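/- Let $n\ge 2$, let $\Omega\subset\mathbb R^n$ be a bounded domain (no smoothness of $\partial\Omega$ is needed), and let $W^{1,n}_0(\Omega)$ be the closure of $C_c^\infty(\Omega)$ in $W^{1,n}(\Omega)$, with $\|u\|^n=\int_\Omega|\nabla u|^n\,dx$. Let $a,b>0$, $m(s)=as+b$, and let $p,q,\beta\in\mathbb R$ satisfy $0<q<n-1$, $2n-1<p+1$ and $1<\beta<\frac{n}{n-1}$. Let $h\in L^{\gamma}(\Omega)$ with $\gamma=\frac{n}{n-q-1}$ be a real function, possibly sign-changing, with $h^+\not\equiv 0$. Put $M(s)=\int_0^s m(\tau)\,d\tau$, $g(s)=s|s|^pe^{|s|^\beta}$, $G(s)=\int_0^s g(\tau)\,d\tau$ and, for $\lambda>0$ and $u\in W^{1,n}_0(\Omega)$, $$J_\lambda(u)=\frac1n M(\|u\|^n)-\frac{\lambda}{q+1}\int_\Omega h|u|^{q+1}\,dx-\int_\Omega G(u)\,dx,\qquad \phi_u(t)=J_\lambda(tu),$$ $$\mathcal N_\lambda=\{u\in W^{1,n}_0(\Omega):\phi_u'(1)=0\},\quad \mathcal N_\lambda^{+}=\{u\in\mathcal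 N_\lambda:\phi_u''(1)>0\},\quad \mathcal N_\lambda^{-}=\{u\in\mathcal N_\lambda:\phi_u''(1)<0\}.$$ Then there is $\lambda_0>0$ such that for every $\lambda\in(0,\lambda_0)$ the problem $$-m(\|u\|^n)\Delta_n u=\lambda h|u|^{q-1}u+u|u|^pe^{|u|^\beta}\ \text{ in }\Omega,\qquad u\ge 0\ \text{ in }\Omega,\qquad u\in W^{1,n}_0(\Omega),$$ has at least two distinct nontrivial weak solutions $u_\lambda$ and $v_\lambda$, where $u_\lambda\in\mathcal N_\lambda^+$ minimizes $J_\lambda$ on $\mathcal N_\lambda^+$ and $v_\lambda\in\mathcal N_\lambda^-$ minimizes $J_\lambda$ on $\mathcal N_\lambda^-$. Here $u$ is a weak solution if, for all $\varphi\in W^{1,n}_0(\Omega)$, $$m(\|u\|^n)\int_\Omega|\nabla u|^{n-2}\nabla u\cdot\nabla\varphi\,dx=\lambda\int_\Omega h|u|^{q-1}u\,\varphi\,dx+\int_\Omega g(u)\varphi\,dx ,$$ with both integrals on the right absolutely convergent. -/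

import Mathlib

open MeasureTheory
open scoped ContDiff Gradient

noncomputable section

namespace Kirchhoff

/-- `ℝⁿ` with the Euclidean norm and inner product. -/
abbrev E (n : ℕ) : Type := EuclideanSpace ℝ (Fin n)

instance factOneLe {n : ℕ} [h : Fact (2 ≤ n)] : Fact (1 ≤ (n : ENNReal)) :=
  ⟨by exact_mod_cast le_trans one_le_two h.out⟩

/-- `φ ∈ C_c^∞(Ω)`. -/
structure IsTest {n : ℕ} (Ω : Set (E n)) (φ : E n → ℝ) : Prop where
  smooth : ContDiff ℝ ∞ φ
  compact : HasCompactSupport φ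
  supp : tsupport φ ⊆ Ω

/-- The space `Lⁿ(Ω) × Lⁿ(Ω; ℝⁿ)`. -/
abbrev PairSpace {n : ℕ} [Fact (2 ≤ n)] (Ω : Set (E n)) : Type :=
  Lp ℝ (n : ENNReal) (volume.restrict Ω) × Lp (E n) (n : ENNReal) (volume.restrict Ω)

/-- The pairs `(φ, ∇φ)` with `φ ∈ C_c^∞(Ω)`, as a subspace of `Lⁿ(Ω) × Lⁿ(Ω; ℝⁿ)`. -/
def testPairs {n : ℕ} [Fact (2 ≤ n)] (Ω : Set (E n)) : Submodule ℝ (PairSpace Ω) where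
  carrier := {w | ∃ φ : E n → ℝ, IsTest Ω φ ∧
    w.1 =ᵐ[volume.restrict Ω] φ ∧ w.2 =ᵐ[volume.restrict Ω] ∇ φ}
  zero_mem' := by
    refine ⟨fun _ => 0, ⟨contDiff_const, HasCompactSupport.zero, ?_⟩, ?_, ?_⟩
    · intro x hx
      have h0 : tsupport (fun _ : E n => (0 : ℝ)) = ∅ := tsupport_eq_empty_iff.2 rfl
      rw [h0] at hx
      exact hx.elim
    · exact Lp.coeFn_zero _ _ _
    · filter_upwards [Lp.coeFn_zero (E n) (n : ENNReal) (volume.restrict Ω)] with x hx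
      simp only [gradient_fun_const]
      exact hx
  add_mem' := by
    rintro v w ⟨φ, hφ, h1, h2⟩ ⟨ψ, hψ, h3, h4⟩
    refine ⟨φ + ψ, ⟨hφ.smooth.add hψ.smooth, hφ.compact.add hψ.compact,
      (tsupport_add φ ψ).trans (Set.union_subset hφ.supp hψ.supp)⟩, ?_, ?_⟩
    · exact (Lp.coeFn_add v.1 w.1).trans (h1.add h3)
    · refine (Lp.coeFn_add v.2 w.2).trans ?_
      filter_upwards [h2, h4] with x hx hy
      have d1 := (hφ.smooth.differentiable (by simp)) x
      have d2 := (hψ.smooth.differentiable (by simp)) x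
      simp only [Pi.add_apply, hx, hy, gradient, fderiv_add d1 d2, map_add]
  smul_mem' := by
    rintro c w ⟨φ, hφ, h1, h2⟩
    refine ⟨c • φ, ⟨contDiff_const.smul hφ.smooth, hφ.compact.smul_left,
      (closure_mono (Function.support_const_smul_subset c φ)).trans hφ.supp⟩, ?_, ?_⟩
    · exact (Lp.coeFn_smul c w.1).trans (h1.const_smul c)
    · refine (Lp.coeFn_smul c w.2).trans ?_
      filter_upwards [h2] with x hx
      have d1 := (hφ.smooth.differentiable (by simp)) x
      simp only [Pi.smul_apply, hx, gradient, fderiv_const_smul d1 c, map_smul]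

/-- `W₀^{1,n}(Ω)`, the closure of `C_c^∞(Ω)` in the Sobolev norm. An element is recorded as the
pair `(u, ∇u)` of its class in `Lⁿ(Ω)` and its weak gradient in `Lⁿ(Ω; ℝⁿ)` (which `u`
determines), so that the Sobolev norm is the norm of the product. -/
def W0 {n : ℕ} [Fact (2 ≤ n)] (Ω : Set (E n)) : Submodule ℝ (PairSpace Ω) :=
  (testPairs Ω).topologicalClosure

section Problem

variable {n : ℕ} [Fact (2 ≤ n)] {Ω : Set (E n)}

/-- The function `u`. -/
def fn (u : W0 Ω) : E n → ℝ := u.1.1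

/-- The weak gradient `∇u`. -/
def grad (u : W0 Ω) : E n → E n := u.1.2

/-- `‖u‖ⁿ = ∫_Ω |∇u|ⁿ`. -/
def normPow (u : W0 Ω) : ℝ := ∫ x in Ω, ‖grad u x‖ ^ n

/-- The Kirchhoff function `m(s) = a s + b`. -/
def m (a b s : ℝ) : ℝ := a * s + b

/-- `M(s) = ∫₀ˢ m`. -/
def M (a b s : ℝ) : ℝ := ∫ τ in (0 : ℝ)..s, m a b τ

/-- `g(s) = s |s|ᵖ exp(|s|^β)`. -/
def g (p β s : ℝ) : ℝ := s * |s| ^ p * Real.exp (|s| ^ β)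

/-- `G(s) = ∫₀ˢ g`. -/
def G (p β s : ℝ) : ℝ := ∫ τ in (0 : ℝ)..s, g p β τ

/-- The energy `J(u) = M(‖u‖ⁿ)/n - λ/(q+1) ∫ h |u|^(q+1) - ∫ G(u)`. -/
def J (a b p q β lam : ℝ) (h : E n → ℝ) (u : W0 Ω) : ℝ :=
  1 / (n : ℝ) * M a b (normPow u)
    - lam / (q + 1) * (∫ x in Ω, h x * |fn u x| ^ (q + 1))
    - (∫ x in Ω, G p β (fn u x))

/-- The fibering map `t ↦ J(t u)`. -/
def fiber (a b p q β lam : ℝ) (h : E n → ℝ) (u : W0 Ω) (t : ℝ) : ℝ :=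
  J a b p q β lam h (t • u)

/-- The Nehari manifold: the derivative of the fibering map of `u` vanishes at `1`. -/
def Nehari (a b p q β lam : ℝ) (h : E n → ℝ) : Set (W0 Ω) :=
  {u | deriv (fiber a b p q β lam h u) 1 = 0}

/-- The part of the Nehari manifold where the second derivative of the fibering map at `1`
is positive. -/
def NehariPlus (a b p q β lam : ℝ) (h : E n → ℝ) : Set (W0 Ω) :=
  {u | u ∈ Nehari a b p q β lam h ∧ 0 < deriv (deriv (fiber a b p q β lam h u)) 1}

/-- The part of the Nehari manifold where the second derivative of the fibering map at `1`
is negative. -/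
def NehariMinus (a b p q β lam : ℝ) (h : E n → ℝ) : Set (W0 Ω) :=
  {u | u ∈ Nehari a b p q β lam h ∧ deriv (deriv (fiber a b p q β lam h u)) 1 < 0}

/-- `u` is a weak solution of `-m(‖u‖ⁿ) Δₙ u = λ h |u|^(q-1) u + g(u)` in `Ω`, `u = 0` on `∂Ω`;
the right-hand integrals are required to converge absolutely. -/
def IsWeakSolution (a b p q β lam : ℝ) (h : E n → ℝ) (u : W0 Ω) : Prop :=
  ∀ φ : W0 Ω,
    IntegrableOn (fun x => h x * (|fn u x| ^ (q - 1) * fn u x) * fn φ x) Ω ∧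
    IntegrableOn (fun x => g p β (fn u x) * fn φ x) Ω ∧
    m a b (normPow u) *
        (∫ x in Ω, ‖grad u x‖ ^ (n - 2) * inner ℝ (grad u x) (grad φ x))
      = lam * (∫ x in Ω, h x * (|fn u x| ^ (q - 1) * fn u x) * fn φ x)
        + (∫ x in Ω, g p β (fn u x) * fn φ x)

/-- A solution of the problem: a nonnegative weak solution. -/
def IsSolution (a b p q β lam : ℝ) (h : E n → ℝ) (u : W0 Ω) : Prop :=
  IsWeakSolution a b p q β lam h u ∧ ∀ᵐ x ∂(volume.restrict Ω), 0 ≤ fn u x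

end Problem

end Kirchhoff

end

/-!
The two solutions are the minimizers of the energy `J` on the two parts of the Nehari manifold; all
of the variational argument takes place on the rays `t ↦ t u`.

On a ray, `φ_u'(t) = P(t u) / t` with `P(u) = a ‖u‖^(2n) + b ‖u‖^n - λ ∫ h |u|^(q+1) - ∫ g(u) u`,
and dividing by `t^q` makes the term in `h` a constant: `ψ(t) = t^(-q-1) P(t u)` has derivative
`t^(-q-2) D(t u)` with `D(u) = (2n-q-1) a ‖u‖^(2n) + (n-q-1) b ‖u‖^n - ∫ (g'(u) u² - q g(u) u)`.
As `g'(s) s² - q g(s) s` is superhomogeneous of degree `p + 2 > 2n`, once `D(t u) ≤ 0` it is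
negative for all larger `t` (`nehariD_smul_neg`). So `ψ` first increases and then decreases, and
`N⁺`, `N⁻` are the points where it crosses zero upwards and downwards (`FiberProfile`). By scaling,
for small `λ` the energy is at least some `c₀ > 0` on a small sphere `‖u‖ = t₀`
(`exists_sphere`). Hence `N⁰` is empty away from `0`, `N⁺` lies in the ball, and a point of `N⁻` has
energy at least `c₀` and maximizes the energy on its ray.

The first solution minimizes `J` on the ball (`exists_solution_nehariPlus`). Since `h⁺ ≢ 0`, some
`u₀` has `∫ h |u₀|^(q+1) > 0`, and `q + 1 < n` makes `J` negative at small multiples of it. So the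
minimum is negative and interior, and the minimizer is a free critical point in `N⁺`. The second is
a minimizer on `N⁻` (`exists_solution_nehariMinus`): a minimizing sequence is bounded, its limit is
nonzero because `D < 0` would otherwise send the sequence, and its energy, to zero, and the limit is
projected onto `N⁻` along its ray. It is critical because rays through nearby points still meet
`N⁻` close by, which makes the first variation nonnegative in every direction. The two solutions
have energies of opposite sign.

The analysis behind this is subcritical, since `β < n/(n-1)`. Truncating between levels and applying
the Sobolev inequality for `W^{1,1}` to each truncation shows that the distribution function of `u`
decays like `exp(-c s^(n/(n-1)))` (`measure_superlevel_le_exp`), so all functionals of growth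
`exp(α |u|^β)` are bounded on balls (`lintegral_exp_fn_le`) and continuous under almost everywhere
convergence of bounded sequences (`tendsto_integral_mul_comp`). Compactness comes from Rellich's theorem
(`exists_subseq_tendsto_fn`) and, in place of weak compactness, Clarkson's inequality
(`exists_normPow_le_of_tendsto`). Minimizing sequences may be replaced by their absolute values in
the limit (`exists_subseq_tendsto_abs`), because `|u| ∈ W₀^{1,n}` has norm at most that of `u`;
therefore the solutions are nonnegative.
-/

noncomputable section

namespace Kirchhoff

/-! ### The Trudinger inequality, by truncation at levels -/

lemma deriv_smoothTransition_eq_zero {x : ℝ} (hx : x ≤ 0 ∨ 1 ≤ x) :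
    deriv Real.smoothTransition x = 0 := by
  rcases hx with h | h
  · apply IsLocalMin.deriv_eq_zero
    filter_upwards with y
    rw [Real.smoothTransition.zero_of_nonpos h]
    exact Real.smoothTransition.nonneg y
  · apply IsLocalMax.deriv_eq_zero
    filter_upwards with y
    rw [Real.smoothTransition.one_of_one_le h]
    exact Real.smoothTransition.le_one y

lemma exists_bound_deriv_smoothTransition :
    ∃ L : ℝ, 0 < L ∧ ∀ x, |deriv Real.smoothTransition x| ≤ L := by
  have hc : Continuous (deriv Real.smoothTransition) :=
    (Real.smoothTransition.contDiff (n := 1)).continuous_deriv le_rfl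
  obtain ⟨B, hB⟩ := isCompact_Icc.exists_bound_of_continuousOn (s := Set.Icc (0 : ℝ) 1) hc.continuousOn
  refine ⟨max B 1, by positivity, fun x => ?_⟩
  by_cases hx : x ∈ Set.Icc (0 : ℝ) 1
  · exact (hB x hx).trans (le_max_left _ _)
  · have hx' : x ≤ 0 ∨ 1 ≤ x := by
      rcases not_and_or.1 hx with h | h
      · exact .inl (not_le.1 h).le
      · exact .inr (not_le.1 h).le
    rw [deriv_smoothTransition_eq_zero hx', abs_zero]; positivity

variable {n : ℕ}

/-- The Sobolev inequality for `W^{1,1}` applied to a smooth truncation of `φ` between the levels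
`s` and `s + h`, followed by Hölder's inequality on the slab where the gradient of the truncation
lives. -/
lemma measure_superlevel_pow_le (hn : 2 ≤ n) :
    ∃ C : ℝ, 0 < C ∧ ∀ φ : E n → ℝ, ContDiff ℝ 1 φ → HasCompactSupport φ →
      ∀ s h : ℝ, 0 ≤ s → 0 < h →
      volume {x | s + h < φ x} ^ (n - 1) ≤ ENNReal.ofReal ((C / h) ^ n) *
        (∫⁻ x in {x | s < φ x ∧ φ x < s + h}, ‖fderiv ℝ φ x‖ₑ ^ n) *
          volume {x | s < φ x} ^ (n - 1) := by
  obtain ⟨L, hL0, hL⟩ := exists_bound_deriv_smoothTransition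
  have hn1 : (1 : ℝ) < n := by exact_mod_cast (by omega : 1 < n)
  have hn0 : (0 : ℝ) < n := by linarith
  set p : ℝ := Real.conjExponent n with hp
  have hpq : Real.HolderConjugate (n : ℝ) p := Real.HolderConjugate.conjExponent hn1
  have hpn : p * ((n - 1 : ℕ) : ℝ) = n := by
    rw [hp, Real.conjExponent, Nat.cast_sub (by omega)]
    field_simp [sub_ne_zero.2 hn1.ne']
    simp
  have hfr : Module.finrank ℝ (E n) = n := by simp
  set S := lintegralPowLePowLIntegralFDerivConst (volume : Measure (E n)) p with hS
  refine ⟨(S + 1) * L, by positivity, fun φ hφ hφc s h hs hh => ?_⟩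
  set χ : E n → ℝ := fun x => Real.smoothTransition ((φ x - s) / h) with hχ
  have hχ1 : ContDiff ℝ 1 χ :=
    Real.smoothTransition.contDiff.comp ((hφ.sub contDiff_const).div_const h)
  have hχc : HasCompactSupport χ := by
    have : χ = (fun y : ℝ => Real.smoothTransition ((y - s) / h)) ∘ φ := rfl
    rw [this]
    refine hφc.comp_left ?_
    exact Real.smoothTransition.zero_of_nonpos (by
      apply div_nonpos_of_nonpos_of_nonneg <;> linarith)
  have hsob := lintegral_pow_le_pow_lintegral_fderiv volume hχ1 hχc (p := p) (by rw [hfr]; exact hpq)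
  have hcont : Continuous φ := hφ.continuous
  have hcontd : Continuous (fderiv ℝ φ) := hφ.continuous_fderiv one_ne_zero
  set T : Set (E n) := {x | s < φ x ∧ φ x < s + h} with hT
  have hTm : MeasurableSet T :=
    ((isOpen_lt continuous_const hcont).inter (isOpen_lt hcont continuous_const)).measurableSet
  -- the truncation is `1` above the level `s + h`
  have h1 : volume {x | s + h < φ x} ≤ ∫⁻ x, ‖χ x‖ₑ ^ p := by
    have hm : MeasurableSet {x | s + h < φ x} := (isOpen_lt continuous_const hcont).measurableSet
    rw [← lintegral_indicator_one hm]
    apply lintegral_mono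
    intro x
    by_cases hx : x ∈ {x | s + h < φ x}
    · have : χ x = 1 := Real.smoothTransition.one_of_one_le (by
        rw [le_div_iff₀ hh]; simp only [Set.mem_ofPred_eq] at hx; linarith)
      simp [hx, this]
    · simp [hx]
  -- its gradient is supported in the slab, where it is at most `L / h` times that of `φ`
  have h2 : ∀ x, ‖fderiv ℝ χ x‖ₑ ≤ T.indicator (fun x => ENNReal.ofReal (L / h) * ‖fderiv ℝ φ x‖ₑ) x := by
    intro x
    have hd : HasFDerivAt χ ((deriv Real.smoothTransition ((φ x - s) / h)) • (h⁻¹ • fderiv ℝ φ x)) x := by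
      have e1 : HasFDerivAt (fun x => (φ x - s) / h) (h⁻¹ • fderiv ℝ φ x) x := by
        have := (((hφ.differentiable one_ne_zero) x).hasFDerivAt.sub_const s).const_smul h⁻¹
        refine this.congr_of_eventuallyEq (Filter.Eventually.of_forall fun y => ?_)
        simp [div_eq_inv_mul]
      have e2 := ((Real.smoothTransition.contDiff (n := 1)).differentiable one_ne_zero
        ((φ x - s) / h)).hasDerivAt
      exact e2.comp_hasFDerivAt x e1
    rw [hd.fderiv]
    by_cases hx : x ∈ T
    · rw [Set.indicator_of_mem hx, smul_smul, enorm_smul]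
      gcongr
      rw [← ofReal_norm]
      apply ENNReal.ofReal_le_ofReal
      rw [Real.norm_eq_abs, abs_mul, abs_of_pos (inv_pos.2 hh), div_eq_mul_inv]
      exact mul_le_mul_of_nonneg_right (hL _) (inv_nonneg.2 hh.le)
    · rw [deriv_smoothTransition_eq_zero]
      · rw [enorm_smul]; simp
      · simp only [hT, Set.mem_ofPred_eq, not_and_or, not_lt] at hx
        rcases hx with h' | h'
        · left; apply div_nonpos_of_nonpos_of_nonneg <;> linarith
        · right; rw [le_div_iff₀ hh]; linarith
  have h3 : ∫⁻ x, ‖fderiv ℝ χ x‖ₑ ≤ ENNReal.ofReal (L / h) * ∫⁻ x in T, ‖fderiv ℝ φ x‖ₑ := by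
    refine (lintegral_mono h2).trans ?_
    rw [lintegral_indicator hTm, lintegral_const_mul]
    exact hcontd.enorm.measurable
  have h4 : (∫⁻ x in T, ‖fderiv ℝ φ x‖ₑ) ^ n ≤
      (∫⁻ x in T, ‖fderiv ℝ φ x‖ₑ ^ n) * volume {x | s < φ x} ^ (n - 1) := by
    have := ENNReal.lintegral_mul_le_Lp_mul_Lq (volume.restrict T) hpq
      (f := fun x => ‖fderiv ℝ φ x‖ₑ) (g := fun _ => 1) hcontd.enorm.aemeasurable
      aemeasurable_const
    simp only [Pi.mul_apply, mul_one, ENNReal.one_rpow, lintegral_const, one_mul,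
      Measure.restrict_apply_univ] at this
    calc _ ≤ ((∫⁻ x in T, ‖fderiv ℝ φ x‖ₑ ^ (n : ℝ)) ^ (1 / (n : ℝ)) * volume T ^ (1 / p)) ^ n := by
          gcongr
      _ = (∫⁻ x in T, ‖fderiv ℝ φ x‖ₑ ^ n) * volume T ^ (n - 1) := by
          rw [mul_pow]
          congr 1
          · simp only [ENNReal.rpow_natCast]
            rw [← ENNReal.rpow_natCast, ← ENNReal.rpow_mul, one_div_mul_cancel hn0.ne',
              ENNReal.rpow_one]
          · rw [← ENNReal.rpow_natCast, ← ENNReal.rpow_mul, ← ENNReal.rpow_natCast]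
            congr 1
            rw [← hpn]; field_simp [hpq.symm.pos.ne']
      _ ≤ _ := by
          gcongr
          exact fun x hx => hx.1
  calc volume {x | s + h < φ x} ^ (n - 1) ≤ (S * (∫⁻ x, ‖fderiv ℝ χ x‖ₑ) ^ p) ^ (n - 1) := by
        gcongr
        exact h1.trans hsob
    _ = (S : ENNReal) ^ (n - 1) * (∫⁻ x, ‖fderiv ℝ χ x‖ₑ) ^ n := by
        rw [mul_pow]
        congr 1
        rw [← ENNReal.rpow_natCast, ← ENNReal.rpow_mul, hpn, ENNReal.rpow_natCast]
    _ ≤ (ENNReal.ofReal (S + 1)) ^ n * (ENNReal.ofReal (L / h) * ∫⁻ x in T, ‖fderiv ℝ φ x‖ₑ) ^ n := by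
        refine mul_le_mul' ?_ (by gcongr)
        calc (S : ENNReal) ^ (n - 1) ≤ (ENNReal.ofReal (S + 1)) ^ (n - 1) := by
              gcongr
              rw [ENNReal.le_ofReal_iff_toReal_le (by simp) (by positivity)]
              simp
          _ ≤ _ := by
              gcongr
              · simp
              · omega
    _ ≤ (ENNReal.ofReal (S + 1)) ^ n * (ENNReal.ofReal (L / h) ^ n *
          ((∫⁻ x in T, ‖fderiv ℝ φ x‖ₑ ^ n) * volume {x | s < φ x} ^ (n - 1))) := by
        rw [mul_pow (ENNReal.ofReal (L / h))]
        gcongr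
    _ = _ := by
        rw [← mul_assoc, ← mul_pow, ← ENNReal.ofReal_mul (by positivity),
          ENNReal.ofReal_pow (by positivity), ← mul_assoc, mul_div_assoc]

/-- Exponential decay of the distribution function: multiply the estimates for `N` consecutive
slabs and bound the product of the slab energies by the arithmetic-geometric mean inequality. -/
lemma measure_superlevel_le_exp (hn : 2 ≤ n) (K : ℝ) (hK : 0 < K) :
    ∃ C : ℝ, 0 < C ∧ ∀ φ : E n → ℝ, ContDiff ℝ 1 φ → HasCompactSupport φ →
      ∫ x, ‖fderiv ℝ φ x‖ ^ n ≤ K → ∀ N : ℕ, 1 ≤ N →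
      volume.real {x | C * (N : ℝ) ^ (1 - 1 / (n : ℝ)) < φ x} ≤
        volume.real (Function.support φ) * Real.exp (-N) := by
  obtain ⟨C, hC, hstep⟩ := measure_superlevel_pow_le hn
  have hn1 : (1 : ℝ) < n := by exact_mod_cast (by omega : 1 < n)
  have hn0 : (0 : ℝ) < n := by linarith
  -- The level step `h = B N^(-1/n)` is chosen so that `N h = B N^(1-1/n)` and the mean of the factors
  -- `(C/h)^n d_j`, at most `(C/h)^n K / N`, equals `exp (-(n-1))`.
  set B : ℝ := C * (K * Real.exp (n - 1)) ^ (1 / (n : ℝ)) with hB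
  have hB0 : 0 < B := by positivity
  have hBn : B ^ n = C ^ n * (K * Real.exp (n - 1)) := by
    rw [hB, mul_pow, one_div, Real.rpow_inv_natCast_pow (by positivity) (by omega)]
  refine ⟨B, hB0, fun φ hφ hφc hKφ N hN => ?_⟩
  have hN0 : (0 : ℝ) < N := by exact_mod_cast hN
  have hcont : Continuous φ := hφ.continuous
  have hcontd : Continuous (fderiv ℝ φ) := hφ.continuous_fderiv one_ne_zero
  set h : ℝ := B * (N : ℝ) ^ (-(1 / (n : ℝ))) with hh
  have hh0 : 0 < h := by positivity
  have hhn : h ^ n * N = B ^ n := by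
    rw [hh, mul_pow, Real.rpow_neg hN0.le, inv_pow, one_div,
      Real.rpow_inv_natCast_pow hN0.le (by omega)]
    field_simp
  have hint : Integrable (fun x => ‖fderiv ℝ φ x‖ ^ n) := by
    apply Continuous.integrable_of_hasCompactSupport (by fun_prop)
    exact (hφc.fderiv (𝕜 := ℝ)).norm.comp_left (g := fun y : ℝ => y ^ n)
      (by rw [zero_pow]; omega)
  set a : ℕ → ℝ := fun j => volume.real {x | j * h < φ x} with ha
  set T : ℕ → Set (E n) := fun j => {x | j * h < φ x ∧ φ x < j * h + h} with hT
  set d : ℕ → ℝ := fun j => ∫ x in T j, ‖fderiv ℝ φ x‖ ^ n with hd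
  have hTm : ∀ j, MeasurableSet (T j) := fun j =>
    ((isOpen_lt continuous_const hcont).inter (isOpen_lt hcont continuous_const)).measurableSet
  have hd0 : ∀ j, 0 ≤ d j := fun j => integral_nonneg fun x => by positivity
  have hsub : ∀ s : ℝ, 0 ≤ s → {x | s < φ x} ⊆ Function.support φ := fun s hs x hx => by
    simp only [Set.mem_ofPred_eq] at hx
    exact (lt_of_le_of_lt hs hx).ne'
  have hsupp : volume (Function.support φ) ≠ ⊤ :=
    ((measure_mono (subset_tsupport φ)).trans_lt hφc.isCompact.measure_lt_top).ne
  have hfin : ∀ s : ℝ, 0 ≤ s → volume {x | s < φ x} ≠ ⊤ := fun s hs =>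
    ((measure_mono (hsub s hs)).trans_lt hsupp.lt_top).ne
  have hrec : ∀ j, a (j + 1) ^ (n - 1) ≤ ((C / h) ^ n * d j) * a j ^ (n - 1) := by
    intro j
    have hjh : 0 ≤ j * h := by positivity
    have := hstep φ hφ hφc (j * h) h hjh hh0
    have hdl : ∫⁻ x in T j, ‖fderiv ℝ φ x‖ₑ ^ n = ENNReal.ofReal (d j) := by
      rw [hd, ofReal_integral_eq_lintegral_ofReal hint.integrableOn
        (Filter.Eventually.of_forall fun x => by positivity)]
      congr 1 with x
      rw [ENNReal.ofReal_pow (norm_nonneg _), ofReal_norm]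
    rw [hdl] at this
    have h5 := ENNReal.toReal_mono (by finiteness [hfin _ hjh]) this
    simp only [ENNReal.toReal_mul, ENNReal.toReal_pow, ENNReal.toReal_ofReal (hd0 j)] at h5
    rw [ENNReal.toReal_ofReal (by positivity)] at h5
    have e : {x | ((j + 1 : ℕ) : ℝ) * h < φ x} = {x | j * h + h < φ x} := by
      ext x; simp only [Set.mem_ofPred_eq]; push_cast; rw [add_one_mul]
    simp only [ha, e]
    exact h5
  have ha0 : ∀ j, 0 ≤ a j := fun j => measureReal_nonneg
  have hprod : ∀ k, a k ^ (n - 1) ≤ (∏ j ∈ Finset.range k, (C / h) ^ n * d j) * a 0 ^ (n - 1) := by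
    intro k
    induction k with
    | zero => simp
    | succ k ih =>
      rw [Finset.prod_range_succ]
      calc _ ≤ _ := hrec k
        _ ≤ ((C / h) ^ n * d k) * ((∏ j ∈ Finset.range k, (C / h) ^ n * d j) * a 0 ^ (n - 1)) := by
          have := hd0 k
          gcongr
        _ = _ := by ring
  have hsum : ∑ j ∈ Finset.range N, d j ≤ K := by
    refine le_trans ?_ hKφ
    rw [hd, ← integral_biUnion_finset (Finset.range N) (fun i _ => hTm i) ?_
      (fun i _ => hint.integrableOn)]
    · exact setIntegral_le_integral hint (Filter.Eventually.of_forall fun x => by positivity)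
    · intro i _ j _ hij
      refine Set.disjoint_left.2 fun x hx hy => hij ?_
      simp only [hT, Set.mem_ofPred_eq] at hx hy
      have l1 : (i : ℝ) * h < (j + 1) * h := by rw [add_one_mul]; linarith
      have l2 : (j : ℝ) * h < (i + 1) * h := by rw [add_one_mul]; linarith
      have l3 : i < j + 1 := by exact_mod_cast lt_of_mul_lt_mul_right l1 hh0.le
      have l4 : j < i + 1 := by exact_mod_cast lt_of_mul_lt_mul_right l2 hh0.le
      omega
  have hamgm : ∏ j ∈ Finset.range N, (C / h) ^ n * d j ≤ Real.exp (-(n - 1)) ^ N := by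
    have hz : ∀ j ∈ Finset.range N, 0 ≤ (C / h) ^ n * d j := fun j _ => by
      have := hd0 j; positivity
    have key := Real.geom_mean_le_arith_mean (Finset.range N) (fun _ => 1)
      (fun j => (C / h) ^ n * d j) (fun _ _ => zero_le_one) (by simp; omega) hz
    simp only [Real.rpow_one, Finset.sum_const, Finset.card_range, nsmul_eq_mul, mul_one,
      one_mul] at key
    have hP : 0 ≤ ∏ j ∈ Finset.range N, (C / h) ^ n * d j := Finset.prod_nonneg hz
    rw [← Real.rpow_inv_natCast_pow hP (by omega : N ≠ 0)]
    gcongr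
    refine key.trans ?_
    rw [← Finset.mul_sum, div_le_iff₀ hN0]
    calc (C / h) ^ n * ∑ j ∈ Finset.range N, d j ≤ (C / h) ^ n * K := by gcongr
      _ = _ := by
        have hpos : 0 < h ^ n := by positivity
        have : h ^ n * N = C ^ n * (K * Real.exp (n - 1)) := by rw [hhn, hBn]
        rw [div_pow, Real.exp_neg]
        field_simp
        linear_combination this.symm
  have hfinal : a N ^ (n - 1) ≤ (volume.real (Function.support φ) * Real.exp (-N)) ^ (n - 1) := by
    calc a N ^ (n - 1) ≤ Real.exp (-(n - 1)) ^ N * a 0 ^ (n - 1) :=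
          (hprod N).trans (by gcongr)
      _ ≤ Real.exp (-(n - 1)) ^ N * volume.real (Function.support φ) ^ (n - 1) := by
          gcongr
          exact measureReal_mono (hsub _ (by simp)) hsupp
      _ = _ := by
          rw [mul_pow, mul_comm, ← Real.exp_nat_mul, ← Real.exp_nat_mul, Nat.cast_sub (by omega)]
          congr 2
          push_cast
          ring
  have hlast : a N ≤ volume.real (Function.support φ) * Real.exp (-N) :=
    le_of_pow_le_pow_left₀ (by omega) (by positivity) hfinal
  have e : (N : ℝ) * h = B * (N : ℝ) ^ (1 - 1 / (n : ℝ)) := by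
    rw [hh, sub_eq_add_neg, Real.rpow_add hN0, Real.rpow_one]; ring
  simpa only [ha, e] using hlast

lemma summable_exp_rpow_sub (A σ : ℝ) (hσ : σ < 1) :
    Summable fun N : ℕ => Real.exp (A * ((N : ℝ) + 1) ^ σ) * Real.exp (-N) := by
  have hlit : (fun N : ℕ => A * ((N : ℝ) + 1) ^ σ) =o[Filter.atTop] fun N : ℕ => (N : ℝ) + 1 := by
    refine Asymptotics.IsLittleO.const_mul_left ?_ A
    have h1 : (fun x : ℝ => x ^ σ) =o[Filter.atTop] fun x : ℝ => x := by
      rw [Asymptotics.isLittleO_iff_tendsto' (by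
        filter_upwards [Filter.eventually_gt_atTop 0] with x hx h0 using absurd h0 hx.ne')]
      refine (tendsto_rpow_neg_atTop (sub_pos.2 hσ)).congr' ?_
      filter_upwards [Filter.eventually_gt_atTop 0] with x hx
      rw [neg_sub, Real.rpow_sub_one hx.ne']
    exact h1.comp_tendsto
      (Filter.tendsto_atTop_add_const_right _ _ tendsto_natCast_atTop_atTop)
  have hsum : Summable fun N : ℕ => Real.exp (1 / 2) * Real.exp (-(1 / 2) * N) := by
    refine Summable.mul_left _ ?_
    have : (fun N : ℕ => Real.exp (-(1 / 2) * N)) = fun N : ℕ => Real.exp (-(1 / 2)) ^ N := by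
      ext N; rw [← Real.exp_nat_mul, mul_comm]
    rw [this]
    exact summable_geometric_of_lt_one (Real.exp_pos _).le (by rw [Real.exp_lt_one_iff]; norm_num)
  refine hsum.of_norm_bounded_eventually_nat ?_
  filter_upwards [hlit.bound (show (0 : ℝ) < 1 / 2 by norm_num)] with N hN
  rw [Real.norm_eq_abs, abs_of_pos (by positivity), ← Real.exp_add, ← Real.exp_add]
  apply Real.exp_le_exp.2
  have h1 := le_abs_self (A * ((N : ℝ) + 1) ^ σ)
  rw [Real.norm_eq_abs, Real.norm_eq_abs, abs_of_nonneg (by positivity : (0:ℝ) ≤ N + 1)] at hN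
  linarith

/-- Subcritical Trudinger inequality: every exponential moment of `|φ|^β` with `β < n/(n-1)` is
bounded in terms of the Dirichlet energy alone. -/
lemma lintegral_exp_le (hn : 2 ≤ n) {Ω : Set (E n)} (hΩ : volume Ω ≠ ⊤) {β : ℝ} (hβ : 0 < β)
    (hβn : β < (n : ℝ) / ((n : ℝ) - 1)) (α : ℝ) (hα : 0 ≤ α) (K : ℝ) :
    ∃ C : ℝ, 0 ≤ C ∧ ∀ φ : E n → ℝ, ContDiff ℝ 1 φ → HasCompactSupport φ →
      Function.support φ ⊆ Ω → ∫ x, ‖fderiv ℝ φ x‖ ^ n ≤ K →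
      ∫⁻ x in Ω, ENNReal.ofReal (Real.exp (α * |φ x| ^ β)) ≤ ENNReal.ofReal C := by
  have hn1 : (1 : ℝ) < n := by exact_mod_cast (by omega : 1 < n)
  have hn0 : (0 : ℝ) < n := by linarith
  obtain ⟨C, hC, htail⟩ := measure_superlevel_le_exp hn (max K 1) (by positivity)
  set θ : ℝ := 1 - 1 / (n : ℝ) with hθ
  have hθ0 : 0 < θ := by rw [hθ, sub_pos, div_lt_one hn0]; exact hn1
  have hθβ : θ * β < 1 := by
    rw [lt_div_iff₀ (by linarith)] at hβn
    rw [hθ, one_sub_div hn0.ne', div_mul_eq_mul_div, div_lt_one hn0]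
    linarith
  set V : ℝ := volume.real Ω
  set t : ℕ → ℝ := fun N => Real.exp (α * (C * ((N : ℝ) + 1) ^ θ) ^ β) with ht
  have hsum : Summable fun N : ℕ => t N * (2 * V * Real.exp (-N)) := by
    have := (summable_exp_rpow_sub (α * C ^ β) (θ * β) hθβ).mul_left (2 * V)
    refine this.congr fun N => ?_
    have e : (C * ((N : ℝ) + 1) ^ θ) ^ β = C ^ β * ((N : ℝ) + 1) ^ (θ * β) := by
      rw [Real.mul_rpow hC.le (by positivity), ← Real.rpow_mul (by positivity)]
    rw [ht]
    simp only [e]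
    rw [mul_assoc α]; ring
  have hnn : ∀ N : ℕ, 0 ≤ t N * (2 * V * Real.exp (-N)) := fun N => by
    have : 0 ≤ V := measureReal_nonneg
    positivity
  refine ⟨∑' N, t N * (2 * V * Real.exp (-N)), tsum_nonneg hnn, fun φ hφ hφc hφs hφK => ?_⟩
  have hcont : Continuous φ := hφ.continuous
  -- If `M` is the first index with `|φ x| ≤ C (M + 1)^θ`, then `x ∈ A M` and the integrand at `x` is at
  -- most `t M`; the set `A 0` is everything, so that this includes `M = 0`. The factor `2` in the bound
  -- for the measure of `A N` accounts for the two signs of `φ`.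
  set A : ℕ → Set (E n) := fun N => {x | N = 0 ∨ C * (N : ℝ) ^ θ < |φ x|} with hA
  have hAm : ∀ N, MeasurableSet (A N) := fun N => by
    by_cases hN : N = 0
    · simp [hA, hN]
    · simp only [hA, hN, false_or]
      exact (isOpen_lt continuous_const hcont.abs).measurableSet
  have hpt : ∀ x, ENNReal.ofReal (Real.exp (α * |φ x| ^ β)) ≤
      ∑' N, (A N).indicator (fun _ => ENNReal.ofReal (t N)) x := by
    intro x
    have hex : ∃ M : ℕ, |φ x| ≤ C * ((M : ℝ) + 1) ^ θ := by
      have : Filter.Tendsto (fun M : ℕ => C * ((M : ℝ) + 1) ^ θ) Filter.atTop Filter.atTop :=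
        ((tendsto_rpow_atTop hθ0).comp (Filter.tendsto_atTop_add_const_right _ _
          tendsto_natCast_atTop_atTop)).const_mul_atTop hC
      exact (this.eventually_ge_atTop _).exists
    classical
    have hM := Nat.find_spec hex
    set M := Nat.find hex with hMdef
    have hxA : x ∈ A M := by
      rcases Nat.eq_zero_or_pos M with h0 | h0
      · exact Or.inl h0
      · right
        have := Nat.find_min hex (m := M - 1) (by omega)
        rw [Nat.cast_sub (by omega)] at this
        simpa using this
    calc _ ≤ ENNReal.ofReal (t M) := by
          apply ENNReal.ofReal_le_ofReal
          rw [ht, Real.exp_le_exp]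
          exact mul_le_mul_of_nonneg_left
            (Real.rpow_le_rpow (abs_nonneg _) hM hβ.le) hα
      _ = (A M).indicator (fun _ => ENNReal.ofReal (t M)) x := by rw [Set.indicator_of_mem hxA]
      _ ≤ _ := ENNReal.le_tsum M
  have hmeas : ∀ N, volume (A N ∩ Ω) ≤ ENNReal.ofReal (2 * V * Real.exp (-N)) := by
    intro N
    rw [← ENNReal.toReal_le_toReal ((measure_mono Set.inter_subset_right).trans_lt hΩ.lt_top).ne
      ENNReal.ofReal_ne_top, ENNReal.toReal_ofReal (by positivity)]
    by_cases hN : N = 0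
    · subst hN
      have hle : volume.real (A 0 ∩ Ω) ≤ V := measureReal_mono Set.inter_subset_right hΩ
      have : 0 ≤ V := measureReal_nonneg
      simp only [measureReal_def] at hle
      simp only [CharP.cast_eq_zero, neg_zero, Real.exp_zero, mul_one]
      linarith
    · have hsV : ∀ ψ : E n → ℝ, Function.support ψ ⊆ Ω →
          volume.real (Function.support ψ) ≤ V := fun ψ hψ => measureReal_mono hψ hΩ
      have h1 := htail φ hφ hφc (hφK.trans (le_max_left _ _)) N (by omega)
      have h2 := htail (-φ) hφ.neg hφc.neg (by
        simp only [fderiv_neg, norm_neg]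
        exact hφK.trans (le_max_left _ _)) N (by omega)
      have hsub : A N ∩ Ω ⊆ {x | C * (N : ℝ) ^ θ < φ x} ∪ {x | C * (N : ℝ) ^ θ < (-φ) x} := by
        rintro x ⟨hx, -⟩
        rcases hx with hx | hx
        · exact absurd hx hN
        · exact lt_abs.1 hx
      have hs' : Function.support (-φ) = Function.support φ := Function.support_neg φ
      rw [hs'] at h2
      have hC0 : 0 ≤ C * (N : ℝ) ^ θ := by positivity
      have hfinU : volume ({x | C * (N : ℝ) ^ θ < φ x} ∪ {x | C * (N : ℝ) ^ θ < (-φ) x}) ≠ ⊤ := by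
        refine ((measure_mono ?_).trans_lt hΩ.lt_top).ne
        rintro x (hx | hx)
        · exact hφs (lt_of_le_of_lt hC0 hx).ne'
        · apply hφs; rw [← hs']; exact (lt_of_le_of_lt hC0 hx).ne'
      have h3 : volume.real (A N ∩ Ω) ≤ _ := measureReal_mono hsub hfinU
      have h4 := h3.trans (measureReal_union_le _ _)
      have h5 := hsV φ hφs
      have h6 : volume.real (Function.support φ) * Real.exp (-N) ≤ V * Real.exp (-N) := by gcongr
      change volume.real (A N ∩ Ω) ≤ _
      linarith
  calc ∫⁻ x in Ω, ENNReal.ofReal (Real.exp (α * |φ x| ^ β))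
      ≤ ∫⁻ x in Ω, ∑' N, (A N).indicator (fun _ => ENNReal.ofReal (t N)) x := lintegral_mono hpt
    _ = ∑' N, ∫⁻ x in Ω, (A N).indicator (fun _ => ENNReal.ofReal (t N)) x :=
        lintegral_tsum fun N => (measurable_const.indicator (hAm N)).aemeasurable
    _ = ∑' N, ENNReal.ofReal (t N) * volume (A N ∩ Ω) := by
        congr 1 with N
        rw [lintegral_indicator_const (hAm N), Measure.restrict_apply (hAm N)]
    _ ≤ ∑' N, ENNReal.ofReal (t N * (2 * V * Real.exp (-N))) := by
        refine ENNReal.tsum_le_tsum fun N => ?_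
        rw [ENNReal.ofReal_mul (by positivity)]
        gcongr
        exact hmeas N
    _ = _ := (ENNReal.ofReal_tsum_of_nonneg hnn hsum).symm

/-! ### The space `W₀^{1,n}(Ω)` and its Dirichlet energy -/

section Auxiliary

variable {n : ℕ} {Ω : Set (E n)}

/-- Clarkson's inequality in an inner product space, from the parallelogram law and convexity. -/
lemma _root_.norm_half_add_pow_add_le {F : Type*} [NormedAddCommGroup F] [InnerProductSpace ℝ F]
    {k : ℕ} (hk : 2 ≤ k) (x y : F) :
    ‖(1 / 2 : ℝ) • (x + y)‖ ^ k + ‖(1 / 2 : ℝ) • (x - y)‖ ^ k ≤ (‖x‖ ^ k + ‖y‖ ^ k) / 2 := by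
  have hr : (1 : ℝ) ≤ (k : ℝ) / 2 := by
    rw [le_div_iff₀ two_pos]; exact_mod_cast (by omega : 1 * 2 ≤ k)
  have key : ∀ z : F, ‖z‖ ^ k = (‖z‖ ^ 2) ^ ((k : ℝ) / 2) := fun z => by
    rw [← Real.rpow_natCast, ← Real.rpow_natCast, ← Real.rpow_mul (norm_nonneg _)]
    congr 1; push_cast; ring
  have hpar : ‖(1 / 2 : ℝ) • (x + y)‖ ^ 2 + ‖(1 / 2 : ℝ) • (x - y)‖ ^ 2 =
      (1 / 2) * ‖x‖ ^ 2 + (1 / 2) * ‖y‖ ^ 2 := by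
    have := parallelogram_law_with_norm ℝ x y
    rw [norm_smul, norm_smul, mul_pow, mul_pow, Real.norm_eq_abs, abs_of_pos (by norm_num)]
    linear_combination this / 4
  rw [key, key ((1 / 2 : ℝ) • (x - y)), key x, key y]
  calc _ ≤ _ := Real.add_rpow_le_rpow_add (by positivity) (by positivity) hr
    _ = ((1 / 2) * ‖x‖ ^ 2 + (1 / 2) * ‖y‖ ^ 2) ^ ((k : ℝ) / 2) := by rw [hpar]
    _ ≤ (1 / 2) * (‖x‖ ^ 2) ^ ((k : ℝ) / 2) + (1 / 2) * (‖y‖ ^ 2) ^ ((k : ℝ) / 2) := by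
        have := (convexOn_rpow hr).2 (Set.mem_Ici.2 (by positivity : 0 ≤ ‖x‖ ^ 2))
          (Set.mem_Ici.2 (by positivity : 0 ≤ ‖y‖ ^ 2)) (by norm_num : (0 : ℝ) ≤ 1 / 2)
          (by norm_num : (0 : ℝ) ≤ 1 / 2) (by norm_num)
        simpa only [smul_eq_mul] using this
    _ = _ := by ring

lemma _root_.Real.exists_rpow_le_mul_exp_rpow (r : ℝ) (hr : 0 ≤ r) {β : ℝ} (hβ : 0 < β) :
    ∃ C : ℝ, 0 < C ∧ ∀ s : ℝ, 0 ≤ s → s ^ r ≤ C * Real.exp (s ^ β) := by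
  obtain ⟨k, hk⟩ := exists_nat_ge (r / β)
  refine ⟨1 + k.factorial, by positivity, fun s hs => ?_⟩
  have hsb : 0 ≤ s ^ β := Real.rpow_nonneg hs _
  have h1 : s ^ r = (s ^ β) ^ (r / β) := by
    rw [← Real.rpow_mul hs, mul_div_cancel₀ _ hβ.ne']
  have h2 : (s ^ β) ^ (r / β) ≤ 1 + (s ^ β) ^ k := by
    rcases le_total (s ^ β) 1 with h | h
    · have := Real.rpow_le_one hsb h (by positivity : 0 ≤ r / β)
      have : 0 ≤ (s ^ β) ^ k := by positivity
      linarith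
    · have := Real.rpow_le_rpow_of_exponent_le h hk
      rw [Real.rpow_natCast] at this
      linarith
  have h3 := Real.pow_div_factorial_le_exp (s ^ β) hsb k
  rw [div_le_iff₀ (by positivity)] at h3
  have h4 := Real.one_le_exp hsb
  rw [h1]
  linarith

lemma isTest_continuous_gradient {φ : E n → ℝ} (hφ : IsTest Ω φ) : Continuous (∇ φ) := by
  unfold gradient
  exact (InnerProductSpace.toDual ℝ (E n)).symm.continuous.comp
    (hφ.smooth.continuous_fderiv (by simp))

lemma norm_gradient (φ : E n → ℝ) (x : E n) : ‖∇ φ x‖ = ‖fderiv ℝ φ x‖ := by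
  simp [gradient]

lemma hasCompactSupport_gradient {φ : E n → ℝ} (hφ : IsTest Ω φ) : HasCompactSupport (∇ φ) := by
  have := (hφ.compact.fderiv (𝕜 := ℝ)).comp_left
    (g := fun y => (InnerProductSpace.toDual ℝ (E n)).symm y) (map_zero _)
  exact this

end Auxiliary

section Space

variable {n : ℕ} [hn : Fact (2 ≤ n)] {Ω : Set (E n)}

lemma fn_add (u v : W0 Ω) : fn (u + v) =ᵐ[volume.restrict Ω] fun x => fn u x + fn v x :=
  Lp.coeFn_add u.1.1 v.1.1

lemma grad_add (u v : W0 Ω) : grad (u + v) =ᵐ[volume.restrict Ω] fun x => grad u x + grad v x :=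
  Lp.coeFn_add u.1.2 v.1.2

lemma fn_smul (t : ℝ) (u : W0 Ω) : fn (t • u) =ᵐ[volume.restrict Ω] fun x => t * fn u x :=
  Lp.coeFn_smul t u.1.1

lemma grad_smul (t : ℝ) (u : W0 Ω) : grad (t • u) =ᵐ[volume.restrict Ω] fun x => t • grad u x :=
  Lp.coeFn_smul t u.1.2

lemma memLp_fn (u : W0 Ω) : MemLp (fn u) n (volume.restrict Ω) := Lp.memLp u.1.1

lemma memLp_grad (u : W0 Ω) : MemLp (grad u) n (volume.restrict Ω) := Lp.memLp u.1.2

lemma aestronglyMeasurable_fn (u : W0 Ω) : AEStronglyMeasurable (fn u) (volume.restrict Ω) :=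
  (memLp_fn u).1

lemma aestronglyMeasurable_grad (u : W0 Ω) : AEStronglyMeasurable (grad u) (volume.restrict Ω) :=
  (memLp_grad u).1

lemma integrable_grad_pow (u : W0 Ω) :
    Integrable (fun x => ‖grad u x‖ ^ n) (volume.restrict Ω) :=
  (memLp_grad u).integrable_norm_pow (by have := hn.out; omega)

lemma integrable_fn_pow (u : W0 Ω) :
    Integrable (fun x => |fn u x| ^ n) (volume.restrict Ω) :=
  (memLp_fn u).integrable_norm_pow (by have := hn.out; omega)

lemma norm_pow_eq_integral {F : Type*} [NormedAddCommGroup F] (f : Lp F (n : ENNReal) (volume.restrict Ω)) :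
    ‖f‖ ^ n = ∫ x in Ω, ‖f x‖ ^ n := by
  have h2 := hn.out
  rw [Lp.norm_def, (Lp.memLp f).eLpNorm_eq_integral_rpow_norm (by simp; omega) (by simp),
    ENNReal.toReal_ofReal (by positivity)]
  simp only [ENNReal.toReal_natCast, Real.rpow_natCast]
  exact Real.rpow_inv_natCast_pow (integral_nonneg fun x => by positivity) (by omega)

lemma normPow_eq (u : W0 Ω) : normPow u = ‖u.1.2‖ ^ n := (norm_pow_eq_integral u.1.2).symm

lemma normPow_nonneg (u : W0 Ω) : 0 ≤ normPow u := by rw [normPow_eq]; positivity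

lemma continuous_normPow : Continuous (normPow : W0 Ω → ℝ) := by
  have : (normPow : W0 Ω → ℝ) = fun u => ‖u.1.2‖ ^ n := funext normPow_eq
  rw [this]; fun_prop

lemma normPow_smul (t : ℝ) (u : W0 Ω) : normPow (t • u) = |t| ^ n * normPow u := by
  rw [normPow_eq, normPow_eq]
  have : (t • u).1.2 = t • u.1.2 := rfl
  rw [this, norm_smul, mul_pow, Real.norm_eq_abs]

lemma normPow_zero : normPow (0 : W0 Ω) = 0 := by
  have := normPow_smul (0 : ℝ) (0 : W0 Ω)
  rwa [smul_zero, abs_zero, zero_pow (by have := hn.out; omega), zero_mul] at this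

/-- Clarkson's inequality for the Dirichlet energy, which makes it uniformly convex. -/
lemma normPow_clarkson (u v : W0 Ω) :
    normPow ((1 / 2 : ℝ) • (u + v)) + normPow ((1 / 2 : ℝ) • (u - v)) ≤
      (normPow u + normPow v) / 2 := by
  have e : ∀ w : W0 Ω, ∫ x in Ω, ‖grad w x‖ ^ n = normPow w := fun _ => rfl
  have h2 : grad (u - v) =ᵐ[volume.restrict Ω] fun x => grad u x - grad v x :=
    Lp.coeFn_sub u.1.2 v.1.2
  simp only [← e]
  rw [← integral_add (integrable_grad_pow _) (integrable_grad_pow _),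
    ← integral_add (integrable_grad_pow _) (integrable_grad_pow _), ← integral_div]
  refine integral_mono_ae ((integrable_grad_pow _).add (integrable_grad_pow _))
    (((integrable_grad_pow _).add (integrable_grad_pow _)).div_const _) ?_
  filter_upwards [grad_smul (1 / 2) (u + v), grad_smul (1 / 2) (u - v), grad_add u v, h2]
    with x h3 h4 h5 h6
  simp only [h3, h4, h5, h6]
  exact norm_half_add_pow_add_le hn.out _ _

/-- A test function, as an element of `W₀^{1,n}(Ω)`. -/
lemma exists_of_isTest {φ : E n → ℝ} (hφ : IsTest Ω φ) :
    ∃ w : W0 Ω, fn w =ᵐ[volume.restrict Ω] φ ∧ grad w =ᵐ[volume.restrict Ω] ∇ φ := by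
  have h1 : MemLp φ n (volume.restrict Ω) :=
    (hφ.smooth.continuous.memLp_of_hasCompactSupport hφ.compact).restrict Ω
  have h2 : MemLp (∇ φ) n (volume.restrict Ω) :=
    ((isTest_continuous_gradient hφ).memLp_of_hasCompactSupport
      (hasCompactSupport_gradient hφ)).restrict Ω
  refine ⟨⟨(h1.toLp φ, h2.toLp (∇ φ)), ?_⟩, h1.coeFn_toLp, h2.coeFn_toLp⟩
  exact (testPairs Ω).le_topologicalClosure ⟨φ, hφ, h1.coeFn_toLp, h2.coeFn_toLp⟩

lemma exists_seq_isTest (u : W0 Ω) : ∃ (φ : ℕ → E n → ℝ) (w : ℕ → W0 Ω),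
    (∀ k, IsTest Ω (φ k) ∧ fn (w k) =ᵐ[volume.restrict Ω] φ k ∧
      grad (w k) =ᵐ[volume.restrict Ω] ∇ (φ k)) ∧ Filter.Tendsto w Filter.atTop (nhds u) := by
  have hu : u.1 ∈ closure (testPairs Ω : Set (PairSpace Ω)) := u.2
  obtain ⟨x, hx, hlim⟩ := mem_closure_iff_seq_limit.1 hu
  choose φ hφ using hx
  refine ⟨φ, fun k => ⟨x k, (testPairs Ω).le_topologicalClosure ⟨φ k, hφ k⟩⟩, hφ, ?_⟩
  exact tendsto_subtype_rng.2 hlim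

lemma normPow_of_isTest {φ : E n → ℝ} (hφ : IsTest Ω φ) {w : W0 Ω}
    (hw : grad w =ᵐ[volume.restrict Ω] ∇ φ) : normPow w = ∫ x, ‖fderiv ℝ φ x‖ ^ n := by
  have h2 := hn.out
  calc normPow w = ∫ x in Ω, ‖fderiv ℝ φ x‖ ^ n := by
        refine integral_congr_ae ?_
        filter_upwards [hw] with x hx
        rw [hx, norm_gradient]
    _ = _ := by
        apply setIntegral_eq_integral_of_forall_compl_eq_zero
        intro x hx
        have : fderiv ℝ φ x = 0 := by
          by_contra hne
          exact hx (hφ.supp (support_fderiv_subset ℝ hne))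
        rw [this, norm_zero, zero_pow (by omega)]

lemma exists_seq_tendsto_ae_fn {w : ℕ → W0 Ω} {u : W0 Ω}
    (h : Filter.Tendsto w Filter.atTop (nhds u)) :
    ∃ σ : ℕ → ℕ, StrictMono σ ∧ ∀ᵐ x ∂(volume.restrict Ω),
      Filter.Tendsto (fun k => fn (w (σ k)) x) Filter.atTop (nhds (fn u x)) := by
  have h1 : Filter.Tendsto (fun k => (w k).1.1) Filter.atTop (nhds u.1.1) :=
    (continuous_fst.comp continuous_subtype_val).continuousAt.tendsto.comp h
  have h2 := tendstoInMeasure_of_tendsto_Lp h1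
  exact h2.exists_seq_tendsto_ae

/-- Subcritical Trudinger inequality in `W₀^{1,n}(Ω)`, by Fatou's lemma from test functions. -/
lemma lintegral_exp_fn_le (hΩ : volume Ω ≠ ⊤) {β : ℝ} (hβ : 0 < β)
    (hβn : β < (n : ℝ) / ((n : ℝ) - 1)) (α : ℝ) (hα : 0 ≤ α) (K : ℝ) :
    ∃ C : ℝ, 0 ≤ C ∧ ∀ u : W0 Ω, normPow u ≤ K →
      ∫⁻ x in Ω, ENNReal.ofReal (Real.exp (α * |fn u x| ^ β)) ≤ ENNReal.ofReal C := by
  obtain ⟨C, hC, h⟩ := lintegral_exp_le hn.out hΩ hβ hβn α hα (K + 1)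
  refine ⟨C, hC, fun u hu => ?_⟩
  obtain ⟨φ, w, hφ, hlim⟩ := exists_seq_isTest u
  have hN : ∀ᶠ k in Filter.atTop, normPow (w k) < K + 1 :=
    (continuous_normPow.continuousAt.tendsto.comp hlim).eventually_lt_const (by linarith)
  obtain ⟨σ, hσ, hae⟩ := exists_seq_tendsto_ae_fn hlim
  have hcont : Continuous fun s : ℝ => ENNReal.ofReal (Real.exp (α * |s| ^ β)) := by
    refine ENNReal.continuous_ofReal.comp (Real.continuous_exp.comp (continuous_const.mul ?_))
    exact continuous_abs.rpow_const fun _ => Or.inr hβ.le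
  calc ∫⁻ x in Ω, ENNReal.ofReal (Real.exp (α * |fn u x| ^ β))
      = ∫⁻ x in Ω, Filter.liminf (fun k =>
          ENNReal.ofReal (Real.exp (α * |fn (w (σ k)) x| ^ β))) Filter.atTop := by
        refine lintegral_congr_ae ?_
        filter_upwards [hae] with x hx
        exact ((hcont.continuousAt.tendsto.comp hx).liminf_eq).symm
    _ ≤ Filter.liminf (fun k => ∫⁻ x in Ω,
          ENNReal.ofReal (Real.exp (α * |fn (w (σ k)) x| ^ β))) Filter.atTop :=
        lintegral_liminf_le' fun k =>
          hcont.measurable.comp_aemeasurable (aestronglyMeasurable_fn _).aemeasurable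
    _ ≤ Filter.limsup (fun k => ∫⁻ x in Ω,
          ENNReal.ofReal (Real.exp (α * |fn (w (σ k)) x| ^ β))) Filter.atTop :=
        Filter.liminf_le_limsup
    _ ≤ ENNReal.ofReal C := by
        refine Filter.limsup_le_of_le (h := ?_)
        filter_upwards [hσ.tendsto_atTop.eventually hN] with k hk
        obtain ⟨ht, hf, hg⟩ := hφ (σ k)
        rw [normPow_of_isTest ht hg] at hk
        refine le_of_eq_of_le (lintegral_congr_ae ?_) (h (φ (σ k))
          (ht.smooth.of_le (by exact_mod_cast le_top)) ht.compact
          ((subset_tsupport _).trans ht.supp) hk.le)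
        filter_upwards [hf] with x hx
        rw [hx]

/-- Poincaré's inequality, a consequence of Trudinger's by homogeneity. -/
lemma poincare (hΩ : volume Ω ≠ ⊤) :
    ∃ C : ℝ, 0 ≤ C ∧ ∀ u : W0 Ω, ∫ x in Ω, |fn u x| ^ n ≤ C * normPow u := by
  have h2 := hn.out
  have hn1 : (1 : ℝ) < n := by exact_mod_cast (by omega : 1 < n)
  have hβn : (1 : ℝ) < (n : ℝ) / ((n : ℝ) - 1) := by
    rw [lt_div_iff₀ (by linarith)]; linarith
  obtain ⟨C, hC, h⟩ := lintegral_exp_fn_le (Ω := Ω) hΩ one_pos hβn 1 zero_le_one 1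
  obtain ⟨B, hB, hb⟩ := Real.exists_rpow_le_mul_exp_rpow (n : ℝ) (by positivity) one_pos
  have key : ∀ u : W0 Ω, normPow u ≤ 1 → ∫ x in Ω, |fn u x| ^ n ≤ B * C := by
    intro u hu
    rw [integral_eq_lintegral_of_nonneg_ae (Filter.Eventually.of_forall fun x => by positivity)
      (integrable_fn_pow u).1]
    refine ENNReal.toReal_le_of_le_ofReal (by positivity) ?_
    calc ∫⁻ x in Ω, ENNReal.ofReal (|fn u x| ^ n)
        ≤ ∫⁻ x in Ω, ENNReal.ofReal B * ENNReal.ofReal (Real.exp (1 * |fn u x| ^ (1 : ℝ))) := by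
          refine lintegral_mono fun x => ?_
          rw [← ENNReal.ofReal_mul hB.le, one_mul]
          apply ENNReal.ofReal_le_ofReal
          rw [← Real.rpow_natCast]
          exact hb _ (abs_nonneg _)
      _ = ENNReal.ofReal B * ∫⁻ x in Ω, ENNReal.ofReal (Real.exp (1 * |fn u x| ^ (1 : ℝ))) :=
          lintegral_const_mul' _ _ ENNReal.ofReal_ne_top
      _ ≤ _ := by
          rw [ENNReal.ofReal_mul hB.le]
          gcongr
          exact h u hu
  have hscale : ∀ (u : W0 Ω) (t : ℝ), ∫ x in Ω, |fn (t • u) x| ^ n =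
      |t| ^ n * ∫ x in Ω, |fn u x| ^ n := by
    intro u t
    rw [← integral_const_mul]
    refine integral_congr_ae ?_
    filter_upwards [fn_smul t u] with x hx
    rw [hx, abs_mul, mul_pow]
  refine ⟨B * C, by positivity, fun u => ?_⟩
  have hI : 0 ≤ ∫ x in Ω, |fn u x| ^ n := integral_nonneg fun x => by positivity
  rcases (normPow_nonneg u).eq_or_lt' with h0 | h0
  · rw [h0, mul_zero]
    by_contra hcon
    push Not at hcon
    -- all multiples of `u` have zero energy, so their `Lⁿ` norms stay bounded
    obtain ⟨k, hk⟩ := exists_nat_gt (B * C / ∫ x in Ω, |fn u x| ^ n)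
    have hk' := key ((k : ℝ) • u) (by rw [normPow_smul, h0]; simp)
    rw [hscale, Nat.abs_cast] at hk'
    rw [div_lt_iff₀ hcon] at hk
    have hle : (k : ℝ) ≤ (k : ℝ) ^ n := by exact_mod_cast Nat.le_self_pow (by omega) k
    have := mul_le_mul_of_nonneg_right hle hI
    linarith
  · set t : ℝ := (normPow u)⁻¹ ^ (1 / (n : ℝ)) with ht
    have ht0 : 0 < t := by positivity
    have htn : |t| ^ n = (normPow u)⁻¹ := by
      rw [abs_of_pos ht0, ht, one_div, Real.rpow_inv_natCast_pow (by positivity) (by omega)]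
    have := key (t • u) (by rw [normPow_smul, htn, inv_mul_cancel₀ h0.ne'])
    rw [hscale, htn, inv_mul_le_iff₀ h0] at this
    linarith

/-- By Poincaré's inequality the Dirichlet energy controls the full Sobolev norm. -/
lemma norm_pow_le (hΩ : volume Ω ≠ ⊤) :
    ∃ C : ℝ, 0 < C ∧ ∀ u : W0 Ω, ‖u‖ ^ n ≤ C * normPow u := by
  obtain ⟨C, hC, h⟩ := poincare (Ω := Ω) hΩ
  refine ⟨C + 1, by positivity, fun u => ?_⟩
  have h1 : ‖u.1.1‖ ^ n ≤ C * normPow u := by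
    rw [norm_pow_eq_integral]; exact h u
  have h2 := normPow_nonneg u
  have e : ‖u‖ = max ‖u.1.1‖ ‖u.1.2‖ := rfl
  rw [e]
  rcases max_choice ‖u.1.1‖ ‖u.1.2‖ with h' | h' <;> rw [h']
  · nlinarith
  · rw [← normPow_eq]; nlinarith

lemma eq_zero_of_normPow_eq_zero (hΩ : volume Ω ≠ ⊤) {u : W0 Ω} (h : normPow u = 0) : u = 0 := by
  obtain ⟨C, hC, hle⟩ := norm_pow_le (Ω := Ω) hΩ
  have := hle u
  rw [h, mul_zero] at this
  have h2 := hn.out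
  have h3 : ‖u‖ ^ n = 0 := le_antisymm this (by positivity)
  exact norm_eq_zero.1 (pow_eq_zero_iff (by omega) |>.1 h3)

end Space

/-! ### Compactness -/

section Rellich

open Filter Topology

variable {n : ℕ}

/-- Bounded sequences in a separable Hilbert space have weakly convergent subsequences. -/
lemma _root_.exists_subseq_tendsto_inner {H : Type*} [NormedAddCommGroup H] [InnerProductSpace ℝ H]
    [CompleteSpace H] [TopologicalSpace.SeparableSpace H] (x : ℕ → H) (R : ℝ)
    (hx : ∀ k, ‖x k‖ ≤ R) :
    ∃ σ : ℕ → ℕ, StrictMono σ ∧ ∃ z : H, ∀ y, Tendsto (fun k => inner ℝ (x (σ k)) y) atTop (𝓝 (inner ℝ z y)) := by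
  have hc := WeakDual.isSeqCompact_closedBall ℝ H (0 : StrongDual ℝ H) R
  obtain ⟨a, -, σ, hσ, hlim⟩ := hc
    (x := fun k => StrongDual.toWeakDual (InnerProductSpace.toDual ℝ H (x k)))
    (fun k => by simpa using hx k)
  refine ⟨σ, hσ, (InnerProductSpace.toDual ℝ H).symm (WeakDual.toStrongDual a), fun y => ?_⟩
  have h1 := ((WeakDual.eval_continuous (𝕜 := ℝ) y).tendsto a).comp hlim
  rw [InnerProductSpace.toDual_symm_apply]
  exact h1

lemma lintegral_enorm_translate_sub_le {φ : E n → ℝ} (hφ : ContDiff ℝ 1 φ) (y : E n) :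
    ∫⁻ x, ‖φ (x + y) - φ x‖ₑ ≤ ‖y‖ₑ * ∫⁻ x, ‖fderiv ℝ φ x‖ₑ := by
  have hcd : Continuous (fderiv ℝ φ) := hφ.continuous_fderiv one_ne_zero
  have h1 : ∀ x, ‖φ (x + y) - φ x‖ₑ ≤ ∫⁻ t in Set.Ioc (0 : ℝ) 1, ‖fderiv ℝ φ (x + t • y)‖ₑ * ‖y‖ₑ := by
    intro x
    have hd : ∀ t : ℝ, HasDerivAt (fun t : ℝ => φ (x + t • y)) (fderiv ℝ φ (x + t • y) y) t := by
      intro t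
      have e1 : HasDerivAt (fun t : ℝ => x + t • y) y t := by
        simpa using ((hasDerivAt_id t).smul_const y).const_add x
      exact ((hφ.differentiable one_ne_zero _).hasFDerivAt).comp_hasDerivAt t e1
    have hcont : Continuous fun t : ℝ => fderiv ℝ φ (x + t • y) y := by fun_prop
    have h2 := intervalIntegral.integral_eq_sub_of_hasDerivAt (a := 0) (b := 1)
      (fun t _ => hd t) (hcont.intervalIntegrable _ _)
    simp only [one_smul, zero_smul, add_zero] at h2
    rw [← h2, intervalIntegral.integral_of_le zero_le_one]
    refine (enorm_integral_le_lintegral_enorm _).trans (lintegral_mono fun t => ?_)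
    exact ContinuousLinearMap.le_opENorm _ _
  calc ∫⁻ x, ‖φ (x + y) - φ x‖ₑ
      ≤ ∫⁻ x, ∫⁻ t in Set.Ioc (0 : ℝ) 1, ‖fderiv ℝ φ (x + t • y)‖ₑ * ‖y‖ₑ := lintegral_mono h1
    _ = ∫⁻ t in Set.Ioc (0 : ℝ) 1, ∫⁻ x, ‖fderiv ℝ φ (x + t • y)‖ₑ * ‖y‖ₑ := by
        rw [lintegral_lintegral_swap]
        apply Continuous.aemeasurable
        have : Continuous fun z : E n × ℝ => ‖fderiv ℝ φ (z.1 + z.2 • y)‖ₑ := by fun_prop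
        exact ENNReal.continuous_mul_const (by simp) |>.comp this
    _ = ∫⁻ t in Set.Ioc (0 : ℝ) 1, ‖y‖ₑ * ∫⁻ x, ‖fderiv ℝ φ x‖ₑ := by
        congr 1 with t
        rw [lintegral_mul_const' _ _ (by simp), mul_comm,
          lintegral_add_right_eq_self (fun x => ‖fderiv ℝ φ x‖ₑ)]
    _ = _ := by simp

/-- The average of `φ` over the ball of radius `ε` around `x`. -/
def ballAverage (ε : ℝ) (φ : E n → ℝ) (x : E n) : ℝ :=
  (volume.real (Metric.ball (0 : E n) ε))⁻¹ * ∫ z in Metric.ball x ε, φ z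

lemma ballAverage_eq (ε : ℝ) (φ : E n → ℝ) (x : E n) :
    ballAverage ε φ x =
      (volume.real (Metric.ball (0 : E n) ε))⁻¹ * ∫ y in Metric.ball (0 : E n) ε, φ (x + y) := by
  rw [ballAverage]
  congr 1
  have hmp : MeasurePreserving (fun y : E n => x + y) volume volume := measurePreserving_add_left volume x
  have := hmp.setIntegral_preimage_emb (measurableEmbedding_addLeft x) φ (Metric.ball x ε)
  rw [← this]
  congr 2
  ext y
  simp

lemma lintegral_enorm_sub_ballAverage_le {φ : E n → ℝ} (hφ : ContDiff ℝ 1 φ) {ε : ℝ} (hε : 0 < ε) :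
    ∫⁻ x, ‖φ x - ballAverage ε φ x‖ₑ ≤ ENNReal.ofReal ε * ∫⁻ x, ‖fderiv ℝ φ x‖ₑ := by
  set B : Set (E n) := Metric.ball 0 ε with hB
  have hBfin : volume B ≠ ⊤ := measure_ball_lt_top.ne
  have hB0 : volume B ≠ 0 := (Metric.measure_ball_pos volume _ hε).ne'
  have hV : 0 < volume.real B := ENNReal.toReal_pos hB0 hBfin
  have hcont := hφ.continuous
  have h1 : ∀ x, ‖φ x - ballAverage ε φ x‖ₑ ≤ (volume B)⁻¹ * ∫⁻ y in B, ‖φ (x + y) - φ x‖ₑ := by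
    intro x
    have hint : IntegrableOn (fun y => φ (x + y)) B := by
      have : IntegrableOn (fun y => φ (x + y)) (Metric.closedBall 0 ε) :=
        (by fun_prop : Continuous fun y => φ (x + y)).continuousOn.integrableOn_compact
          (isCompact_closedBall _ _)
      exact this.mono_set Metric.ball_subset_closedBall
    have e : φ x - ballAverage ε φ x = -((volume.real B)⁻¹ * ∫ y in B, (φ (x + y) - φ x)) := by
      rw [ballAverage_eq, integral_sub hint (integrableOn_const hBfin), setIntegral_const,
        smul_eq_mul, mul_sub, inv_mul_cancel_left₀ hV.ne']
      ring
    rw [e, enorm_neg, enorm_mul]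
    gcongr
    · rw [enorm_inv hV.ne', measureReal_def, Real.enorm_of_nonneg ENNReal.toReal_nonneg,
        ENNReal.ofReal_toReal hBfin]
    · exact enorm_integral_le_lintegral_enorm _
  calc ∫⁻ x, ‖φ x - ballAverage ε φ x‖ₑ
      ≤ ∫⁻ x, (volume B)⁻¹ * ∫⁻ y in B, ‖φ (x + y) - φ x‖ₑ := lintegral_mono h1
    _ = (volume B)⁻¹ * ∫⁻ y in B, ∫⁻ x, ‖φ (x + y) - φ x‖ₑ := by
        rw [lintegral_const_mul' _ _ (by simp [hB0]), lintegral_lintegral_swap]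
        apply Continuous.aemeasurable
        fun_prop
    _ ≤ (volume B)⁻¹ * ∫⁻ y in B, ENNReal.ofReal ε * ∫⁻ x, ‖fderiv ℝ φ x‖ₑ := by
        refine mul_le_mul' le_rfl (setLIntegral_mono measurable_const fun y hy => ?_)
        refine (lintegral_enorm_translate_sub_le hφ y).trans ?_
        gcongr
        rw [← ofReal_norm]
        apply ENNReal.ofReal_le_ofReal
        simpa [hB] using (Metric.mem_ball.1 hy).le
    _ = _ := by
        rw [setLIntegral_const, mul_comm _ (volume B), ← mul_assoc, ENNReal.inv_mul_cancel hB0 hBfin,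
          one_mul]

/-- Rellich's theorem for test functions: on a sequence converging weakly in `L²` the ball averages
converge, and a ball average is `L¹`-close to the function by the gradient bound. -/
lemma exists_subseq_tendsto_eLpNorm_one {Ω : Set (E n)} (hΩ : volume Ω ≠ ⊤) (φ : ℕ → E n → ℝ)
    (hφ : ∀ k, IsTest Ω (φ k)) (A B : ℝ)
    (hA : ∀ k, ∫⁻ x, ‖fderiv ℝ (φ k) x‖ₑ ≤ ENNReal.ofReal A)
    (hB : ∀ k, eLpNorm (φ k) 2 volume ≤ ENNReal.ofReal B) :
    ∃ (σ : ℕ → ℕ) (f : E n → ℝ), StrictMono σ ∧ AEStronglyMeasurable f (volume.restrict Ω) ∧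
      Tendsto (fun k => eLpNorm (φ (σ k) - f) 1 (volume.restrict Ω)) atTop (𝓝 0) := by
  have hfinΩ : IsFiniteMeasure (volume.restrict Ω) := ⟨by simpa using hΩ.lt_top⟩
  have h1 : ∀ k, ContDiff ℝ 1 (φ k) := fun k => (hφ k).smooth.of_le (by exact_mod_cast le_top)
  have hL2 : ∀ k, MemLp (φ k) 2 volume := fun k =>
    (h1 k).continuous.memLp_of_hasCompactSupport (hφ k).compact
  have hL1 : ∀ k, MemLp (φ k) 1 (volume.restrict Ω) := fun k =>
    ((h1 k).continuous.memLp_of_hasCompactSupport (hφ k).compact).restrict Ω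
  have h2top : Fact ((2 : ENNReal) ≠ ⊤) := ⟨by simp⟩
  obtain ⟨σ, hσ, z, hz⟩ := exists_subseq_tendsto_inner (fun k => (hL2 k).toLp (φ k)) (max B 0)
    (fun k => by
      rw [Lp.norm_toLp]
      refine ENNReal.toReal_le_of_le_ofReal (le_max_right _ _) ((hB k).trans ?_)
      exact ENNReal.ofReal_le_ofReal (le_max_left _ _))
  -- The ball averages are inner products with indicators, so they converge pointwise and are
  -- uniformly bounded.
  have hball : ∀ (ε : ℝ) (x : E n), volume (Metric.ball x ε) ≠ ⊤ := fun ε x => measure_ball_lt_top.ne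
  have hinner : ∀ (ε : ℝ) (x : E n) (w : Lp ℝ 2 (volume : Measure (E n))),
      inner ℝ w (indicatorConstLp 2 Metric.isOpen_ball.measurableSet (hball ε x) (1 : ℝ)) =
        ∫ y in Metric.ball x ε, w y := by
    intro ε x w
    rw [real_inner_comm, L2.inner_indicatorConstLp_one]
  have hinner' : ∀ (ε : ℝ) (x : E n) (k : ℕ),
      ∫ y in Metric.ball x ε, (hL2 k).toLp (φ k) y = ∫ y in Metric.ball x ε, φ k y := by
    intro ε x k
    exact integral_congr_ae (ae_restrict_of_ae (hL2 k).coeFn_toLp)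
  have hpt : ∀ (ε : ℝ) (x : E n), Tendsto (fun k => ballAverage ε (φ (σ k)) x) atTop
      (𝓝 (ballAverage ε z x)) := by
    intro ε x
    refine Tendsto.const_mul _ ?_
    have := hz (indicatorConstLp 2 Metric.isOpen_ball.measurableSet (hball ε x) (1 : ℝ))
    simp only [hinner, hinner'] at this
    exact this
  have hbd : ∀ (ε : ℝ) (k : ℕ) (x : E n), ‖ballAverage ε (φ k) x‖ ≤
      (volume.real (Metric.ball (0 : E n) ε))⁻¹ *
        (max B 0 * (volume.real (Metric.ball (0 : E n) ε)) ^ (1 / (2 : ℝ))) := by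
    intro ε k x
    rw [ballAverage, norm_mul, norm_inv, Real.norm_of_nonneg measureReal_nonneg]
    gcongr
    rw [← hinner', ← hinner]
    refine (norm_inner_le_norm _ _).trans ?_
    rw [norm_indicatorConstLp (by norm_num) (by norm_num), norm_one, one_mul, Lp.norm_toLp]
    have hbb : volume.real (Metric.ball x ε) = volume.real (Metric.ball (0 : E n) ε) := by
      simp [measureReal_def, Measure.addHaar_ball_center]
    rw [hbb, ENNReal.toReal_ofNat]
    gcongr
    refine ENNReal.toReal_le_of_le_ofReal (le_max_right _ _) ((hB k).trans ?_)
    exact ENNReal.ofReal_le_ofReal (le_max_left _ _)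
  have hmeas : ∀ (ε : ℝ) (k : ℕ), Measurable (ballAverage ε (φ k)) := by
    intro ε k
    have e : ballAverage ε (φ k) = fun x => (volume.real (Metric.ball (0 : E n) ε))⁻¹ *
        ∫ y in Metric.ball (0 : E n) ε, φ k (x + y) := funext (ballAverage_eq ε (φ k))
    rw [e]
    refine Measurable.const_mul ?_ _
    have hc : Continuous fun p : E n × E n => φ k (p.1 + p.2) :=
      (h1 k).continuous.comp (by fun_prop)
    exact (hc.stronglyMeasurable.integral_prod_right).measurable
  have hconv : ∀ ε : ℝ, 0 < ε → Tendsto (fun k => ∫⁻ x in Ω,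
      ‖ballAverage ε (φ (σ k)) x - ballAverage ε z x‖ₑ) atTop (𝓝 0) := by
    intro ε hε
    set M := (volume.real (Metric.ball (0 : E n) ε))⁻¹ *
        (max B 0 * (volume.real (Metric.ball (0 : E n) ε)) ^ (1 / (2 : ℝ))) with hM
    have hzb : ∀ x, ‖ballAverage ε z x‖ ≤ M := fun x =>
      le_of_tendsto (hpt ε x).norm (Eventually.of_forall fun k => hbd ε (σ k) x)
    have hzm : Measurable (ballAverage ε z) :=
      measurable_of_tendsto_metrizable (fun k => hmeas ε (σ k)) (tendsto_pi_nhds.2 (hpt ε))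
    have := tendsto_lintegral_of_dominated_convergence (μ := volume.restrict Ω)
      (F := fun k x => ‖ballAverage ε (φ (σ k)) x - ballAverage ε z x‖ₑ) (f := fun _ => 0)
      (fun _ => ENNReal.ofReal (2 * M)) (fun k => ((hmeas ε (σ k)).sub hzm).enorm)
      (fun k => Eventually.of_forall fun x => by
        beta_reduce
        rw [← ofReal_norm]
        apply ENNReal.ofReal_le_ofReal
        calc _ ≤ _ := norm_sub_le _ _
          _ ≤ M + M := add_le_add (hbd ε _ x) (hzb x)
          _ = _ := by ring)
      (by rw [lintegral_const]; exact ENNReal.mul_ne_top ENNReal.ofReal_ne_top (measure_ne_top _ _))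
      (Eventually.of_forall fun x => by
        have := ((hpt ε x).sub_const (ballAverage ε z x)).enorm
        simpa using this)
    simpa using this
  -- Given `δ`, the radius is chosen so that each `φ k` is `δ/8`-close in `L¹` to its averages.
  have hcauchy : CauchySeq fun k => (hL1 (σ k)).toLp (φ (σ k)) := by
    rw [EMetric.cauchySeq_iff]
    intro δ hδ
    obtain ⟨ε, hε, hεδ⟩ : ∃ ε : ℝ, 0 < ε ∧ ENNReal.ofReal ε * ENNReal.ofReal A ≤ δ / 8 := by
      have hδ8 : 0 < δ / 8 := ENNReal.div_pos hδ.ne' (by simp)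
      have ht : Tendsto (fun ε : ℝ => ENNReal.ofReal ε * ENNReal.ofReal A) (𝓝[>] 0) (𝓝 0) := by
        have : Tendsto (fun ε : ℝ => ENNReal.ofReal (ε * A)) (𝓝[>] 0) (𝓝 (ENNReal.ofReal (0 * A))) :=
          ((ENNReal.continuous_ofReal.comp (continuous_mul_const A)).tendsto 0).mono_left
            nhdsWithin_le_nhds
        rw [zero_mul, ENNReal.ofReal_zero] at this
        refine this.congr' ?_
        filter_upwards [self_mem_nhdsWithin] with ε hε
        rw [ENNReal.ofReal_mul (le_of_lt hε)]
      obtain ⟨ε, h1, h2⟩ := ((ht.eventually_le_const hδ8).and self_mem_nhdsWithin).exists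
      exact ⟨ε, h2, h1⟩
    have hδ8 : 0 < δ / 8 := ENNReal.div_pos hδ.ne' (by simp)
    obtain ⟨K, hK⟩ := eventually_atTop.1 ((hconv ε hε).eventually_le_const hδ8)
    have key : ∀ k ≥ K, ∫⁻ x in Ω, ‖φ (σ k) x - ballAverage ε z x‖ₑ ≤ δ / 4 := by
      intro k hk
      calc _ ≤ ∫⁻ x in Ω, (‖φ (σ k) x - ballAverage ε (φ (σ k)) x‖ₑ +
              ‖ballAverage ε (φ (σ k)) x - ballAverage ε z x‖ₑ) := by
            refine lintegral_mono fun x => ?_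
            have := enorm_add_le (φ (σ k) x - ballAverage ε (φ (σ k)) x)
              (ballAverage ε (φ (σ k)) x - ballAverage ε z x)
            rwa [sub_add_sub_cancel] at this
        _ = (∫⁻ x in Ω, ‖φ (σ k) x - ballAverage ε (φ (σ k)) x‖ₑ) +
              ∫⁻ x in Ω, ‖ballAverage ε (φ (σ k)) x - ballAverage ε z x‖ₑ :=
            lintegral_add_left (((h1 _).continuous.measurable.sub (hmeas ε _)).enorm) _
        _ ≤ δ / 8 + δ / 8 := by
            refine add_le_add ?_ (hK k hk)
            refine (setLIntegral_le_lintegral _ _).trans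
              ((lintegral_enorm_sub_ballAverage_le (h1 _) hε).trans (le_trans ?_ hεδ))
            gcongr
            exact hA _
        _ = δ / 4 := by
            rw [ENNReal.div_add_div_same, ← two_mul, show (8 : ENNReal) = 2 * 4 by norm_num,
              ENNReal.mul_div_mul_left _ _ (by simp) (by simp)]
    by_cases hδt : δ = ⊤
    · exact ⟨0, fun m _ k _ => by rw [hδt]; exact edist_lt_top _ _⟩
    refine ⟨K, fun i hi j hj => ?_⟩
    rw [Lp.edist_toLp_toLp, eLpNorm_one_eq_lintegral_enorm]
    have hzm : Measurable (ballAverage ε z) :=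
      measurable_of_tendsto_metrizable (fun k => hmeas ε (σ k)) (tendsto_pi_nhds.2 (hpt ε))
    calc _ ≤ ∫⁻ x in Ω, (‖φ (σ i) x - ballAverage ε z x‖ₑ + ‖φ (σ j) x - ballAverage ε z x‖ₑ) := by
          refine lintegral_mono fun x => ?_
          have := enorm_sub_le (a := φ (σ i) x - ballAverage ε z x)
            (b := φ (σ j) x - ballAverage ε z x)
          rwa [sub_sub_sub_cancel_right] at this
      _ = (∫⁻ x in Ω, ‖φ (σ i) x - ballAverage ε z x‖ₑ) +
            ∫⁻ x in Ω, ‖φ (σ j) x - ballAverage ε z x‖ₑ :=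
          lintegral_add_left (((h1 _).continuous.measurable.sub hzm).enorm) _
      _ ≤ δ / 4 + δ / 4 := add_le_add (key i hi) (key j hj)
      _ = δ / 2 := by
          rw [ENNReal.div_add_div_same, ← two_mul, show (4 : ENNReal) = 2 * 2 by norm_num,
              ENNReal.mul_div_mul_left _ _ (by simp) (by simp)]
      _ < δ := ENNReal.half_lt_self hδ.ne' hδt
  obtain ⟨F, hF⟩ := cauchySeq_tendsto_of_complete hcauchy
  refine ⟨σ, F, hσ, (Lp.memLp F).1, ?_⟩
  rw [Lp.tendsto_Lp_iff_tendsto_eLpNorm'] at hF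
  refine hF.congr fun k => eLpNorm_congr_ae ?_
  filter_upwards [(hL1 (σ k)).coeFn_toLp] with x hx
  simp [hx]

end Rellich

section Compactness

open Filter Topology

variable {n : ℕ} [hn : Fact (2 ≤ n)] {Ω : Set (E n)}

lemma eLpNorm_fn_sub_le (u v : W0 Ω) : eLpNorm (fn u - fn v) 1 (volume.restrict Ω) ≤
    ENNReal.ofReal ‖u - v‖ * volume Ω ^ (1 - 1 / (n : ℝ)) := by
  have h1 : eLpNorm (fn u - fn v) n (volume.restrict Ω) ≤ ENNReal.ofReal ‖u - v‖ := by
    have e : fn (u - v) =ᵐ[volume.restrict Ω] fn u - fn v := Lp.coeFn_sub u.1.1 v.1.1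
    rw [← eLpNorm_congr_ae e]
    have h2 : ‖(u - v).1.1‖ ≤ ‖u - v‖ := norm_fst_le (u - v).1
    have h3 : eLpNorm (fn (u - v)) n (volume.restrict Ω) = ENNReal.ofReal ‖(u - v).1.1‖ := by
      rw [Lp.norm_def, ENNReal.ofReal_toReal (Lp.eLpNorm_ne_top _)]; rfl
    rw [h3]
    exact ENNReal.ofReal_le_ofReal h2
  refine (eLpNorm_le_eLpNorm_mul_rpow_measure_univ (p := 1) (q := n)
    (by exact_mod_cast (by have := hn.out; omega : 1 ≤ n))
    ((aestronglyMeasurable_fn u).sub (aestronglyMeasurable_fn v))).trans ?_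
  simp only [ENNReal.toReal_one, ENNReal.toReal_natCast, Measure.restrict_apply_univ, div_one]
  gcongr

lemma eLpNorm_convexComb_sub_le {u v : W0 Ω} {f : E n → ℝ}
    (hf : AEStronglyMeasurable f (volume.restrict Ω)) {δ : ENNReal}
    (hu : eLpNorm (fn u - f) 1 (volume.restrict Ω) ≤ δ)
    (hv : eLpNorm (fn v - f) 1 (volume.restrict Ω) ≤ δ) :
    eLpNorm (fn ((1 / 2 : ℝ) • (u + v)) - f) 1 (volume.restrict Ω) ≤ δ := by
  have e : fn ((1 / 2 : ℝ) • (u + v)) - f =ᵐ[volume.restrict Ω]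
      (1 / 2 : ℝ) • (fn u - f) + (1 / 2 : ℝ) • (fn v - f) := by
    filter_upwards [fn_smul (1 / 2) (u + v), fn_add u v] with x h1 h2
    simp only [Pi.sub_apply, Pi.add_apply, Pi.smul_apply, h1, h2, smul_eq_mul]
    ring
  rw [eLpNorm_congr_ae e]
  refine (eLpNorm_add_le (((aestronglyMeasurable_fn u).sub hf).const_smul _)
    (((aestronglyMeasurable_fn v).sub hf).const_smul _) le_rfl).trans ?_
  rw [eLpNorm_const_smul, eLpNorm_const_smul]
  have h12 : ‖(1 / 2 : ℝ)‖ₑ = 2⁻¹ := by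
    rw [Real.enorm_of_nonneg (by norm_num), one_div, ENNReal.ofReal_inv_of_pos two_pos]
    simp
  rw [h12]
  calc _ ≤ 2⁻¹ * δ + 2⁻¹ * δ := by gcongr
    _ = δ := by rw [← add_mul, ENNReal.inv_two_add_inv_two, one_mul]

/-- Sequential weak closedness of `W₀^{1,n}` and weak lower semicontinuity of `‖·‖ⁿ`, without
reflexivity: near-minimizers of `‖·‖ⁿ` over the nested convex sets of functions close to `f`
form a Cauchy sequence by Clarkson's inequality. -/
lemma exists_normPow_le_of_tendsto (hΩ : volume Ω ≠ ⊤) {w : ℕ → W0 Ω} {f : E n → ℝ} {c : ℕ → ℝ}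
    {L : ℝ} (hf : AEStronglyMeasurable f (volume.restrict Ω)) (hw : ∀ k, normPow (w k) ≤ c k)
    (hc : Tendsto c atTop (𝓝 L))
    (hlim : Tendsto (fun k => eLpNorm (fn (w k) - f) 1 (volume.restrict Ω)) atTop (𝓝 0)) :
    ∃ u : W0 Ω, fn u =ᵐ[volume.restrict Ω] f ∧ normPow u ≤ L := by
  have h2n := hn.out
  -- The infima `d k` of `‖·‖ⁿ` over the nested convex sets `C k` increase to some `D`; `v k ∈ C k` has
  -- `‖v k‖ⁿ` at most `d k + δ k`.
  set δ : ℕ → ℝ := fun k => 1 / ((k : ℝ) + 1) with hδ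
  have hδ0 : ∀ k, 0 < δ k := fun k => by positivity
  have hδanti : ∀ j k, j ≤ k → δ k ≤ δ j := fun j k h => by
    simp only [hδ]; gcongr
  have hδlim : Tendsto δ atTop (𝓝 0) := tendsto_one_div_add_atTop_nhds_zero_nat
  set C : ℕ → Set (W0 Ω) := fun k => {v | eLpNorm (fn v - f) 1 (volume.restrict Ω) ≤
    ENNReal.ofReal (δ k) ∧ normPow v ≤ L + δ k} with hC
  have hCne : ∀ k, (C k).Nonempty := by
    intro k
    have e1 := hlim.eventually_le_const (ENNReal.ofReal_pos.2 (hδ0 k))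
    have e2 := hc.eventually_le_const (lt_add_of_pos_right L (hδ0 k))
    obtain ⟨j, h1, h2⟩ := (e1.and e2).exists
    exact ⟨w j, h1, (hw j).trans h2⟩
  have hCanti : ∀ j k, j ≤ k → C k ⊆ C j := fun j k h v hv =>
    ⟨hv.1.trans (ENNReal.ofReal_le_ofReal (hδanti j k h)),
      hv.2.trans (by linarith [hδanti j k h])⟩
  set d : ℕ → ℝ := fun k => sInf (normPow '' C k) with hd
  have hbdd : ∀ k, BddBelow (normPow '' C k) := fun k =>
    ⟨0, by rintro _ ⟨v, -, rfl⟩; exact normPow_nonneg v⟩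
  have hdmono : Monotone d := fun j k h =>
    csInf_le_csInf (hbdd j) ((hCne k).image _) (Set.image_mono (hCanti j k h))
  have hdle : ∀ k, d k ≤ L + 1 := fun k => by
    obtain ⟨v, hv⟩ := hCne k
    refine (csInf_le (hbdd k) ⟨v, hv, rfl⟩).trans (hv.2.trans ?_)
    have := hδanti 0 k (Nat.zero_le k)
    simp only [hδ] at this ⊢
    norm_num at this ⊢
    exact this
  obtain ⟨D, hD⟩ : ∃ D, Tendsto d atTop (𝓝 D) :=
    ⟨_, tendsto_atTop_ciSup hdmono ⟨L + 1, by rintro _ ⟨k, rfl⟩; exact hdle k⟩⟩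
  have hdD : ∀ k, d k ≤ D := fun k => hdmono.ge_of_tendsto hD k
  have hv : ∀ k, ∃ v ∈ C k, normPow v ≤ d k + δ k := by
    intro k
    obtain ⟨_, ⟨v, hv, rfl⟩, hlt⟩ := Real.lt_sInf_add_pos ((hCne k).image normPow) (hδ0 k)
    exact ⟨v, hv, hlt.le⟩
  choose v hvC hvN using hv
  obtain ⟨B, hB, hnorm⟩ := norm_pow_le (Ω := Ω) hΩ
  have hdiff : ∀ j k, j ≤ k → ‖v j - v k‖ ^ n ≤ B * 2 ^ n * ((D - d j) + δ j) := by
    intro j k h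
    have hvk : v k ∈ C j := hCanti j k h (hvC k)
    have hcl := normPow_clarkson (v j) (v k)
    have hmid : (1 / 2 : ℝ) • (v j + v k) ∈ C j := by
      refine ⟨eLpNorm_convexComb_sub_le hf (hvC j).1 hvk.1, ?_⟩
      have h1 := normPow_nonneg ((1 / 2 : ℝ) • (v j - v k))
      have h2 := (hvC j).2
      have h3 := hvk.2
      linarith
    have h4 : d j ≤ normPow ((1 / 2 : ℝ) • (v j + v k)) := csInf_le (hbdd j) ⟨_, hmid, rfl⟩
    have h5 := hvN j
    have h6 := hvN k
    have h7 := hdD k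
    have h8 := hδanti j k h
    have h9 := hdD j
    have h10 : normPow ((1 / 2 : ℝ) • (v j - v k)) ≤ (D - d j) + δ j := by linarith
    rw [normPow_smul, abs_of_pos (by norm_num : (0 : ℝ) < 1 / 2)] at h10
    calc ‖v j - v k‖ ^ n ≤ B * normPow (v j - v k) := hnorm _
      _ = B * 2 ^ n * ((1 / 2) ^ n * normPow (v j - v k)) := by
          rw [one_div, inv_pow]; field_simp
      _ ≤ _ := by gcongr
  have hcs : CauchySeq v := by
    refine cauchySeq_of_le_tendsto_0'
      (fun j => (B * 2 ^ n * ((D - d j) + δ j)) ^ (1 / (n : ℝ))) ?_ ?_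
    · intro j k h
      rw [dist_eq_norm]
      have h1 := hdiff j k h
      rw [← Real.pow_rpow_inv_natCast (norm_nonneg (v j - v k)) (by omega : n ≠ 0), one_div]
      gcongr
    · have h1 : Tendsto (fun j => B * 2 ^ n * ((D - d j) + δ j)) atTop (𝓝 0) := by
        have := ((hD.const_sub D).add hδlim).const_mul (B * 2 ^ n)
        simpa using this
      have hpos : (0 : ℝ) < 1 / (n : ℝ) := by
        have : (0 : ℝ) < n := by exact_mod_cast (by omega : 0 < n)
        positivity
      have := h1.rpow_const (p := 1 / (n : ℝ)) (Or.inr hpos.le)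
      rwa [Real.zero_rpow hpos.ne'] at this
  have hcomp : CompleteSpace (W0 Ω) :=
    (Submodule.isClosed_topologicalClosure (testPairs Ω)).completeSpace_coe
  obtain ⟨u, hu⟩ := cauchySeq_tendsto_of_complete hcs
  refine ⟨u, ?_, ?_⟩
  · have h1 : Tendsto (fun k => (v k).1.1) atTop (𝓝 u.1.1) :=
      (continuous_fst.comp continuous_subtype_val).continuousAt.tendsto.comp hu
    have h2 := tendstoInMeasure_of_tendsto_Lp h1
    have h3 : Tendsto (fun k => eLpNorm (fn (v k) - f) 1 (volume.restrict Ω)) atTop (𝓝 0) := by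
      refine tendsto_of_tendsto_of_tendsto_of_le_of_le tendsto_const_nhds ?_
        (fun _ => zero_le) (fun k => (hvC k).1)
      have := (ENNReal.continuous_ofReal.tendsto 0).comp hδlim
      rw [ENNReal.ofReal_zero] at this
      exact this
    have h4 := tendstoInMeasure_of_tendsto_eLpNorm one_ne_zero
      (fun k => aestronglyMeasurable_fn (v k)) hf h3
    exact tendstoInMeasure_ae_unique h2 h4
  · have h1 : Tendsto (fun k => normPow (v k)) atTop (𝓝 (normPow u)) :=
      continuous_normPow.continuousAt.tendsto.comp hu
    have h2 : Tendsto (fun k => L + δ k) atTop (𝓝 (L + 0)) := hδlim.const_add L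
    rw [add_zero] at h2
    exact le_of_tendsto_of_tendsto' h1 h2 fun k => (hvC k).2

/-- Rellich's theorem in `W₀^{1,n}(Ω)`, by approximating the `k`-th function by a test function up to
`1/(k+1)`. -/
lemma exists_subseq_tendsto_fn (hΩ : volume Ω ≠ ⊤) (w : ℕ → W0 Ω) (K : ℝ)
    (hw : ∀ k, normPow (w k) ≤ K) :
    ∃ (σ : ℕ → ℕ) (f : E n → ℝ), StrictMono σ ∧ AEStronglyMeasurable f (volume.restrict Ω) ∧
      Tendsto (fun k => eLpNorm (fn (w (σ k)) - f) 1 (volume.restrict Ω)) atTop (𝓝 0) := by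
  have h2n := hn.out
  have hfinΩ : IsFiniteMeasure (volume.restrict Ω) := ⟨by simpa using hΩ.lt_top⟩
  obtain ⟨B, hB, hpoin⟩ := poincare (Ω := Ω) hΩ
  have hpick : ∀ k : ℕ, ∃ (φ : E n → ℝ) (v : W0 Ω), IsTest Ω φ ∧ fn v =ᵐ[volume.restrict Ω] φ ∧
      grad v =ᵐ[volume.restrict Ω] ∇ φ ∧ ‖w k - v‖ ≤ 1 / ((k : ℝ) + 1) ∧ normPow v ≤ K + 1 := by
    intro k
    obtain ⟨φ, v, hφ, hlim⟩ := exists_seq_isTest (w k)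
    have h1 : Tendsto (fun j => ‖w k - v j‖) atTop (𝓝 0) := by
      have := (hlim.const_sub (w k)).norm
      simpa using this
    have e1 := h1.eventually_le_const (by positivity : (0 : ℝ) < 1 / ((k : ℝ) + 1))
    have e2 := (continuous_normPow.continuousAt.tendsto.comp hlim).eventually_le_const
      (by linarith [hw k] : normPow (w k) < K + 1)
    obtain ⟨j, h3, h4⟩ := (e1.and e2).exists
    exact ⟨φ j, v j, (hφ j).1, (hφ j).2.1, (hφ j).2.2, h3, h4⟩
  choose φ v hφ hfn hgrad hclose hNv using hpick
  have hI1 : ∀ k, ∫⁻ x, ‖fderiv ℝ (φ k) x‖ₑ ≤ ENNReal.ofReal (volume.real Ω + (K + 1)) := by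
    intro k
    have e : ∫⁻ x, ‖fderiv ℝ (φ k) x‖ₑ = ∫⁻ x in Ω, ‖fderiv ℝ (φ k) x‖ₑ := by
      symm
      rw [setLIntegral_eq_of_support_subset]
      intro x hx
      refine (hφ k).supp (support_fderiv_subset ℝ ?_)
      intro h0; exact hx (by beta_reduce; rw [← ofReal_norm, h0, norm_zero, ENNReal.ofReal_zero])
    rw [e]
    calc ∫⁻ x in Ω, ‖fderiv ℝ (φ k) x‖ₑ
        ≤ ∫⁻ x in Ω, ENNReal.ofReal (1 + ‖grad (v k) x‖ ^ n) := by
          refine lintegral_mono_ae ?_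
          filter_upwards [hgrad k] with x hx
          rw [← ofReal_norm, ← norm_gradient, hx]
          apply ENNReal.ofReal_le_ofReal
          rcases le_total ‖∇ (φ k) x‖ 1 with h | h
          · have : 0 ≤ ‖∇ (φ k) x‖ ^ n := by positivity
            linarith
          · have := le_self_pow₀ h (by omega : n ≠ 0)
            linarith
      _ = ENNReal.ofReal (∫ x in Ω, (1 + ‖grad (v k) x‖ ^ n)) :=
          (ofReal_integral_eq_lintegral_ofReal ((integrable_const _).add (integrable_grad_pow _))
            (Eventually.of_forall fun x => add_nonneg zero_le_one (by positivity))).symm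
      _ ≤ _ := by
          apply ENNReal.ofReal_le_ofReal
          rw [integral_add (integrable_const _) (integrable_grad_pow _)]
          have : ∫ x in Ω, ‖grad (v k) x‖ ^ n = normPow (v k) := rfl
          rw [this]
          simp only [integral_const, smul_eq_mul, mul_one, measureReal_restrict_apply_univ]
          linarith [hNv k]
  have hI2 : ∀ k, eLpNorm (φ k) 2 volume ≤
      ENNReal.ofReal ((volume.real Ω + B * (K + 1)) ^ (1 / (2 : ℝ))) := by
    intro k
    have hK0 : 0 ≤ K + 1 := (normPow_nonneg _).trans (hNv k)
    rw [eLpNorm_eq_lintegral_rpow_enorm_toReal (by norm_num) (by norm_num), ENNReal.toReal_ofNat,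
      ← ENNReal.ofReal_rpow_of_nonneg (by have : 0 ≤ volume.real Ω := measureReal_nonneg
                                          positivity) (by norm_num)]
    gcongr
    have e : ∫⁻ x, ‖φ k x‖ₑ ^ (2 : ℝ) = ∫⁻ x in Ω, ‖φ k x‖ₑ ^ (2 : ℝ) := by
      symm
      rw [setLIntegral_eq_of_support_subset]
      intro x hx
      refine (hφ k).supp (subset_tsupport _ ?_)
      intro h0; exact hx (by simp [h0])
    rw [e]
    calc ∫⁻ x in Ω, ‖φ k x‖ₑ ^ (2 : ℝ)
        ≤ ∫⁻ x in Ω, ENNReal.ofReal (1 + |fn (v k) x| ^ n) := by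
          refine lintegral_mono_ae ?_
          filter_upwards [hfn k] with x hx
          rw [← ofReal_norm, hx, ENNReal.ofReal_rpow_of_nonneg (norm_nonneg _) (by norm_num),
            Real.norm_eq_abs]
          apply ENNReal.ofReal_le_ofReal
          rw [Real.rpow_ofNat]
          rcases le_total |φ k x| 1 with h | h
          · have h1 : 0 ≤ |φ k x| ^ n := by positivity
            have h2 := pow_le_one₀ (abs_nonneg (φ k x)) h (n := 2)
            linarith
          · have := pow_le_pow_right₀ h h2n
            linarith
      _ = ENNReal.ofReal (∫ x in Ω, (1 + |fn (v k) x| ^ n)) :=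
          (ofReal_integral_eq_lintegral_ofReal ((integrable_const _).add (integrable_fn_pow _))
            (Eventually.of_forall fun x => add_nonneg zero_le_one (by positivity))).symm
      _ ≤ _ := by
          apply ENNReal.ofReal_le_ofReal
          rw [integral_add (integrable_const _) (integrable_fn_pow _)]
          simp only [integral_const, smul_eq_mul, mul_one, measureReal_restrict_apply_univ]
          have h1 := hpoin (v k)
          have h2 := mul_le_mul_of_nonneg_left (hNv k) hB
          linarith
  obtain ⟨σ, f, hσ, hf, hlim⟩ := exists_subseq_tendsto_eLpNorm_one hΩ φ hφ _ _ hI1 hI2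
  refine ⟨σ, f, hσ, hf, ?_⟩
  have hle : ∀ k, eLpNorm (fn (w (σ k)) - f) 1 (volume.restrict Ω) ≤
      ENNReal.ofReal (1 / (((σ k : ℕ) : ℝ) + 1)) * volume Ω ^ (1 - 1 / (n : ℝ)) +
        eLpNorm (φ (σ k) - f) 1 (volume.restrict Ω) := by
    intro k
    have e : eLpNorm (φ (σ k) - f) 1 (volume.restrict Ω) =
        eLpNorm (fn (v (σ k)) - f) 1 (volume.restrict Ω) := by
      apply eLpNorm_congr_ae
      filter_upwards [hfn (σ k)] with x hx
      simp [hx]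
    rw [e]
    have h1 := eLpNorm_add_le ((aestronglyMeasurable_fn (w (σ k))).sub
      (aestronglyMeasurable_fn (v (σ k)))) ((aestronglyMeasurable_fn (v (σ k))).sub hf) le_rfl
      (p := 1)
    rw [sub_add_sub_cancel] at h1
    refine h1.trans (add_le_add ((eLpNorm_fn_sub_le _ _).trans ?_) le_rfl)
    gcongr
    exact hclose _
  refine tendsto_of_tendsto_of_tendsto_of_le_of_le tendsto_const_nhds ?_ (fun _ => zero_le) hle
  have hz : Tendsto (fun k => ENNReal.ofReal (1 / (((σ k : ℕ) : ℝ) + 1))) atTop (𝓝 0) := by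
    have := (ENNReal.continuous_ofReal.tendsto 0).comp
      (tendsto_one_div_add_atTop_nhds_zero_nat.comp hσ.tendsto_atTop)
    rw [ENNReal.ofReal_zero] at this
    exact this
  have hexp : (0 : ℝ) ≤ 1 - 1 / (n : ℝ) := by
    have : (1 : ℝ) ≤ n := by exact_mod_cast (by omega : 1 ≤ n)
    rw [sub_nonneg, div_le_one (by linarith)]; exact this
  have := (ENNReal.Tendsto.mul_const hz
    (Or.inr (ENNReal.rpow_ne_top_of_nonneg hexp hΩ))).add hlim
  simpa using this

/-- `|u|` belongs to `W₀^{1,n}(Ω)` and has norm at most that of `u`: it is the limit of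
`√(φ² + ε²) - ε` for test functions `φ → u`, whose gradients are dominated by those of `φ`. -/
lemma exists_abs (hΩ : volume Ω ≠ ⊤) (u : W0 Ω) :
    ∃ v : W0 Ω, fn v =ᵐ[volume.restrict Ω] (fun x => |fn u x|) ∧ normPow v ≤ normPow u := by
  have h2n := hn.out
  have hfinΩ : IsFiniteMeasure (volume.restrict Ω) := ⟨by simpa using hΩ.lt_top⟩
  obtain ⟨φ, w, hφ, hlim⟩ := exists_seq_isTest u
  set ε : ℕ → ℝ := fun k => 1 / ((k : ℝ) + 1) with hε
  have hε0 : ∀ k, 0 < ε k := fun k => by positivity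
  set r : ℕ → ℝ → ℝ := fun k s => √(s ^ 2 + ε k ^ 2) - ε k with hr
  have hrd : ∀ k s, HasDerivAt (r k) (s / √(s ^ 2 + ε k ^ 2)) s := by
    intro k s
    have h0 : s ^ 2 + ε k ^ 2 ≠ 0 := by have := hε0 k; positivity
    have := ((((hasDerivAt_id s).pow 2).add_const (ε k ^ 2)).sqrt h0).sub_const (ε k)
    convert! this using 1
    simp only [id, Nat.cast_ofNat, Nat.reduceSub, pow_one, mul_one, Pi.pow_apply]
    rw [mul_div_mul_left _ _ two_ne_zero]
  have hrs : ∀ k, ContDiff ℝ ∞ (r k) := by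
    intro k
    refine ContDiff.sub (ContDiff.sqrt (by fun_prop) fun s => ?_) contDiff_const
    have := hε0 k; positivity
  have hr0 : ∀ k, r k 0 = 0 := by
    intro k
    simp only [hr]
    rw [zero_pow two_ne_zero, zero_add, Real.sqrt_sq (hε0 k).le, sub_self]
  have hrabs : ∀ k s, |r k s - (|s|)| ≤ ε k := by
    intro k s
    have h1 : |s| ≤ √(s ^ 2 + ε k ^ 2) := by
      rw [← Real.sqrt_sq_eq_abs]; exact Real.sqrt_le_sqrt (by nlinarith [hε0 k])
    have h2 : √(s ^ 2 + ε k ^ 2) ≤ |s| + ε k := by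
      rw [Real.sqrt_le_left (by have := hε0 k; positivity)]
      nlinarith [hε0 k, abs_nonneg s, sq_abs s]
    rw [abs_le]
    simp only [hr]
    constructor <;> linarith [hε0 k]
  have htest : ∀ k, IsTest Ω (r k ∘ φ k) := fun k =>
    ⟨(hrs k).comp (hφ k).1.smooth, (hφ k).1.compact.comp_left (hr0 k),
      (closure_mono (Function.support_comp_subset (hr0 k) _)).trans (hφ k).1.supp⟩
  choose v hv1 hv2 using fun k => exists_of_isTest (htest k)
  have hN : ∀ k, normPow (v k) ≤ normPow (w k) := by
    intro k
    refine integral_mono_ae (integrable_grad_pow _) (integrable_grad_pow _) ?_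
    filter_upwards [hv2 k, (hφ k).2.2] with x h1 h2
    rw [h1, h2, norm_gradient, norm_gradient]
    gcongr
    have hd := ((hφ k).1.smooth.differentiable (by simp) x).hasFDerivAt
    have := (hrd k (φ k x)).comp_hasFDerivAt x hd
    rw [this.fderiv, norm_smul]
    refine mul_le_of_le_one_left (norm_nonneg _) ?_
    have hpos : 0 < √(φ k x ^ 2 + ε k ^ 2) := Real.sqrt_pos.2 (by have := hε0 k; positivity)
    rw [norm_div, Real.norm_of_nonneg hpos.le, div_le_one hpos, Real.norm_eq_abs,
      ← Real.sqrt_sq_eq_abs]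
    exact Real.sqrt_le_sqrt (by nlinarith [hε0 k])
  refine exists_normPow_le_of_tendsto hΩ (aestronglyMeasurable_fn u).norm hN
    (continuous_normPow.continuousAt.tendsto.comp hlim) ?_
  have hle : ∀ k, eLpNorm (fn (v k) - fun x => |fn u x|) 1 (volume.restrict Ω) ≤
      ENNReal.ofReal (ε k) * volume Ω + eLpNorm (fn (w k) - fn u) 1 (volume.restrict Ω) := by
    intro k
    rw [eLpNorm_one_eq_lintegral_enorm, eLpNorm_one_eq_lintegral_enorm]
    calc _ ≤ ∫⁻ x in Ω, (ENNReal.ofReal (ε k) + ‖(fn (w k) - fn u) x‖ₑ) := by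
          refine lintegral_mono_ae ?_
          filter_upwards [hv1 k, (hφ k).2.1] with x h1 h2
          simp only [Pi.sub_apply, h1, h2, Function.comp_apply]
          rw [← ofReal_norm, ← ofReal_norm, ← ENNReal.ofReal_add (hε0 k).le (norm_nonneg _)]
          apply ENNReal.ofReal_le_ofReal
          rw [Real.norm_eq_abs, Real.norm_eq_abs]
          have h3 := hrabs k (φ k x)
          have h4 := abs_abs_sub_abs_le_abs_sub (φ k x) (fn u x)
          have h5 := abs_add_le (r k (φ k x) - |φ k x|) (|φ k x| - |fn u x|)
          rw [sub_add_sub_cancel] at h5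
          linarith
      _ = _ := by
          rw [lintegral_add_left measurable_const, lintegral_const, Measure.restrict_apply_univ]
  refine tendsto_of_tendsto_of_tendsto_of_le_of_le tendsto_const_nhds ?_ (fun _ => zero_le) hle
  have hz : Tendsto (fun k => ENNReal.ofReal (ε k)) atTop (𝓝 0) := by
    have := (ENNReal.continuous_ofReal.tendsto 0).comp
      (tendsto_one_div_add_atTop_nhds_zero_nat (𝕜 := ℝ))
    rw [ENNReal.ofReal_zero] at this
    exact this
  have hz2 : Tendsto (fun k => eLpNorm (fn (w k) - fn u) 1 (volume.restrict Ω)) atTop (𝓝 0) := by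
    refine tendsto_of_tendsto_of_tendsto_of_le_of_le tendsto_const_nhds ?_ (fun _ => zero_le)
      (fun k => eLpNorm_fn_sub_le (w k) u)
    have h1 : Tendsto (fun k => ‖w k - u‖) atTop (𝓝 0) := by
      have := (hlim.sub_const u).norm
      simpa using this
    have h2 := (ENNReal.continuous_ofReal.tendsto 0).comp h1
    have hexp : (0 : ℝ) ≤ 1 - 1 / (n : ℝ) := by
      have : (1 : ℝ) ≤ n := by exact_mod_cast (by omega : 1 ≤ n)
      rw [sub_nonneg, div_le_one (by linarith)]; exact this
    have := ENNReal.Tendsto.mul_const h2 (Or.inr (ENNReal.rpow_ne_top_of_nonneg hexp hΩ))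
    simpa using this
  have := (ENNReal.Tendsto.mul_const hz (Or.inr hΩ)).add hz2
  simpa using this

/-- Bounded sequences subconverge, after passing to absolute values, to a nonnegative function whose
norm does not exceed the limit of the norms. -/
lemma exists_subseq_tendsto_abs (hΩ : volume Ω ≠ ⊤) (w : ℕ → W0 Ω) (K : ℝ)
    (hw : ∀ k, normPow (w k) ≤ K) :
    ∃ (σ : ℕ → ℕ) (u : W0 Ω) (L : ℝ), StrictMono σ ∧
      Tendsto (fun k => normPow (w (σ k))) atTop (𝓝 L) ∧ normPow u ≤ L ∧
      (∀ᵐ x ∂(volume.restrict Ω), 0 ≤ fn u x) ∧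
      ∀ᵐ x ∂(volume.restrict Ω), Tendsto (fun k => |fn (w (σ k)) x|) atTop (𝓝 (fn u x)) := by
  obtain ⟨L, -, σ₁, hσ₁, hL⟩ := (isCompact_Icc (a := (0 : ℝ)) (b := K)).tendsto_subseq
    (x := fun k => normPow (w k)) fun k => ⟨normPow_nonneg _, hw k⟩
  obtain ⟨σ₂, f, hσ₂, hf, hlim⟩ := exists_subseq_tendsto_fn hΩ (fun k => w (σ₁ k)) K fun k => hw _
  have hm := tendstoInMeasure_of_tendsto_eLpNorm one_ne_zero
    (fun k => aestronglyMeasurable_fn (w (σ₁ (σ₂ k)))) hf hlim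
  obtain ⟨σ₃, hσ₃, hae⟩ := hm.exists_seq_tendsto_ae
  choose v hv1 hv2 using fun k => exists_abs hΩ (w (σ₁ (σ₂ k)))
  have hL2 : Tendsto (fun k => normPow (w (σ₁ (σ₂ k)))) atTop (𝓝 L) := hL.comp hσ₂.tendsto_atTop
  obtain ⟨u, hu, hNu⟩ := exists_normPow_le_of_tendsto hΩ (w := v) (f := fun x => |f x|) hf.norm
    hv2 hL2 (by
      refine tendsto_of_tendsto_of_tendsto_of_le_of_le tendsto_const_nhds hlim (fun _ => zero_le)
        fun k => ?_
      refine eLpNorm_mono_ae ?_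
      filter_upwards [hv1 k] with x hx
      simp only [Pi.sub_apply, hx, Real.norm_eq_abs]
      exact abs_abs_sub_abs_le_abs_sub _ _)
  refine ⟨fun k => σ₁ (σ₂ (σ₃ k)), u, L, hσ₁.comp (hσ₂.comp hσ₃), hL2.comp hσ₃.tendsto_atTop, hNu,
    ?_, ?_⟩
  · filter_upwards [hu] with x hx
    rw [hx]; exact abs_nonneg _
  · filter_upwards [hu, hae] with x hx hx2
    rw [hx]; exact hx2.abs

end Compactness

/-! ### Integral functionals of exponential growth -/

section Functionals

open Filter Topology

/-- A Vitali-type convergence theorem: a bound for `∫ |h| f_k²` prevents concentration. -/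
lemma _root_.MeasureTheory.tendsto_integral_mul_of_bounded_sq {X : Type*} [MeasurableSpace X]
    {μ : Measure X} {h : X → ℝ} (hh : Integrable h μ) {f : ℕ → X → ℝ} {g : X → ℝ} {C : ℝ}
    (hf : ∀ k, AEStronglyMeasurable (f k) μ) (hg : AEStronglyMeasurable g μ)
    (hfi : ∀ k, Integrable (fun x => |h x| * f k x ^ 2) μ)
    (hgi : Integrable (fun x => |h x| * g x ^ 2) μ)
    (hfC : ∀ k, ∫ x, |h x| * f k x ^ 2 ∂μ ≤ C) (hgC : ∫ x, |h x| * g x ^ 2 ∂μ ≤ C)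
    (hlim : ∀ᵐ x ∂μ, Tendsto (fun k => f k x) atTop (𝓝 (g x))) :
    Tendsto (fun k => ∫ x, h x * f k x ∂μ) atTop (𝓝 (∫ x, h x * g x ∂μ)) := by
  have hint : ∀ r : X → ℝ, AEStronglyMeasurable r μ → Integrable (fun x => |h x| * r x ^ 2) μ →
      Integrable (fun x => h x * r x) μ := by
    intro r hr hri
    refine (hh.abs.add hri).mono' (hh.1.mul hr) (Eventually.of_forall fun x => ?_)
    rw [Real.norm_eq_abs, abs_mul, Pi.add_apply]
    have h1 : |r x| ≤ 1 + r x ^ 2 := by nlinarith [sq_nonneg (|r x| - 1), sq_abs (r x)]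
    nlinarith [abs_nonneg (h x), mul_le_mul_of_nonneg_left h1 (abs_nonneg (h x))]
  have hC : 0 ≤ C := (integral_nonneg fun x => by positivity).trans hgC
  -- the square of the difference stays bounded
  have hdi : ∀ k, Integrable (fun x => |h x| * (f k x - g x) ^ 2) μ := by
    intro k
    refine (((hfi k).add hgi).const_mul 2).mono' (hh.1.norm.mul (((hf k).sub hg).pow 2))
      (Eventually.of_forall fun x => ?_)
    rw [Real.norm_of_nonneg (by positivity), Pi.add_apply]
    nlinarith [mul_nonneg (abs_nonneg (h x)) (sq_nonneg (f k x + g x))]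
  have hdC : ∀ k, ∫ x, |h x| * (f k x - g x) ^ 2 ∂μ ≤ 4 * C := by
    intro k
    calc _ ≤ ∫ x, 2 * (|h x| * f k x ^ 2 + |h x| * g x ^ 2) ∂μ := by
          refine integral_mono (hdi k) (((hfi k).add hgi).const_mul 2) fun x => ?_
          beta_reduce
          nlinarith [mul_nonneg (abs_nonneg (h x)) (sq_nonneg (f k x + g x))]
      _ ≤ _ := by
          rw [integral_const_mul, integral_add (hfi k) hgi]
          linarith [hfC k]
  rw [tendsto_iff_norm_sub_tendsto_zero]
  refine tendsto_order.2 ⟨fun a ha => Eventually.of_forall fun k => ha.trans_le (norm_nonneg _),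
    fun δ hδ => ?_⟩
  -- Below the threshold `M` dominated convergence applies; above it `|s| ≤ s² / M`, and the choice of
  -- `M` makes the contribution at most `δ/2`.
  set M : ℝ := (8 * C + 1) / δ with hM
  have hM0 : 0 < M := by positivity
  have hminint : ∀ k, Integrable (fun x => |h x| * min |f k x - g x| M) μ := by
    intro k
    refine (hh.abs.mul_const M).mono'
      (hh.1.norm.mul (((hf k).sub hg).norm.inf aestronglyMeasurable_const))
      (Eventually.of_forall fun x => ?_)
    rw [Real.norm_of_nonneg (by positivity)]
    exact mul_le_mul_of_nonneg_left (min_le_right _ _) (abs_nonneg _)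
  have hmin : Tendsto (fun k => ∫ x, |h x| * min |f k x - g x| M ∂μ) atTop (𝓝 0) := by
    have := tendsto_integral_of_dominated_convergence (μ := μ)
      (F := fun k x => |h x| * min |f k x - g x| M) (f := fun _ => 0) (fun x => |h x| * M)
      (fun k => (hminint k).1) (hh.abs.mul_const M)
      (fun k => Eventually.of_forall fun x => by
        rw [Real.norm_of_nonneg (by positivity)]
        exact mul_le_mul_of_nonneg_left (min_le_right _ _) (abs_nonneg _))
      (by
        filter_upwards [hlim] with x hx
        have h1 : Tendsto (fun k => |f k x - g x|) atTop (𝓝 0) := by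
          have := (hx.sub_const (g x)).abs
          simpa using this
        have := (h1.min (tendsto_const_nhds (x := M))).const_mul |h x|
        simpa [min_eq_left hM0.le] using this)
    simpa using this
  filter_upwards [hmin.eventually_lt_const (half_pos hδ)] with k hk
  rw [← integral_sub (hint _ (hf k) (hfi k)) (hint _ hg hgi)]
  calc ‖∫ x, (h x * f k x - h x * g x) ∂μ‖
      ≤ ∫ x, (|h x| * min |f k x - g x| M + M⁻¹ * (|h x| * (f k x - g x) ^ 2)) ∂μ := by
        refine norm_integral_le_of_norm_le ((hminint k).add ((hdi k).const_mul _))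
          (Eventually.of_forall fun x => ?_)
        rw [← mul_sub, Real.norm_eq_abs, abs_mul, mul_left_comm, ← mul_add]
        refine mul_le_mul_of_nonneg_left ?_ (abs_nonneg _)
        rcases le_total |f k x - g x| M with h1 | h1
        · rw [min_eq_left h1]
          have : 0 ≤ M⁻¹ * (f k x - g x) ^ 2 := by positivity
          linarith
        · rw [min_eq_right h1, ← sq_abs (f k x - g x)]
          have : |f k x - g x| ≤ M⁻¹ * |f k x - g x| ^ 2 := by
            rw [le_inv_mul_iff₀ hM0]; nlinarith [abs_nonneg (f k x - g x)]
          linarith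
    _ = ∫ x, |h x| * min |f k x - g x| M ∂μ + M⁻¹ * ∫ x, |h x| * (f k x - g x) ^ 2 ∂μ := by
        rw [integral_add (hminint k) ((hdi k).const_mul _), integral_const_mul]
    _ < δ / 2 + M⁻¹ * (4 * C) + 0 := by
        have := mul_le_mul_of_nonneg_left (hdC k) (inv_pos.2 hM0).le
        linarith
    _ ≤ δ := by
        rw [hM, inv_div, add_zero]
        have : δ / (8 * C + 1) * (4 * C) ≤ δ / 2 := by
          rw [div_mul_eq_mul_div, div_le_div_iff₀ (by positivity) two_pos]
          nlinarith
        linarith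

/-- Strict differentiability gives the limit of difference quotients with both points moving. -/
lemma _root_.HasStrictFDerivAt.tendsto_diffQuot {V ι : Type*} [NormedAddCommGroup V]
    [NormedSpace ℝ V] {F : V → ℝ} {F' : V →L[ℝ] ℝ} {y c : V} (hF : HasStrictFDerivAt F F' y)
    {l : Filter ι} {r s c' : ι → V} {ε : ι → ℝ} (hr : Tendsto r l (𝓝 y)) (hs : Tendsto s l (𝓝 y))
    (hrs : ∀ᶠ i in l, r i - s i = ε i • c' i) (hc : Tendsto c' l (𝓝 c)) (hε : ∀ᶠ i in l, ε i ≠ 0) :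
    Tendsto (fun i => (F (r i) - F (s i)) / ε i) l (𝓝 (F' c)) := by
  have h1 := hF.isLittleO.comp_tendsto (hr.prodMk_nhds hs)
  have h2 : (fun i => r i - s i) =O[l] ε := by
    have : (fun i => ε i • c' i) =O[l] fun i => ε i • (1 : ℝ) :=
      (Asymptotics.isBigO_refl ε l).smul (hc.isBigO_one ℝ)
    simp only [smul_eq_mul, mul_one] at this
    exact this.congr' (hrs.mono fun i hi => hi.symm) EventuallyEq.rfl
  have h3 := (h1.trans_isBigO h2).tendsto_div_nhds_zero
  have h4 : Tendsto (fun i => F' (c' i)) l (𝓝 (F' c)) := (F'.continuous.tendsto c).comp hc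
  have h5 := h3.add h4
  rw [zero_add] at h5
  refine h5.congr' ?_
  filter_upwards [hrs, hε] with i hi hi0
  simp only [Function.comp_apply, hi, map_smul, smul_eq_mul]
  field_simp
  ring

lemma memLp_one {n : ℕ} {Ω : Set (E n)} (hΩ : volume Ω ≠ ⊤) :
    MemLp (fun _ : E n => (1 : ℝ)) (ENNReal.ofReal 2) (volume.restrict Ω) := by
  have hfinΩ : IsFiniteMeasure (volume.restrict Ω) := ⟨by simpa using hΩ.lt_top⟩
  exact memLp_const 1

variable {n : ℕ} [hn : Fact (2 ≤ n)] {Ω : Set (E n)} {β : ℝ}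

/-- A weight in `L^γ`, `γ > 1`, times a function of exponential growth in `u ∈ W₀^{1,n}(Ω)` is
integrable, with a bound uniform on balls: Young's inequality and Trudinger's. -/
lemma integrable_mul_of_le_exp (hΩ : volume Ω ≠ ⊤) (hβ : 0 < β) (hβn : β < (n : ℝ) / ((n : ℝ) - 1))
    {h : E n → ℝ} {γ : ℝ} (hγ : 1 < γ) (hh : MemLp h (ENNReal.ofReal γ) (volume.restrict Ω))
    (C α K : ℝ) (hα : 0 ≤ α) :
    ∃ B : ℝ, 0 ≤ B ∧ ∀ u : W0 Ω, normPow u ≤ K → ∀ f : E n → ℝ,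
      AEStronglyMeasurable f (volume.restrict Ω) →
      (∀ᵐ x ∂(volume.restrict Ω), |f x| ≤ C * Real.exp (α * |fn u x| ^ β)) →
      IntegrableOn (fun x => h x * f x) Ω ∧ ∫ x in Ω, |h x| * |f x| ≤ B := by
  set γ' := Real.conjExponent γ with hγ'
  have hconj : γ.HolderConjugate γ' := Real.HolderConjugate.conjExponent hγ
  obtain ⟨T, hT, hTr⟩ := lintegral_exp_fn_le (Ω := Ω) hΩ hβ hβn (γ' * α)
    (mul_nonneg hconj.symm.pos.le hα) K
  have hhγ : Integrable (fun x => |h x| ^ γ) (volume.restrict Ω) := by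
    have := hh.integrable_norm_rpow (by simp [hconj.pos]) ENNReal.ofReal_ne_top
    rwa [ENNReal.toReal_ofReal hconj.pos.le] at this
  refine ⟨(∫ x in Ω, |h x| ^ γ) + |C| ^ γ' * T, by positivity, fun u hu f hf hle => ?_⟩
  have hexpm : AEStronglyMeasurable (fun x => Real.exp (γ' * α * |fn u x| ^ β))
      (volume.restrict Ω) := by
    have hc : Continuous fun s : ℝ => Real.exp (γ' * α * |s| ^ β) :=
      Real.continuous_exp.comp (continuous_const.mul
        (continuous_abs.rpow_const fun _ => Or.inr hβ.le))
    exact hc.comp_aestronglyMeasurable (aestronglyMeasurable_fn u)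
  have hexpi : Integrable (fun x => Real.exp (γ' * α * |fn u x| ^ β)) (volume.restrict Ω) := by
    refine ⟨hexpm, ?_⟩
    rw [hasFiniteIntegral_iff_ofReal (Eventually.of_forall fun x => (Real.exp_pos _).le)]
    exact (hTr u hu).trans_lt ENNReal.ofReal_lt_top
  have hexple : ∫ x in Ω, Real.exp (γ' * α * |fn u x| ^ β) ≤ T := by
    rw [integral_eq_lintegral_of_nonneg_ae (Eventually.of_forall fun x => (Real.exp_pos _).le) hexpm]
    exact ENNReal.toReal_le_of_le_ofReal hT (hTr u hu)
  have hpt : ∀ᵐ x ∂(volume.restrict Ω), |h x| * |f x| ≤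
      |h x| ^ γ + |C| ^ γ' * Real.exp (γ' * α * |fn u x| ^ β) := by
    filter_upwards [hle] with x hx
    have h1 := Real.young_inequality_of_nonneg (abs_nonneg (h x)) (abs_nonneg (f x)) hconj
    have h2 : |h x| ^ γ / γ ≤ |h x| ^ γ := div_le_self (by positivity) hγ.le
    have h3 : |f x| ^ γ' / γ' ≤ |f x| ^ γ' := div_le_self (by positivity) hconj.symm.lt.le
    have h4 : |f x| ^ γ' ≤ |C| ^ γ' * Real.exp (γ' * α * |fn u x| ^ β) := by
      calc |f x| ^ γ' ≤ (|C| * Real.exp (α * |fn u x| ^ β)) ^ γ' := by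
            apply Real.rpow_le_rpow (abs_nonneg _) _ hconj.symm.pos.le
            refine hx.trans ?_
            gcongr
            exact le_abs_self C
        _ = _ := by
            rw [Real.mul_rpow (abs_nonneg _) (Real.exp_pos _).le, ← Real.exp_mul]
            congr 2; ring
    linarith
  have hdom : Integrable (fun x => |h x| ^ γ + |C| ^ γ' * Real.exp (γ' * α * |fn u x| ^ β))
      (volume.restrict Ω) := hhγ.add (hexpi.const_mul _)
  constructor
  · refine hdom.mono' (hh.1.mul hf) ?_
    filter_upwards [hpt] with x hx
    rwa [Real.norm_eq_abs, abs_mul]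
  · calc _ ≤ ∫ x in Ω, (|h x| ^ γ + |C| ^ γ' * Real.exp (γ' * α * |fn u x| ^ β)) := by
          refine integral_mono_of_nonneg (Eventually.of_forall fun x => by positivity) hdom hpt
      _ ≤ _ := by
          rw [integral_add hhγ (hexpi.const_mul _), integral_const_mul]
          exact add_le_add le_rfl (mul_le_mul_of_nonneg_left hexple (by positivity))

/-- `F` grows at most exponentially in `|s|^β`; the rate `α` is arbitrary, so that products of such
functions are again of this kind. -/
def ExpGrowth (β : ℝ) (F : ℝ → ℝ) : Prop :=
  ∃ C α : ℝ, 0 ≤ C ∧ 0 ≤ α ∧ ∀ s, |F s| ≤ C * Real.exp (α * |s| ^ β)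

lemma ExpGrowth.mul {F₁ F₂ : ℝ → ℝ} (h₁ : ExpGrowth β F₁) (h₂ : ExpGrowth β F₂) :
    ExpGrowth β fun s => F₁ s * F₂ s := by
  obtain ⟨C, α, hC, hα, hb⟩ := h₁
  obtain ⟨C', α', hC', hα', hb'⟩ := h₂
  refine ⟨C * C', α + α', by positivity, by positivity, fun s => ?_⟩
  rw [abs_mul, add_mul, Real.exp_add]
  calc _ ≤ _ := mul_le_mul (hb s) (hb' s) (abs_nonneg _) (by positivity)
    _ = _ := by ring

lemma expGrowth_rpow (hβ : 0 < β) {r : ℝ} (hr : 0 ≤ r) : ExpGrowth β fun s => |s| ^ r := by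
  obtain ⟨C, hC, hb⟩ := Real.exists_rpow_le_mul_exp_rpow r hr hβ
  refine ⟨C, 1, hC.le, zero_le_one, fun s => ?_⟩
  rw [abs_of_nonneg (by positivity), one_mul]
  exact hb _ (abs_nonneg s)

lemma expGrowth_exp : ExpGrowth β fun s => Real.exp (|s| ^ β) :=
  ⟨1, 1, zero_le_one, zero_le_one, fun s => by rw [abs_of_pos (Real.exp_pos _)]; simp⟩

lemma expGrowth_const (c : ℝ) : ExpGrowth β fun _ => c :=
  ⟨|c|, 0, abs_nonneg c, le_rfl, fun s => by simp⟩

lemma ExpGrowth.add {F₁ F₂ : ℝ → ℝ} (h₁ : ExpGrowth β F₁) (h₂ : ExpGrowth β F₂) :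
    ExpGrowth β fun s => F₁ s + F₂ s := by
  obtain ⟨C, α, hC, hα, hb⟩ := h₁
  obtain ⟨C', α', hC', hα', hb'⟩ := h₂
  refine ⟨C + C', α + α', by positivity, by positivity, fun s => ?_⟩
  have e1 : Real.exp (α * |s| ^ β) ≤ Real.exp ((α + α') * |s| ^ β) := by gcongr; linarith
  have e2 : Real.exp (α' * |s| ^ β) ≤ Real.exp ((α + α') * |s| ^ β) := by gcongr; linarith
  calc _ ≤ |F₁ s| + |F₂ s| := abs_add_le _ _
    _ ≤ C * Real.exp (α * |s| ^ β) + C' * Real.exp (α' * |s| ^ β) := add_le_add (hb s) (hb' s)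
    _ ≤ C * Real.exp ((α + α') * |s| ^ β) + C' * Real.exp ((α + α') * |s| ^ β) := by gcongr
    _ = _ := by ring

lemma ExpGrowth.mono {F₁ F₂ : ℝ → ℝ} (h₁ : ExpGrowth β F₁) (h : ∀ s, |F₂ s| ≤ |F₁ s|) :
    ExpGrowth β F₂ := by
  obtain ⟨C, α, hC, hα, hb⟩ := h₁
  exact ⟨C, α, hC, hα, fun s => (h s).trans (hb s)⟩

lemma integrable_mul_comp (hΩ : volume Ω ≠ ⊤) (hβ : 0 < β) (hβn : β < (n : ℝ) / ((n : ℝ) - 1))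
    {h : E n → ℝ} {γ : ℝ} (hγ : 1 < γ) (hh : MemLp h (ENNReal.ofReal γ) (volume.restrict Ω))
    {F : ℝ → ℝ} (hF : Continuous F) (hFg : ExpGrowth β F) (u : W0 Ω) :
    IntegrableOn (fun x => h x * F (fn u x)) Ω := by
  obtain ⟨C, α, hC, hα, hb⟩ := hFg
  obtain ⟨B, hB, h1⟩ := integrable_mul_of_le_exp (Ω := Ω) hΩ hβ hβn hγ hh C α (normPow u) hα
  exact (h1 u le_rfl _ (hF.comp_aestronglyMeasurable (aestronglyMeasurable_fn u))
    (Eventually.of_forall fun x => hb _)).1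

lemma integrable_comp (hΩ : volume Ω ≠ ⊤) (hβ : 0 < β) (hβn : β < (n : ℝ) / ((n : ℝ) - 1))
    {F : ℝ → ℝ} (hF : Continuous F) (hFg : ExpGrowth β F) (u : W0 Ω) :
    IntegrableOn (fun x => F (fn u x)) Ω := by
  simpa using integrable_mul_comp hΩ hβ hβn one_lt_two (memLp_one hΩ) hF hFg u

lemma exists_bound_integral_mul_comp (hΩ : volume Ω ≠ ⊤) (hβ : 0 < β)
    (hβn : β < (n : ℝ) / ((n : ℝ) - 1)) {h : E n → ℝ} {γ : ℝ} (hγ : 1 < γ)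
    (hh : MemLp h (ENNReal.ofReal γ) (volume.restrict Ω))
    {F : ℝ → ℝ} (hF : Continuous F) (hFg : ExpGrowth β F) (K : ℝ) :
    ∃ B : ℝ, 0 ≤ B ∧ ∀ u : W0 Ω, normPow u ≤ K → |∫ x in Ω, h x * F (fn u x)| ≤ B := by
  obtain ⟨C, α, hC, hα, hb⟩ := hFg
  obtain ⟨B, hB, h1⟩ := integrable_mul_of_le_exp (Ω := Ω) hΩ hβ hβn hγ hh C α K hα
  refine ⟨B, hB, fun u hu => ?_⟩
  have h2 := (h1 u hu _ (hF.comp_aestronglyMeasurable (aestronglyMeasurable_fn u))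
    (Eventually.of_forall fun x => hb _)).2
  refine le_trans ?_ h2
  have := norm_integral_le_integral_norm (μ := volume.restrict Ω) (fun x => h x * F (fn u x))
  simpa only [Real.norm_eq_abs, abs_mul] using this

/-- Functionals of exponential growth pass to the limit along bounded sequences converging
almost everywhere. Only the moduli have to converge, as `F` is even. -/
lemma tendsto_integral_mul_comp (hΩ : volume Ω ≠ ⊤) (hβ : 0 < β)
    (hβn : β < (n : ℝ) / ((n : ℝ) - 1)) {h : E n → ℝ} {γ : ℝ} (hγ : 1 < γ)
    (hh : MemLp h (ENNReal.ofReal γ) (volume.restrict Ω)) {F : ℝ → ℝ} (hF : Continuous F)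
    (hFg : ExpGrowth β F) (hFe : ∀ s, F |s| = F s) {w : ℕ → W0 Ω} {u : W0 Ω} {K : ℝ}
    (hw : ∀ k, normPow (w k) ≤ K) (hu : normPow u ≤ K)
    (hlim : ∀ᵐ x ∂(volume.restrict Ω), Tendsto (fun k => |fn (w k) x|) atTop (𝓝 |fn u x|)) :
    Tendsto (fun k => ∫ x in Ω, h x * F (fn (w k) x)) atTop (𝓝 (∫ x in Ω, h x * F (fn u x))) := by
  have hfinΩ : IsFiniteMeasure (volume.restrict Ω) := ⟨by simpa using hΩ.lt_top⟩
  obtain ⟨C, α, hC, hα, hb⟩ := hFg.mul hFg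
  obtain ⟨B, hB, h1⟩ := integrable_mul_of_le_exp (Ω := Ω) hΩ hβ hβn hγ hh.norm C α K hα
  have h2 : ∀ v : W0 Ω, normPow v ≤ K → IntegrableOn (fun x => |h x| * F (fn v x) ^ 2)
      Ω ∧ ∫ x in Ω, |h x| * F (fn v x) ^ 2 ≤ B := by
    intro v hv
    have h3 := h1 v hv (fun x => F (fn v x) * F (fn v x))
      ((hF.mul hF).comp_aestronglyMeasurable (aestronglyMeasurable_fn v))
      (Eventually.of_forall fun x => hb _)
    simpa only [Real.norm_eq_abs, abs_abs, ← sq, abs_sq] using h3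
  have hhi : Integrable h (volume.restrict Ω) := hh.integrable (by
    rw [ENNReal.one_le_ofReal]; exact hγ.le)
  refine tendsto_integral_mul_of_bounded_sq hhi (C := B)
    (fun k => hF.comp_aestronglyMeasurable (aestronglyMeasurable_fn _))
    (hF.comp_aestronglyMeasurable (aestronglyMeasurable_fn _))
    (fun k => (h2 _ (hw k)).1) (h2 _ hu).1 (fun k => (h2 _ (hw k)).2) (h2 _ hu).2 ?_
  filter_upwards [hlim] with x hx
  have := (hF.tendsto _).comp hx
  simp only [hFe] at this
  refine this.congr fun k => ?_
  simp only [Function.comp_apply, hFe]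

/-- A function in `W₀^{1,n}(Ω)` dominating both `|u|` and `|v|`. -/
lemma exists_abs_add_abs (hΩ : volume Ω ≠ ⊤) (u v : W0 Ω) :
    ∃ z : W0 Ω, fn z =ᵐ[volume.restrict Ω] fun x => |fn u x| + |fn v x| := by
  obtain ⟨u', hu, -⟩ := exists_abs hΩ u
  obtain ⟨v', hv, -⟩ := exists_abs hΩ v
  refine ⟨u' + v', ?_⟩
  filter_upwards [fn_add u' v', hu, hv] with x h1 h2 h3
  rw [h1, h2, h3]

lemma exists_integrable_mul_of_le (hΩ : volume Ω ≠ ⊤) (hβ : 0 < β)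
    (hβn : β < (n : ℝ) / ((n : ℝ) - 1))
    {h : E n → ℝ} {γ : ℝ} (hγ : 1 < γ) (hh : MemLp h (ENNReal.ofReal γ) (volume.restrict Ω))
    (C α : ℝ) (hα : 0 ≤ α) (u v : W0 Ω) {f : E n → ℝ}
    (hf : AEStronglyMeasurable f (volume.restrict Ω))
    (hle : ∀ᵐ x ∂(volume.restrict Ω),
      |f x| ≤ C * Real.exp (α * (|fn u x| + |fn v x|) ^ β)) :
    IntegrableOn (fun x => h x * f x) Ω := by
  obtain ⟨z, hz⟩ := exists_abs_add_abs hΩ u v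
  obtain ⟨B, hB, h1⟩ := integrable_mul_of_le_exp (Ω := Ω) hΩ hβ hβn hγ hh C α (normPow z) hα
  refine (h1 z le_rfl f hf ?_).1
  filter_upwards [hle, hz] with x h2 h3
  rwa [h3, abs_of_nonneg (add_nonneg (abs_nonneg (fn u x)) (abs_nonneg (fn v x)))]

lemma integrable_mul_comp_mul (hΩ : volume Ω ≠ ⊤) (hβ : 0 < β)
    (hβn : β < (n : ℝ) / ((n : ℝ) - 1))
    {h : E n → ℝ} {γ : ℝ} (hγ : 1 < γ) (hh : MemLp h (ENNReal.ofReal γ) (volume.restrict Ω))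
    {F : ℝ → ℝ} (hF : Continuous F) (hFg : ExpGrowth β F) (u v : W0 Ω) :
    IntegrableOn (fun x => h x * (F (fn u x) * fn v x)) Ω := by
  obtain ⟨C, α, hC, hα, hb⟩ := hFg
  obtain ⟨C', hC', hb'⟩ := Real.exists_rpow_le_mul_exp_rpow 1 zero_le_one hβ
  refine exists_integrable_mul_of_le hΩ hβ hβn hγ hh (C * C') (α + 1) (by positivity) u v
    ((hF.comp_aestronglyMeasurable (aestronglyMeasurable_fn u)).mul (aestronglyMeasurable_fn v))
    (Eventually.of_forall fun x => ?_)
  rw [abs_mul, add_mul, one_mul, Real.exp_add]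
  have h0 : 0 ≤ |fn u x| + |fn v x| := by positivity
  have h1 : |F (fn u x)| ≤ C * Real.exp (α * (|fn u x| + |fn v x|) ^ β) := by
    refine (hb _).trans ?_
    gcongr
    linarith [abs_nonneg (fn v x)]
  have h2 : |fn v x| ≤ C' * Real.exp ((|fn u x| + |fn v x|) ^ β) := by
    have := hb' _ h0
    rw [Real.rpow_one] at this
    linarith [abs_nonneg (fn u x)]
  calc _ ≤ _ := mul_le_mul h1 h2 (abs_nonneg _) (by positivity)
    _ = _ := by ring

lemma aestronglyMeasurable_comp₂ (Φ : ℝ → ℝ → ℝ) (hΦ : Continuous fun p : ℝ × ℝ => Φ p.1 p.2)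
    (u v : W0 Ω) : AEStronglyMeasurable (fun x => Φ (fn u x) (fn v x)) (volume.restrict Ω) := by
  have := hΦ.comp_aestronglyMeasurable
    ((aestronglyMeasurable_fn u).prodMk (aestronglyMeasurable_fn v))
  exact this

lemma aestronglyMeasurable_exp_add_rpow (hβ : 0 < β) (u v : W0 Ω) (A : ℝ) :
    AEStronglyMeasurable (fun x => Real.exp (A * (|fn u x| + |fn v x|) ^ β))
      (volume.restrict Ω) := by
  have h1 : Continuous fun s : ℝ => Real.exp (A * |s| ^ β) :=
    Real.continuous_exp.comp (continuous_const.mul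
      (continuous_abs.rpow_const fun _ => Or.inr hβ.le))
  have h2 : AEStronglyMeasurable (fun x => |fn u x| + |fn v x|) (volume.restrict Ω) :=
    (aestronglyMeasurable_fn u).norm.add (aestronglyMeasurable_fn v).norm
  refine (h1.comp_aestronglyMeasurable h2).congr (Eventually.of_forall fun x => ?_)
  simp only [abs_of_nonneg (add_nonneg (abs_nonneg (fn u x)) (abs_nonneg (fn v x)))]

/-- The difference quotients of `F` along `t (y + ε z)` are dominated uniformly in `t` and `ε`. -/
lemma abs_diffQuot_le_exp {β : ℝ} (hβ : 0 < β) {F F' : ℝ → ℝ} (hF : ∀ s, HasDerivAt F (F' s) s)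
    {C α C' : ℝ} (hC : 0 ≤ C) (hα : 0 ≤ α)
    (hb : ∀ s, |F' s| ≤ C * Real.exp (α * |s| ^ β))
    (hb' : ∀ s : ℝ, 0 ≤ s → s ^ (1 : ℝ) ≤ C' * Real.exp (s ^ β)) {t ε y z : ℝ} (ht : |t| ≤ 2)
    (hε : |ε| ≤ 1) (hε0 : ε ≠ 0) :
    |(F (t * (y + ε * z)) - F (t * y)) / ε| ≤
      2 * C * C' * Real.exp ((α * 4 ^ β + 1) * (|y| + |z|) ^ β) := by
  set R : ℝ := 4 * (|y| + |z|) with hR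
  have hy0 := abs_nonneg y
  have hz0 := abs_nonneg z
  have hεz : |ε * z| ≤ |z| := by
    rw [abs_mul]; exact mul_le_of_le_one_left hz0 hε
  have ha : |t * (y + ε * z)| ≤ R := by
    rw [abs_mul]
    calc _ ≤ 2 * (|y| + |z|) := by
          refine mul_le_mul ht ?_ (abs_nonneg _) two_pos.le
          exact (abs_add_le _ _).trans (by linarith)
      _ ≤ R := by rw [hR]; linarith
  have hb2 : |t * y| ≤ R := by
    rw [abs_mul]
    calc _ ≤ 2 * |y| := mul_le_mul_of_nonneg_right ht hy0
      _ ≤ R := by rw [hR]; linarith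
  have hmv := (convex_Icc (-R) R).norm_image_sub_le_of_norm_hasDerivWithin_le
    (f := F) (f' := F') (C := C * Real.exp (α * R ^ β))
    (fun s _ => (hF s).hasDerivWithinAt) (fun s hs => by
      refine (hb s).trans ?_
      have h1 : |s| ≤ R := abs_le.2 hs
      have h2 := Real.rpow_le_rpow (abs_nonneg s) h1 hβ.le
      exact mul_le_mul_of_nonneg_left
        (Real.exp_le_exp.2 (mul_le_mul_of_nonneg_left h2 hα)) hC) (abs_le.1 hb2) (abs_le.1 ha)
  have e : t * (y + ε * z) - t * y = t * ε * z := by ring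
  rw [e, Real.norm_eq_abs, Real.norm_eq_abs, abs_mul, abs_mul] at hmv
  rw [abs_div, div_le_iff₀ (abs_pos.2 hε0)]
  have hRβ : R ^ β = 4 ^ β * (|y| + |z|) ^ β := by
    rw [hR, Real.mul_rpow (by norm_num) (by positivity)]
  have hz1 : |z| ≤ C' * Real.exp ((|y| + |z|) ^ β) := by
    have := hb' (|y| + |z|) (by positivity)
    rw [Real.rpow_one] at this
    linarith
  have hexp : Real.exp ((α * 4 ^ β + 1) * (|y| + |z|) ^ β) =
      Real.exp (α * R ^ β) * Real.exp ((|y| + |z|) ^ β) := by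
    rw [← Real.exp_add, hRβ]; congr 1; ring
  calc _ ≤ _ := hmv
    _ ≤ C * Real.exp (α * R ^ β) * (2 * |ε| * (C' * Real.exp ((|y| + |z|) ^ β))) := by
        have h1 : |t| * |ε| ≤ 2 * |ε| := mul_le_mul_of_nonneg_right ht (abs_nonneg _)
        have h2 : |t| * |ε| * |z| ≤ 2 * |ε| * (C' * Real.exp ((|y| + |z|) ^ β)) :=
          mul_le_mul h1 hz1 hz0 (by positivity)
        exact mul_le_mul_of_nonneg_left h2 (by positivity)
    _ = _ := by rw [hexp]; ring

/-- The limit of difference quotients of `∫ h F(u)` in the direction `w`, where the base point is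
allowed to move along the ray through `v`. -/
lemma tendsto_diffQuot_integral_mul_comp (hΩ : volume Ω ≠ ⊤) (hβ : 0 < β)
    (hβn : β < (n : ℝ) / ((n : ℝ) - 1))
    {h : E n → ℝ} {γ : ℝ} (hγ : 1 < γ) (hh : MemLp h (ENNReal.ofReal γ) (volume.restrict Ω))
    {F F' : ℝ → ℝ} (hF : ∀ s, HasDerivAt F (F' s) s) (hF' : Continuous F')
    (hFg : ExpGrowth β F) (hFg' : ExpGrowth β F') (v w : W0 Ω) {ι : Type*} {l : Filter ι}
    [l.IsCountablyGenerated] {t ε : ι → ℝ} (ht : Tendsto t l (𝓝 1)) (hε : Tendsto ε l (𝓝 0))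
    (hε0 : ∀ᶠ i in l, ε i ≠ 0) :
    Tendsto (fun i => ((∫ x in Ω, h x * F (fn (t i • (v + ε i • w)) x)) -
      ∫ x in Ω, h x * F (fn (t i • v) x)) / ε i) l (𝓝 (∫ x in Ω, h x * (F' (fn v x) * fn w x))) := by
  have hFc : Continuous F := continuous_iff_continuousAt.2 fun s => (hF s).continuousAt
  obtain ⟨C, α, hC, hα, hb⟩ := hFg'
  obtain ⟨C', hC', hb'⟩ := Real.exists_rpow_le_mul_exp_rpow 1 zero_le_one hβ
  have hae : ∀ i, (fun x => h x * ((F (fn (t i • (v + ε i • w)) x) - F (fn (t i • v) x)) / ε i))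
      =ᵐ[volume.restrict Ω] fun x => h x *
        ((F (t i * (fn v x + ε i * fn w x)) - F (t i * fn v x)) / ε i) := by
    intro i
    filter_upwards [fn_smul (t i) (v + ε i • w), fn_add v (ε i • w), fn_smul (ε i) w,
      fn_smul (t i) v] with x h1 h2 h3 h4
    rw [h1, h2, h3, h4]
  have heq : ∀ i, ((∫ x in Ω, h x * F (fn (t i • (v + ε i • w)) x)) -
      ∫ x in Ω, h x * F (fn (t i • v) x)) / ε i =
      ∫ x in Ω, h x * ((F (t i * (fn v x + ε i * fn w x)) - F (t i * fn v x)) / ε i) := by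
    intro i
    rw [← integral_congr_ae (hae i), ← integral_sub
      (integrable_mul_comp hΩ hβ hβn hγ hh hFc hFg _)
      (integrable_mul_comp hΩ hβ hβn hγ hh hFc hFg _), ← integral_div]
    congr 1 with x
    ring
  simp only [heq]
  obtain ⟨Bd, hBd⟩ : ∃ Bd : E n → ℝ, ∀ x, Bd x =
      2 * C * C' * Real.exp ((α * 4 ^ β + 1) * (|fn v x| + |fn w x|) ^ β) := ⟨_, fun _ => rfl⟩
  have hBdm : AEStronglyMeasurable Bd (volume.restrict Ω) :=
    ((aestronglyMeasurable_exp_add_rpow hβ v w (α * 4 ^ β + 1)).const_mul (2 * C * C')).congr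
      (Eventually.of_forall fun x => (hBd x).symm)
  refine tendsto_integral_filter_of_dominated_convergence (fun x => |h x| * Bd x) ?_ ?_ ?_ ?_
  · refine Eventually.of_forall fun i => ?_
    have hc : Continuous fun p : ℝ × ℝ => (F (t i * (p.1 + ε i * p.2)) - F (t i * p.1)) / ε i := by
      fun_prop
    exact hh.1.mul (aestronglyMeasurable_comp₂ (fun y z : ℝ =>
      (F (t i * (y + ε i * z)) - F (t i * y)) / ε i) hc v w)
  · have e1 : ∀ᶠ i in l, |t i| ≤ 2 := by
      have := ht.abs
      rw [abs_one] at this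
      exact this.eventually_le_const one_lt_two
    have e2 : ∀ᶠ i in l, |ε i| ≤ 1 := by
      have := hε.abs
      rw [abs_zero] at this
      exact this.eventually_le_const one_pos
    filter_upwards [e1, e2, hε0] with i h1 h2 h3
    refine Eventually.of_forall fun x => ?_
    rw [norm_mul, Real.norm_eq_abs]
    rw [hBd]
    exact mul_le_mul_of_nonneg_left (abs_diffQuot_le_exp hβ hF hC hα hb hb' h1 h2 h3)
      (abs_nonneg _)
  · have hBd0 : ∀ x, |Bd x| ≤ 2 * C * C' * Real.exp ((α * 4 ^ β + 1) *
        (|fn v x| + |fn w x|) ^ β) := fun x => by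
      rw [hBd, abs_of_nonneg (by positivity)]
    exact exists_integrable_mul_of_le hΩ hβ hβn hγ hh.norm (2 * C * C') (α * 4 ^ β + 1)
      (by positivity) v w hBdm (Eventually.of_forall hBd0)
  · refine Eventually.of_forall fun x => Tendsto.const_mul _ ?_
    have hs : HasStrictDerivAt F (F' (fn v x)) (fn v x) :=
      hasStrictDerivAt_of_hasDerivAt_of_continuousAt (Eventually.of_forall fun s => hF s)
        hF'.continuousAt
    have h1 : Tendsto (fun i => t i * (fn v x + ε i * fn w x)) l (𝓝 (fn v x)) := by
      have := ht.mul ((hε.mul_const (fn w x)).const_add (fn v x))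
      simpa using this
    have h2 : Tendsto (fun i => t i * fn v x) l (𝓝 (fn v x)) := by
      simpa using ht.mul_const (fn v x)
    have h3 : Tendsto (fun i => t i * fn w x) l (𝓝 (fn w x)) := by
      simpa using ht.mul_const (fn w x)
    have := hs.hasStrictFDerivAt.tendsto_diffQuot h1 h2
      (Eventually.of_forall fun i => by simp only [smul_eq_mul]; ring) h3 hε0
    simpa [mul_comm] using this

end Functionals

/-! ### The nonlinearity -/

section Scalar

variable {p q β : ℝ}

/-- The function `g(s) s = |s|^(p+2) exp(|s|^β)`. -/
def gs (p β s : ℝ) : ℝ := |s| ^ (p + 2) * Real.exp (|s| ^ β)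

/-- The derivative of `s ↦ g(s) s`. -/
def gsDeriv (p β s : ℝ) : ℝ := ((p + 2) * |s| ^ p + β * |s| ^ (p + β)) * s * Real.exp (|s| ^ β)

/-- The function `g'(s) s² - q g(s) s = (p + 1 - q + β |s|^β) g(s) s`. -/
def gss (p q β s : ℝ) : ℝ := (p + 1 - q + β * |s| ^ β) * gs p β s

lemma gs_nonneg (p β s : ℝ) : 0 ≤ gs p β s := by unfold gs; positivity

lemma abs_rpow_mul_self_sq (hp : 0 < p) (s : ℝ) : |s| ^ p * (s * s) = |s| ^ (p + 2) := by
  rw [← abs_mul_abs_self s, Real.rpow_add_of_nonneg (abs_nonneg s) hp.le two_pos.le,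
    Real.rpow_two, sq]

lemma g_mul_self (hp : 0 < p) (s : ℝ) : g p β s * s = gs p β s := by
  rw [g, gs, ← abs_rpow_mul_self_sq hp]; ring

lemma gsDeriv_mul_self (hp : 0 < p) (hβ : 0 < β) (s : ℝ) :
    gsDeriv p β s * s = gss p q β s + (q + 1) * gs p β s := by
  rw [gsDeriv, gss, gs, ← abs_rpow_mul_self_sq hp,
    Real.rpow_add_of_nonneg (abs_nonneg s) hp.le hβ.le]
  ring

lemma continuous_abs_rpow {r : ℝ} (hr : 0 ≤ r) : Continuous fun s : ℝ => |s| ^ r :=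
  continuous_abs.rpow_const fun _ => Or.inr hr

lemma continuous_g (hp : 0 < p) (hβ : 0 < β) : Continuous (g p β) :=
  (continuous_id.mul (continuous_abs_rpow hp.le)).mul
    (Real.continuous_exp.comp (continuous_abs_rpow hβ.le))

lemma continuous_gs (hp : 0 < p) (hβ : 0 < β) : Continuous (gs p β) :=
  (continuous_abs_rpow (by linarith)).mul (Real.continuous_exp.comp (continuous_abs_rpow hβ.le))

lemma continuous_gss (hp : 0 < p) (hβ : 0 < β) : Continuous (gss p q β) :=
  (continuous_const.add (continuous_const.mul (continuous_abs_rpow hβ.le))).mul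
    (continuous_gs hp hβ)

lemma continuous_gsDeriv (hp : 0 < p) (hβ : 0 < β) : Continuous (gsDeriv p β) :=
  (((continuous_const.mul (continuous_abs_rpow hp.le)).add
    (continuous_const.mul (continuous_abs_rpow (by linarith)))).mul continuous_id).mul
    (Real.continuous_exp.comp (continuous_abs_rpow hβ.le))

lemma hasDerivAt_gs (hp : 0 < p) (hβ : 1 < β) (s : ℝ) :
    HasDerivAt (gs p β) (gsDeriv p β s) s := by
  have h1 := hasDerivAt_abs_rpow s (by linarith : 1 < p + 2)
  have h2 := (hasDerivAt_abs_rpow s hβ).exp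
  refine (h1.mul h2).congr_deriv ?_
  rw [gsDeriv, add_sub_cancel_right]
  rcases eq_or_ne s 0 with rfl | hs
  · simp
  · have hs' : 0 < |s| := abs_pos.2 hs
    have e : |s| ^ (p + β) = |s| ^ (p + 2) * |s| ^ (β - 2) := by
      rw [← Real.rpow_add hs']; congr 1; ring
    rw [e]; ring

lemma hasDerivAt_G (hp : 0 < p) (hβ : 0 < β) (s : ℝ) : HasDerivAt (G p β) (g p β s) s :=
  intervalIntegral.integral_hasDerivAt_right ((continuous_g hp hβ).intervalIntegrable _ _)
    ((continuous_g hp hβ).stronglyMeasurableAtFilter _ _) (continuous_g hp hβ).continuousAt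

lemma continuous_G (hp : 0 < p) (hβ : 0 < β) : Continuous (G p β) :=
  continuous_iff_continuousAt.2 fun s => (hasDerivAt_G hp hβ s).continuousAt

lemma G_neg (s : ℝ) : G p β (-s) = G p β s := by
  have hodd : ∀ t, g p β (-t) = -g p β t := fun t => by simp [g]
  have := intervalIntegral.integral_comp_neg (f := g p β) (a := 0) (b := s)
  simp only [hodd, intervalIntegral.integral_neg, neg_zero] at this
  rw [G, intervalIntegral.integral_symm, ← this, neg_neg, G]

lemma G_abs (s : ℝ) : G p β |s| = G p β s := by
  rcases abs_choice s with h | h <;> rw [h]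
  exact G_neg s

lemma gs_abs (s : ℝ) : gs p β |s| = gs p β s := by simp [gs]

lemma gss_abs (s : ℝ) : gss p q β |s| = gss p q β s := by simp [gss, gs]

lemma G_nonneg (s : ℝ) : 0 ≤ G p β s := by
  rw [← G_abs]
  refine intervalIntegral.integral_nonneg (abs_nonneg s) fun t ht => ?_
  have := ht.1
  unfold g; positivity

/-- The Ambrosetti–Rabinowitz condition `(p + 2) G(s) ≤ g(s) s`. -/
lemma mul_G_le_gs (hp : 0 < p) (hβ : 1 < β) (s : ℝ) : (p + 2) * G p β s ≤ gs p β s := by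
  have hβ0 : 0 < β := by linarith
  rw [← G_abs, ← gs_abs]
  have hd : ∀ t, HasDerivAt (fun t => gs p β t - (p + 2) * G p β t)
      (gsDeriv p β t - (p + 2) * g p β t) t := fun t =>
    (hasDerivAt_gs hp hβ t).sub ((hasDerivAt_G hp hβ0 t).const_mul _)
  have hmono : MonotoneOn (fun t => gs p β t - (p + 2) * G p β t) (Set.Ici 0) := by
    refine monotoneOn_of_deriv_nonneg (convex_Ici 0)
      (fun t _ => (hd t).continuousAt.continuousWithinAt)
      (fun t _ => (hd t).differentiableAt.differentiableWithinAt) fun t ht => ?_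
    rw [interior_Ici] at ht
    have ht0 : 0 < t := ht
    rw [(hd t).deriv]
    have e : gsDeriv p β t - (p + 2) * g p β t =
        β * |t| ^ (p + β) * t * Real.exp (|t| ^ β) := by rw [gsDeriv, g]; ring
    rw [e]; positivity
  have := hmono (Set.mem_Ici.2 le_rfl) (Set.mem_Ici.2 (abs_nonneg s)) (abs_nonneg s)
  have h0 : gs p β 0 = 0 := by simp [gs, Real.zero_rpow (by linarith : p + 2 ≠ 0)]
  have h1 : G p β 0 = 0 := by simp [G]
  simp only [h0, h1] at this
  linarith

lemma gs_mul_le (hβ : 0 < β) {t : ℝ} (ht : 0 ≤ t) (ht1 : t ≤ 1) (s : ℝ) :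
    gs p β (t * s) ≤ t ^ (p + 2) * gs p β s := by
  rw [gs, gs, abs_mul, abs_of_nonneg ht, Real.mul_rpow ht (abs_nonneg s), mul_assoc]
  gcongr
  exact mul_le_of_le_one_left (abs_nonneg s) ht1

lemma le_gs_mul (hβ : 0 < β) {t : ℝ} (ht : 1 ≤ t) (s : ℝ) :
    t ^ (p + 2) * gs p β s ≤ gs p β (t * s) := by
  have ht0 : 0 ≤ t := by linarith
  rw [gs, gs, abs_mul, abs_of_nonneg ht0, Real.mul_rpow ht0 (abs_nonneg s), mul_assoc]
  gcongr
  exact le_mul_of_one_le_left (abs_nonneg s) ht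

lemma le_gss_mul (hβ : 0 < β) (hpq : 0 < p + 1 - q) {t : ℝ} (ht : 1 ≤ t) (s : ℝ) :
    t ^ (p + 2) * gss p q β s ≤ gss p q β (t * s) := by
  have ht0 : 0 ≤ t := by linarith
  have h1 := le_gs_mul (p := p) hβ ht s
  have h2 : p + 1 - q + β * |s| ^ β ≤ p + 1 - q + β * |t * s| ^ β := by
    rw [abs_mul, abs_of_nonneg ht0]
    gcongr
    exact le_mul_of_one_le_left (abs_nonneg s) ht
  rw [gss, gss, mul_left_comm]
  exact mul_le_mul h2 h1 (mul_nonneg (by positivity) (gs_nonneg _ _ _)) (by positivity)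

/-- At `0` this is a statement about the junk value of `|0|^(q-1)` for `q ≤ 1`, which the factor `s`
annihilates: the function is a multiple of the derivative of `|s|^(q+1)`. -/
lemma continuous_signedRpow (hq : 0 < q) : Continuous fun s : ℝ => |s| ^ (q - 1) * s := by
  have h1 := (contDiff_norm_rpow (E := ℝ) (by linarith : 1 < q + 1)).continuous_deriv le_rfl
  have h2 : deriv (fun s : ℝ => ‖s‖ ^ (q + 1)) = fun s => (q + 1) * (|s| ^ (q - 1) * s) := by
    ext s
    rw [(hasDerivAt_norm_rpow s (by linarith : 1 < q + 1)).deriv, Real.norm_eq_abs, mul_assoc]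
    congr 3; ring
  rw [h2] at h1
  have h3 : Continuous fun s : ℝ => (q + 1)⁻¹ * ((q + 1) * (|s| ^ (q - 1) * s)) :=
    continuous_const.mul h1
  refine h3.congr fun s => ?_
  rw [inv_mul_cancel_left₀ (by linarith)]

lemma signedRpow_mul_self (hq : 0 < q) (s : ℝ) : |s| ^ (q - 1) * s * s = |s| ^ (q + 1) := by
  rcases eq_or_ne s 0 with rfl | hs
  · simp [Real.zero_rpow (by linarith : q + 1 ≠ 0)]
  · have hs' : 0 < |s| := abs_pos.2 hs
    rw [mul_assoc, ← abs_mul_abs_self s, ← sq, ← Real.rpow_two, ← Real.rpow_add hs']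
    congr 1; ring

lemma abs_signedRpow (hq : 0 < q) (s : ℝ) : |(|s| ^ (q - 1) * s)| = |s| ^ q := by
  rcases eq_or_ne s 0 with rfl | hs
  · simp [Real.zero_rpow hq.ne']
  · have hs' : 0 < |s| := abs_pos.2 hs
    rw [abs_mul, abs_of_nonneg (by positivity : 0 ≤ |s| ^ (q - 1)), Real.rpow_sub_one hs'.ne',
      div_mul_cancel₀ _ hs'.ne']

lemma hasDerivAt_abs_rpow_add_one (hq : 0 < q) (s : ℝ) :
    HasDerivAt (fun s : ℝ => |s| ^ (q + 1)) ((q + 1) * (|s| ^ (q - 1) * s)) s := by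
  refine (hasDerivAt_abs_rpow s (by linarith : 1 < q + 1)).congr_deriv ?_
  rw [mul_assoc]; congr 3; ring

lemma expGrowth_gs (hp : 0 < p) (hβ : 0 < β) : ExpGrowth β (gs p β) :=
  (expGrowth_rpow hβ (by linarith)).mul expGrowth_exp

lemma expGrowth_gss (hp : 0 < p) (hβ : 0 < β) : ExpGrowth β (gss p q β) :=
  ((expGrowth_const (p + 1 - q)).add ((expGrowth_const β).mul (expGrowth_rpow hβ hβ.le))).mul
    (expGrowth_gs hp hβ)

lemma expGrowth_id (hβ : 0 < β) : ExpGrowth β fun s => s :=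
  (expGrowth_rpow hβ zero_le_one).mono fun s => by simp

lemma expGrowth_g (hp : 0 < p) (hβ : 0 < β) : ExpGrowth β (g p β) :=
  ((expGrowth_id hβ).mul (expGrowth_rpow hβ hp.le)).mul expGrowth_exp

lemma expGrowth_gsDeriv (hp : 0 < p) (hβ : 0 < β) : ExpGrowth β (gsDeriv p β) :=
  ((((expGrowth_const (p + 2)).mul (expGrowth_rpow hβ hp.le)).add
    ((expGrowth_const β).mul (expGrowth_rpow hβ (by linarith)))).mul (expGrowth_id hβ)).mul
    expGrowth_exp

lemma expGrowth_G (hp : 0 < p) (hβ : 1 < β) : ExpGrowth β (G p β) := by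
  refine (expGrowth_gs hp (by linarith)).mono fun s => ?_
  have h1 := mul_G_le_gs hp hβ s
  have h2 := G_nonneg (p := p) (β := β) s
  rw [abs_of_nonneg h2, abs_of_nonneg (gs_nonneg _ _ _)]
  nlinarith

lemma expGrowth_signedRpow (hq : 0 < q) (hβ : 0 < β) :
    ExpGrowth β fun s => |s| ^ (q - 1) * s :=
  (expGrowth_rpow hβ hq.le).mono fun s => by
    rw [abs_signedRpow hq]; exact le_abs_self _

end Scalar

/-! ### The energy, its derivative and the fibering maps -/

section Energy

open Filter Topology

/-- The standing assumptions on the data of the problem, except for the sign condition on `h`; of `Ω`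
only its finite measure matters. -/
structure Admissible {n : ℕ} (Ω : Set (E n)) (a b p q β : ℝ) (h : E n → ℝ) : Prop where
  vol : volume Ω ≠ ⊤
  a_pos : 0 < a
  b_pos : 0 < b
  q_pos : 0 < q
  q_lt : q < (n : ℝ) - 1
  lt_p : 2 * (n : ℝ) - 1 < p + 1
  one_lt_β : 1 < β
  β_lt : β < (n : ℝ) / ((n : ℝ) - 1)
  memLp : MemLp h (ENNReal.ofReal ((n : ℝ) / ((n : ℝ) - q - 1))) (volume.restrict Ω)

namespace Admissible

variable {n : ℕ} {Ω : Set (E n)} {a b p q β : ℝ} {h : E n → ℝ}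

lemma β_pos (A : Admissible Ω a b p q β h) : 0 < β := one_pos.trans A.one_lt_β

lemma one_lt_γ (A : Admissible Ω a b p q β h) : 1 < (n : ℝ) / ((n : ℝ) - q - 1) := by
  rw [one_lt_div (by linarith [A.q_lt])]; linarith [A.q_pos]

lemma p_pos (A : Admissible Ω a b p q β h) : 0 < p := by
  linarith [A.q_lt, A.q_pos, A.lt_p]

lemma n_pos (A : Admissible Ω a b p q β h) : (0 : ℝ) < n := by linarith [A.q_lt, A.q_pos]

end Admissible

variable {n : ℕ} [hn : Fact (2 ≤ n)] {Ω : Set (E n)} {a b p q β lam : ℝ} {h : E n → ℝ}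

/-- The integral `∫_Ω h |u|^(q+1)`. -/
def hInt (q : ℝ) (h : E n → ℝ) (u : W0 Ω) : ℝ := ∫ x in Ω, h x * |fn u x| ^ (q + 1)

/-- The integral `∫_Ω G(u)`. -/
def primInt (p β : ℝ) (u : W0 Ω) : ℝ := ∫ x in Ω, G p β (fn u x)

/-- The integral `∫_Ω g(u) u`. -/
def gInt (p β : ℝ) (u : W0 Ω) : ℝ := ∫ x in Ω, gs p β (fn u x)

/-- The integral `∫_Ω (g'(u) u² - q g(u) u)`. -/
def gssInt (p q β : ℝ) (u : W0 Ω) : ℝ := ∫ x in Ω, gss p q β (fn u x)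

/-- The derivative of the energy at `u` in the direction `u`, so that `φ_u'(t) = P(t u) / t`. -/
def nehariP (a b p q β lam : ℝ) (h : E n → ℝ) (u : W0 Ω) : ℝ :=
  a * normPow u ^ 2 + b * normPow u - lam * hInt q h u - gInt p β u

/-- On the Nehari set this is `φ_u''(1)`; the term in `h` has been eliminated by means of
`P(u) = 0`, so that `D` does not depend on `h` and `λ`. -/
def nehariD (a b p q β : ℝ) (u : W0 Ω) : ℝ :=
  (2 * n - q - 1) * a * normPow u ^ 2 + (n - q - 1) * b * normPow u - gssInt p q β u

/-- The derivative of the energy at `u` in the direction `φ`. -/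
def dJ (a b p q β lam : ℝ) (h : E n → ℝ) (u φ : W0 Ω) : ℝ :=
  m a b (normPow u) * (∫ x in Ω, ‖grad u x‖ ^ (n - 2) * inner ℝ (grad u x) (grad φ x))
    - lam * (∫ x in Ω, h x * (|fn u x| ^ (q - 1) * fn u x) * fn φ x)
    - (∫ x in Ω, g p β (fn u x) * fn φ x)

lemma M_eq (a b s : ℝ) : M a b s = a / 2 * s ^ 2 + b * s := by
  have hd : ∀ x ∈ Set.uIcc 0 s, HasDerivAt (fun x : ℝ => a / 2 * x ^ 2 + b * x) (m a b x) x := by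
    intro x _
    have := ((hasDerivAt_pow 2 x).const_mul (a / 2)).add ((hasDerivAt_id x).const_mul b)
    refine this.congr_deriv ?_
    rw [m]; norm_num; ring
  rw [M, intervalIntegral.integral_eq_sub_of_hasDerivAt hd
    (Continuous.intervalIntegrable (by unfold m; fun_prop) _ _)]
  ring

lemma J_eq (u : W0 Ω) : J a b p q β lam h u =
    1 / (n : ℝ) * (a / 2 * normPow u ^ 2 + b * normPow u) - lam / (q + 1) * hInt q h u -
      primInt p β u := by
  rw [J, M_eq]; rfl

lemma hInt_smul {t : ℝ} (ht : 0 ≤ t) (u : W0 Ω) :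
    hInt q h (t • u) = t ^ (q + 1) * hInt q h u := by
  rw [hInt, hInt, ← integral_const_mul]
  refine integral_congr_ae ?_
  filter_upwards [fn_smul t u] with x hx
  rw [hx, abs_mul, abs_of_nonneg ht, Real.mul_rpow ht (abs_nonneg _)]
  ring

lemma normPow_smul_of_nonneg {t : ℝ} (ht : 0 ≤ t) (u : W0 Ω) :
    normPow (t • u) = t ^ n * normPow u := by rw [normPow_smul, abs_of_nonneg ht]

lemma integrable_gs (A : Admissible Ω a b p q β h) (u : W0 Ω) :
    IntegrableOn (fun x => gs p β (fn u x)) Ω :=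
  integrable_comp A.vol A.β_pos A.β_lt (continuous_gs A.p_pos A.β_pos)
    (expGrowth_gs A.p_pos A.β_pos) u

lemma integrable_gss (A : Admissible Ω a b p q β h) (u : W0 Ω) :
    IntegrableOn (fun x => gss p q β (fn u x)) Ω :=
  integrable_comp A.vol A.β_pos A.β_lt (continuous_gss A.p_pos A.β_pos)
    (expGrowth_gss A.p_pos A.β_pos) u

lemma integrable_G (A : Admissible Ω a b p q β h) (u : W0 Ω) :
    IntegrableOn (fun x => G p β (fn u x)) Ω :=
  integrable_comp A.vol A.β_pos A.β_lt (continuous_G A.p_pos A.β_pos)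
    (expGrowth_G A.p_pos A.one_lt_β) u

lemma gInt_nonneg (u : W0 Ω) : 0 ≤ gInt p β u := integral_nonneg fun _ => gs_nonneg _ _ _

lemma primInt_nonneg (u : W0 Ω) : 0 ≤ primInt p β u :=
  integral_nonneg fun _ => G_nonneg _

lemma mul_primInt_le (A : Admissible Ω a b p q β h) (u : W0 Ω) :
    (p + 2) * primInt p β u ≤ gInt p β u := by
  rw [primInt, ← integral_const_mul]
  exact integral_mono ((integrable_G A u).const_mul _) (integrable_gs A u)
    fun x => mul_G_le_gs A.p_pos A.one_lt_β _

lemma gInt_smul_le (A : Admissible Ω a b p q β h) {t : ℝ} (ht : 0 ≤ t) (ht1 : t ≤ 1) (u : W0 Ω) :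
    gInt p β (t • u) ≤ t ^ (p + 2) * gInt p β u := by
  rw [gInt, gInt, ← integral_const_mul]
  refine integral_mono_ae (integrable_gs A _) ((integrable_gs A u).const_mul _) ?_
  filter_upwards [fn_smul t u] with x hx
  rw [hx]
  exact gs_mul_le A.β_pos ht ht1 _

lemma le_gInt_smul (A : Admissible Ω a b p q β h) {t : ℝ} (ht : 1 ≤ t) (u : W0 Ω) :
    t ^ (p + 2) * gInt p β u ≤ gInt p β (t • u) := by
  rw [gInt, gInt, ← integral_const_mul]
  refine integral_mono_ae ((integrable_gs A u).const_mul _) (integrable_gs A _) ?_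
  filter_upwards [fn_smul t u] with x hx
  rw [hx]
  exact le_gs_mul A.β_pos ht _

lemma le_gssInt_smul (A : Admissible Ω a b p q β h) {t : ℝ} (ht : 1 ≤ t) (u : W0 Ω) :
    t ^ (p + 2) * gssInt p q β u ≤ gssInt p q β (t • u) := by
  rw [gssInt, gssInt, ← integral_const_mul]
  refine integral_mono_ae ((integrable_gss A u).const_mul _) (integrable_gss A _) ?_
  filter_upwards [fn_smul t u] with x hx
  rw [hx]
  exact le_gss_mul A.β_pos (by linarith [A.lt_p, A.q_lt, A.q_pos]) ht _

/-- The derivative of `‖·‖ⁿ` in the direction `w`, where the base point is allowed to move along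
the ray through `v`. -/
lemma tendsto_diffQuot_normPow (v w : W0 Ω) {ι : Type*} {l : Filter ι}
    [l.IsCountablyGenerated] {t ε : ι → ℝ} (ht : Tendsto t l (𝓝 1)) (hε : Tendsto ε l (𝓝 0))
    (hε0 : ∀ᶠ i in l, ε i ≠ 0) :
    Tendsto (fun i => (normPow (t i • (v + ε i • w)) - normPow (t i • v)) / ε i) l
      (𝓝 (n * ∫ x in Ω, ‖grad v x‖ ^ (n - 2) * inner ℝ (grad v x) (grad w x))) := by
  have h2 := hn.out
  have h1n : (1 : ℝ) < n := by exact_mod_cast (by omega : 1 < n)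
  have heq : ∀ i, (normPow (t i • (v + ε i • w)) - normPow (t i • v)) / ε i =
      ∫ x in Ω, (‖t i • (grad v x + ε i • grad w x)‖ ^ n - ‖t i • grad v x‖ ^ n) / ε i := by
    intro i
    rw [normPow, normPow, ← integral_sub (integrable_grad_pow _) (integrable_grad_pow _),
      ← integral_div]
    refine integral_congr_ae ?_
    filter_upwards [grad_smul (t i) (v + ε i • w), grad_add v (ε i • w), grad_smul (ε i) w,
      grad_smul (t i) v] with x h1 h2 h3 h4
    rw [h1, h2, h3, h4]
  simp only [heq]
  rw [← integral_const_mul]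
  have hi : Integrable (fun x => 2 * n * 4 ^ (n - 1) * (‖grad v x‖ + ‖grad w x‖) ^ n)
      (volume.restrict Ω) := by
    have h1 := ((memLp_grad v).norm.add (memLp_grad w).norm).integrable_norm_pow (by omega : n ≠ 0)
    refine (h1.congr (Eventually.of_forall fun x => ?_)).const_mul _
    simp only [Pi.add_apply]
    rw [Real.norm_of_nonneg (by positivity)]
  refine tendsto_integral_filter_of_dominated_convergence _ ?_ ?_ hi ?_
  · refine Eventually.of_forall fun i => ?_
    have m1 := aestronglyMeasurable_grad v
    have m2 := aestronglyMeasurable_grad w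
    have m3 := ((m1.add (m2.const_smul (ε i))).const_smul (t i)).norm.pow n
    have m4 := (m1.const_smul (t i)).norm.pow n
    exact ((m3.sub m4).mul aestronglyMeasurable_const (g := fun _ => (ε i)⁻¹)).congr
      (Eventually.of_forall fun x => by simp [div_eq_mul_inv])
  · have e1 : ∀ᶠ i in l, |t i| ≤ 2 := by
      have := ht.abs
      rw [abs_one] at this
      exact this.eventually_le_const one_lt_two
    have e2 : ∀ᶠ i in l, |ε i| ≤ 1 := by
      have := hε.abs
      rw [abs_zero] at this
      exact this.eventually_le_const one_pos
    filter_upwards [e1, e2, hε0] with i h1 h2 h3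
    refine Eventually.of_forall fun x => ?_
    set y := grad v x
    set z := grad w x
    have hy := norm_nonneg y
    have hz := norm_nonneg z
    have hεz : ‖ε i • z‖ ≤ ‖z‖ := by
      rw [norm_smul]; exact mul_le_of_le_one_left hz h2
    have ha : ‖t i • (y + ε i • z)‖ ≤ 4 * (‖y‖ + ‖z‖) := by
      rw [norm_smul]
      calc _ ≤ 2 * (‖y‖ + ‖z‖) :=
            mul_le_mul h1 ((norm_add_le _ _).trans (by linarith)) (norm_nonneg _) two_pos.le
        _ ≤ _ := by linarith
    have hb : ‖t i • y‖ ≤ 4 * (‖y‖ + ‖z‖) := by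
      rw [norm_smul]
      calc _ ≤ 2 * ‖y‖ := mul_le_mul_of_nonneg_right h1 hy
        _ ≤ _ := by linarith
    have hdiff : |‖t i • (y + ε i • z)‖ - ‖t i • y‖| ≤ 2 * |ε i| * ‖z‖ := by
      refine (abs_norm_sub_norm_le _ _).trans ?_
      rw [← smul_sub, add_sub_cancel_left, norm_smul, norm_smul, Real.norm_eq_abs, Real.norm_eq_abs,
        ← mul_assoc]
      gcongr
    have hpow := abs_pow_sub_pow_le ‖t i • (y + ε i • z)‖ ‖t i • y‖ n
    rw [abs_norm, abs_norm] at hpow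
    rw [Real.norm_eq_abs, abs_div, div_le_iff₀ (abs_pos.2 h3)]
    calc _ ≤ _ := hpow
      _ ≤ (2 * |ε i| * ‖z‖) * n * (4 * (‖y‖ + ‖z‖)) ^ (n - 1) := by
          gcongr
          exact max_le ha hb
      _ ≤ (2 * |ε i| * (‖y‖ + ‖z‖)) * n * (4 * (‖y‖ + ‖z‖)) ^ (n - 1) := by
          gcongr
          linarith
      _ = _ := by
          have : (‖y‖ + ‖z‖) ^ n = (‖y‖ + ‖z‖) ^ (n - 1) * (‖y‖ + ‖z‖) := by
            rw [← pow_succ]; congr 1; omega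
          rw [mul_pow, this]; ring
  · refine Eventually.of_forall fun x => ?_
    have hF : HasStrictFDerivAt (fun y : E n => ‖y‖ ^ n)
        (((n : ℝ) * ‖grad v x‖ ^ (n - 2)) • innerSL ℝ (grad v x)) (grad v x) := by
      have h1 : ContDiffAt ℝ 1 (fun y : E n => ‖y‖ ^ (n : ℝ)) (grad v x) :=
        (contDiff_norm_rpow h1n).contDiffAt
      have h3 := h1.hasStrictFDerivAt' (hasFDerivAt_norm_rpow (grad v x) h1n) one_ne_zero
      have e : (n : ℝ) - 2 = ((n - 2 : ℕ) : ℝ) := by rw [Nat.cast_sub h2]; simp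
      rw [e] at h3
      simpa only [Real.rpow_natCast] using h3
    have l1 : Tendsto (fun i => t i • (grad v x + ε i • grad w x)) l (𝓝 (grad v x)) := by
      have := ht.smul ((hε.smul_const (grad w x)).const_add (grad v x))
      simpa using this
    have l2 : Tendsto (fun i => t i • grad v x) l (𝓝 (grad v x)) := by
      simpa using ht.smul_const (grad v x)
    have l3 : Tendsto (fun i => t i • grad w x) l (𝓝 (grad w x)) := by
      simpa using ht.smul_const (grad w x)
    have := hF.tendsto_diffQuot l1 l2 (Eventually.of_forall fun i => by
      rw [← smul_sub, add_sub_cancel_left, smul_comm]) l3 hε0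
    simpa [mul_assoc] using this

lemma tendsto_diffQuot_hInt (A : Admissible Ω a b p q β h) (v w : W0 Ω) {ι : Type*}
    {l : Filter ι} [l.IsCountablyGenerated] {t ε : ι → ℝ} (ht : Tendsto t l (𝓝 1))
    (hε : Tendsto ε l (𝓝 0)) (hε0 : ∀ᶠ i in l, ε i ≠ 0) :
    Tendsto (fun i => (hInt q h (t i • (v + ε i • w)) - hInt q h (t i • v)) / ε i) l
      (𝓝 ((q + 1) * ∫ x in Ω, h x * (|fn v x| ^ (q - 1) * fn v x) * fn w x)) := by
  have := tendsto_diffQuot_integral_mul_comp A.vol A.β_pos A.β_lt A.one_lt_γ A.memLp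
    (hasDerivAt_abs_rpow_add_one A.q_pos)
    (continuous_const.mul (continuous_signedRpow A.q_pos))
    (expGrowth_rpow A.β_pos (by linarith [A.q_pos]))
    ((expGrowth_const (q + 1)).mul (expGrowth_signedRpow A.q_pos A.β_pos)) v w ht hε hε0
  have e : (q + 1) * ∫ x in Ω, h x * (|fn v x| ^ (q - 1) * fn v x) * fn w x =
      ∫ x in Ω, h x * ((q + 1) * (|fn v x| ^ (q - 1) * fn v x) * fn w x) := by
    rw [← integral_const_mul]
    congr 1 with x
    ring
  rw [e]
  exact this

lemma tendsto_diffQuot_gInt (A : Admissible Ω a b p q β h) (v w : W0 Ω) {ι : Type*}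
    {l : Filter ι} [l.IsCountablyGenerated] {t ε : ι → ℝ} (ht : Tendsto t l (𝓝 1))
    (hε : Tendsto ε l (𝓝 0)) (hε0 : ∀ᶠ i in l, ε i ≠ 0) :
    Tendsto (fun i => (gInt p β (t i • (v + ε i • w)) - gInt p β (t i • v)) / ε i) l
      (𝓝 (∫ x in Ω, gsDeriv p β (fn v x) * fn w x)) := by
  have := tendsto_diffQuot_integral_mul_comp A.vol A.β_pos A.β_lt one_lt_two (memLp_one A.vol)
    (hasDerivAt_gs A.p_pos A.one_lt_β) (continuous_gsDeriv A.p_pos A.β_pos)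
    (expGrowth_gs A.p_pos A.β_pos) (expGrowth_gsDeriv A.p_pos A.β_pos) v w ht hε hε0
  simp only [one_mul] at this
  exact this

lemma tendsto_diffQuot_primInt (A : Admissible Ω a b p q β h) (v w : W0 Ω) {ι : Type*}
    {l : Filter ι} [l.IsCountablyGenerated] {t ε : ι → ℝ} (ht : Tendsto t l (𝓝 1))
    (hε : Tendsto ε l (𝓝 0)) (hε0 : ∀ᶠ i in l, ε i ≠ 0) :
    Tendsto (fun i => (primInt p β (t i • (v + ε i • w)) - primInt p β (t i • v)) / ε i) l
      (𝓝 (∫ x in Ω, g p β (fn v x) * fn w x)) := by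
  have := tendsto_diffQuot_integral_mul_comp A.vol A.β_pos A.β_lt one_lt_two (memLp_one A.vol)
    (hasDerivAt_G A.p_pos A.β_pos) (continuous_g A.p_pos A.β_pos)
    (expGrowth_G A.p_pos A.one_lt_β) (expGrowth_g A.p_pos A.β_pos) v w ht hε hε0
  simp only [one_mul] at this
  exact this

lemma tendsto_normPow_ray (v w : W0 Ω) {ι : Type*} {l : Filter ι} {t ε : ι → ℝ}
    (ht : Tendsto t l (𝓝 1)) (hε : Tendsto ε l (𝓝 0)) :
    Tendsto (fun i => normPow (t i • (v + ε i • w))) l (𝓝 (normPow v)) := by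
  refine (continuous_normPow.tendsto v).comp ?_
  have := ht.smul ((hε.smul_const w).const_add v)
  simpa using this

/-- The energy is differentiable, with the base point allowed to move along the ray through `v`. -/
lemma tendsto_diffQuot_J (A : Admissible Ω a b p q β h) (v w : W0 Ω) {ι : Type*}
    {l : Filter ι} [l.IsCountablyGenerated] {t ε : ι → ℝ} (ht : Tendsto t l (𝓝 1))
    (hε : Tendsto ε l (𝓝 0)) (hε0 : ∀ᶠ i in l, ε i ≠ 0) :
    Tendsto (fun i => (J a b p q β lam h (t i • (v + ε i • w)) -
      J a b p q β lam h (t i • v)) / ε i) l (𝓝 (dJ a b p q β lam h v w)) := by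
  have h1 := tendsto_diffQuot_normPow v w ht hε hε0
  have h2 := tendsto_diffQuot_hInt A v w ht hε hε0
  have h3 := tendsto_diffQuot_primInt A v w ht hε hε0
  have h4 := tendsto_normPow_ray v w ht hε
  have h5 : Tendsto (fun i => normPow (t i • v)) l (𝓝 (normPow v)) := by
    refine (continuous_normPow.tendsto v).comp ?_
    simpa using ht.smul_const v
  have h6 := ((((h4.add h5).const_mul (a / 2)).add_const b).mul h1).const_mul (1 / (n : ℝ))
  have h7 := (h6.sub (h2.const_mul (lam / (q + 1)))).sub h3
  have hq : q + 1 ≠ 0 := by linarith [A.q_pos]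
  have hn0 := A.n_pos.ne'
  have e : dJ a b p q β lam h v w = 1 / (n : ℝ) * ((a / 2 * (normPow v + normPow v) + b) *
      (n * ∫ x in Ω, ‖grad v x‖ ^ (n - 2) * inner ℝ (grad v x) (grad w x))) -
      lam / (q + 1) * ((q + 1) * ∫ x in Ω, h x * (|fn v x| ^ (q - 1) * fn v x) * fn w x) -
      ∫ x in Ω, g p β (fn v x) * fn w x := by
    rw [dJ, m]; field_simp; ring
  rw [e]
  refine h7.congr' ?_
  filter_upwards [hε0] with i hi
  rw [J_eq, J_eq]
  field_simp
  ring

lemma dJ_self (A : Admissible Ω a b p q β h) (u : W0 Ω) :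
    dJ a b p q β lam h u u = nehariP a b p q β lam h u := by
  have h2 := hn.out
  have e1 : ∫ x in Ω, ‖grad u x‖ ^ (n - 2) * inner ℝ (grad u x) (grad u x) = normPow u := by
    rw [normPow]
    congr 1 with x
    rw [real_inner_self_eq_norm_sq, ← pow_add]; congr 1; omega
  have e2 : ∫ x in Ω, h x * (|fn u x| ^ (q - 1) * fn u x) * fn u x = hInt q h u := by
    rw [hInt]
    congr 1 with x
    rw [mul_assoc, signedRpow_mul_self A.q_pos]
  have e3 : ∫ x in Ω, g p β (fn u x) * fn u x = gInt p β u := by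
    rw [gInt]
    congr 1 with x
    exact g_mul_self A.p_pos _
  rw [dJ, e1, e2, e3, nehariP, m]; ring

lemma dJ_smul (c : ℝ) (u φ : W0 Ω) :
    dJ a b p q β lam h u (c • φ) = c * dJ a b p q β lam h u φ := by
  have e1 : ∫ x in Ω, ‖grad u x‖ ^ (n - 2) * inner ℝ (grad u x) (grad (c • φ) x) =
      c * ∫ x in Ω, ‖grad u x‖ ^ (n - 2) * inner ℝ (grad u x) (grad φ x) := by
    rw [← integral_const_mul]
    refine integral_congr_ae ?_
    filter_upwards [grad_smul c φ] with x hx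
    rw [hx, inner_smul_right]; ring
  have e2 : ∫ x in Ω, h x * (|fn u x| ^ (q - 1) * fn u x) * fn (c • φ) x =
      c * ∫ x in Ω, h x * (|fn u x| ^ (q - 1) * fn u x) * fn φ x := by
    rw [← integral_const_mul]
    refine integral_congr_ae ?_
    filter_upwards [fn_smul c φ] with x hx
    rw [hx]; ring
  have e3 : ∫ x in Ω, g p β (fn u x) * fn (c • φ) x = c * ∫ x in Ω, g p β (fn u x) * fn φ x := by
    rw [← integral_const_mul]
    refine integral_congr_ae ?_
    filter_upwards [fn_smul c φ] with x hx
    rw [hx]; ring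
  rw [dJ, dJ, e1, e2, e3]; ring

/-- One inequality suffices, since `φ` may be replaced by `-φ`. -/
lemma isWeakSolution_of_dJ (A : Admissible Ω a b p q β h) {u : W0 Ω}
    (hu : ∀ φ, 0 ≤ dJ a b p q β lam h u φ) : IsWeakSolution a b p q β lam h u := by
  intro φ
  refine ⟨?_, ?_, ?_⟩
  · have := integrable_mul_comp_mul A.vol A.β_pos A.β_lt A.one_lt_γ A.memLp
      (continuous_signedRpow A.q_pos) (expGrowth_signedRpow A.q_pos A.β_pos) u φ
    simpa only [mul_assoc] using this
  · have := integrable_mul_comp_mul A.vol A.β_pos A.β_lt one_lt_two (memLp_one A.vol)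
      (continuous_g A.p_pos A.β_pos) (expGrowth_g A.p_pos A.β_pos) u φ
    simpa only [one_mul] using this
  · have h1 := hu φ
    have h2 := hu ((-1 : ℝ) • φ)
    rw [dJ_smul] at h2
    have h3 : dJ a b p q β lam h u φ = 0 := by linarith
    rw [dJ] at h3
    linarith

lemma hasDerivAt_of_diffQuot {Φ : W0 Ω → ℝ} {d : ℝ} {u : W0 Ω} {t : ℝ}
    (hΦ : Tendsto (fun s => (Φ ((1 : ℝ) • (t • u + (s - t) • u)) - Φ ((1 : ℝ) • (t • u))) / (s - t))
      (𝓝[≠] t) (𝓝 d)) : HasDerivAt (fun s => Φ (s • u)) d t := by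
  rw [hasDerivAt_iff_tendsto_slope]
  refine hΦ.congr fun s => ?_
  rw [slope_def_field, one_smul, one_smul, ← add_smul, add_sub_cancel]

lemma tendsto_sub_punctured (t : ℝ) : Tendsto (fun s => s - t) (𝓝[≠] t) (𝓝 0) := by
  have : Tendsto (fun s => s - t) (𝓝 t) (𝓝 (t - t)) := (continuous_id.sub continuous_const).tendsto t
  rw [sub_self] at this
  exact this.mono_left nhdsWithin_le_nhds

lemma eventually_sub_punctured (t : ℝ) : ∀ᶠ s in 𝓝[≠] t, s - t ≠ 0 := by
  filter_upwards [self_mem_nhdsWithin] with s hs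
  exact sub_ne_zero.2 hs

lemma hasDerivAt_fiber (A : Admissible Ω a b p q β h) (u : W0 Ω) {t : ℝ} (ht : 0 < t) :
    HasDerivAt (fiber a b p q β lam h u) (nehariP a b p q β lam h (t • u) / t) t := by
  have h1 := tendsto_diffQuot_J (lam := lam) A (t • u) u (t := fun _ => 1) tendsto_const_nhds
    (tendsto_sub_punctured t) (eventually_sub_punctured t)
  have h2 : dJ a b p q β lam h (t • u) u = nehariP a b p q β lam h (t • u) / t := by
    rw [← dJ_self A, dJ_smul, mul_div_cancel_left₀ _ ht.ne']
  rw [h2] at h1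
  exact hasDerivAt_of_diffQuot h1

lemma hasDerivAt_gInt (A : Admissible Ω a b p q β h) (u : W0 Ω) {t : ℝ} (ht : 0 < t) :
    HasDerivAt (fun s => gInt p β (s • u))
      ((gssInt p q β (t • u) + (q + 1) * gInt p β (t • u)) / t) t := by
  have h1 := tendsto_diffQuot_gInt A (t • u) u (t := fun _ => 1) tendsto_const_nhds
    (tendsto_sub_punctured t) (eventually_sub_punctured t)
  have h2 : ∫ x in Ω, gsDeriv p β (fn (t • u) x) * fn u x =
      (gssInt p q β (t • u) + (q + 1) * gInt p β (t • u)) / t := by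
    rw [gssInt, gInt, ← integral_const_mul, ← integral_add (integrable_gss A _)
      ((integrable_gs A _).const_mul _), ← integral_div]
    refine integral_congr_ae ?_
    filter_upwards [fn_smul t u] with x hx
    rw [← gsDeriv_mul_self A.p_pos A.β_pos, hx]
    field_simp
  rw [h2] at h1
  exact hasDerivAt_of_diffQuot h1

lemma nehariP_smul {t : ℝ} (ht : 0 ≤ t) (u : W0 Ω) : nehariP a b p q β lam h (t • u) =
    a * (t ^ n * normPow u) ^ 2 + b * (t ^ n * normPow u) - lam * (t ^ (q + 1) * hInt q h u) -
      gInt p β (t • u) := by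
  rw [nehariP, normPow_smul_of_nonneg ht, hInt_smul ht]

lemma hasDerivAt_nehariP (A : Admissible Ω a b p q β h) (u : W0 Ω) {t : ℝ} (ht : 0 < t) :
    HasDerivAt (fun s => nehariP a b p q β lam h (s • u))
      ((nehariD a b p q β (t • u) + (q + 1) * nehariP a b p q β lam h (t • u)) / t) t := by
  have hn1 : n ≠ 0 := by have := hn.out; omega
  have d1 : HasDerivAt (fun s : ℝ => s ^ n * normPow u) (n * t ^ (n - 1) * normPow u) t :=
    (hasDerivAt_pow n t).mul_const _
  have d2 : HasDerivAt (fun s : ℝ => s ^ (q + 1) * hInt q h u)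
      ((q + 1) * t ^ q * hInt q h u) t := by
    have := (Real.hasDerivAt_rpow_const (x := t) (p := q + 1) (Or.inl ht.ne')).mul_const
      (hInt q h u)
    simpa using this
  have d3 := ((((d1.pow 2).const_mul a).add (d1.const_mul b)).sub (d2.const_mul lam)).sub
    (hasDerivAt_gInt A u ht)
  have hev : (fun s => nehariP a b p q β lam h (s • u)) =ᶠ[𝓝 t] fun s =>
      a * (s ^ n * normPow u) ^ 2 + b * (s ^ n * normPow u) - lam * (s ^ (q + 1) * hInt q h u) -
      gInt p β (s • u) := by
    filter_upwards [eventually_gt_nhds ht] with s hs using nehariP_smul hs.le u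
  refine (d3.congr_of_eventuallyEq hev).congr_deriv ?_
  rw [nehariP_smul ht.le, nehariD, normPow_smul_of_nonneg ht.le]
  have e1 : t ^ n = t ^ (n - 1) * t := by rw [← pow_succ]; congr 1; omega
  have e2 : t ^ (q + 1) = t ^ q * t := Real.rpow_add_one ht.ne' q
  rw [e1, e2]
  field_simp
  ring

/-- The fibering derivative divided by `t^q` has derivative `t^(-q-2) D(t u)`; since `λ` and `h`
only contribute a constant to it, it determines the shape of the fibering map. -/
lemma hasDerivAt_rpow_mul_nehariP (A : Admissible Ω a b p q β h) (u : W0 Ω) {t : ℝ} (ht : 0 < t) :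
    HasDerivAt (fun s => s ^ (-(q + 1)) * nehariP a b p q β lam h (s • u))
      (t ^ (-(q + 2)) * nehariD a b p q β (t • u)) t := by
  have d1 := Real.hasDerivAt_rpow_const (x := t) (p := -(q + 1)) (Or.inl ht.ne')
  refine (d1.mul (hasDerivAt_nehariP A u ht)).congr_deriv ?_
  have e1 : t ^ (-(q + 1)) = t ^ (-(q + 2)) * t := by
    rw [← Real.rpow_add_one ht.ne']; congr 1; ring
  have e2 : t ^ (-(q + 1) - 1) = t ^ (-(q + 2)) := by congr 1; ring
  rw [e1, e2]
  field_simp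
  ring

lemma mem_nehari_iff (A : Admissible Ω a b p q β h) (u : W0 Ω) :
    u ∈ Nehari a b p q β lam h ↔ nehariP a b p q β lam h u = 0 := by
  have := (hasDerivAt_fiber (lam := lam) A u one_pos).deriv
  rw [one_smul, div_one] at this
  change deriv (fiber a b p q β lam h u) 1 = 0 ↔ _
  rw [this]

lemma deriv_deriv_fiber (A : Admissible Ω a b p q β h) {u : W0 Ω}
    (hu : nehariP a b p q β lam h u = 0) :
    deriv (deriv (fiber a b p q β lam h u)) 1 = nehariD a b p q β u := by
  have hev : deriv (fiber a b p q β lam h u) =ᶠ[𝓝 1]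
      fun t => nehariP a b p q β lam h (t • u) / t := by
    filter_upwards [eventually_gt_nhds (one_pos (α := ℝ))] with t ht
    exact (hasDerivAt_fiber A u ht).deriv
  rw [hev.deriv_eq]
  have := (hasDerivAt_nehariP (lam := lam) A u one_pos).div (hasDerivAt_id (1 : ℝ)) one_ne_zero
  have h2 := this.deriv
  simp only [id, one_smul, hu, mul_zero, add_zero, div_one, mul_one, sub_zero, one_pow] at h2
  exact h2

lemma mem_nehariPlus_iff (A : Admissible Ω a b p q β h) (u : W0 Ω) :
    u ∈ NehariPlus a b p q β lam h ↔
      nehariP a b p q β lam h u = 0 ∧ 0 < nehariD a b p q β u := by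
  change u ∈ Nehari a b p q β lam h ∧ _ ↔ _
  rw [mem_nehari_iff A]
  exact and_congr_right fun hu => by rw [deriv_deriv_fiber A hu]

lemma mem_nehariMinus_iff (A : Admissible Ω a b p q β h) (u : W0 Ω) :
    u ∈ NehariMinus a b p q β lam h ↔
      nehariP a b p q β lam h u = 0 ∧ nehariD a b p q β u < 0 := by
  change u ∈ Nehari a b p q β lam h ∧ _ ↔ _
  rw [mem_nehari_iff A]
  exact and_congr_right fun hu => by rw [deriv_deriv_fiber A hu]

/-- Once nonpositive along a ray, `D` is negative from then on: its negative term grows at least like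
`t^(p+2)`, and `p + 2 > 2 n`. -/
lemma nehariD_smul_neg (A : Admissible Ω a b p q β h) {u : W0 Ω} (hu : 0 < normPow u) {s t : ℝ}
    (hs : 0 < s) (hst : s < t) (hD : nehariD a b p q β (s • u) ≤ 0) :
    nehariD a b p q β (t • u) < 0 := by
  have hn1 : 1 ≤ n := by have := hn.out; omega
  obtain ⟨r, hr, rfl⟩ : ∃ r : ℝ, 1 < r ∧ t = r * s :=
    ⟨t / s, (one_lt_div hs).2 hst, (div_mul_cancel₀ t hs.ne').symm⟩
  have hr0 : 0 < r := one_pos.trans hr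
  set v := s • u with hv
  have hNv : 0 < normPow v := by rw [hv, normPow_smul_of_nonneg hs.le]; positivity
  rw [mul_smul, ← hv]
  have h1 := le_gssInt_smul (q := q) A hr.le v
  have hc1 : 0 < (2 * (n : ℝ) - q - 1) * a :=
    mul_pos (by linarith [A.q_lt, A.n_pos]) A.a_pos
  have hc2 : 0 < ((n : ℝ) - q - 1) * b := mul_pos (by linarith [A.q_lt]) A.b_pos
  rw [nehariD] at hD ⊢
  rw [normPow_smul_of_nonneg hr0.le]
  have hS : 0 < gssInt p q β v := by
    have : 0 < (2 * (n : ℝ) - q - 1) * a * normPow v ^ 2 := by positivity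
    have : 0 < ((n : ℝ) - q - 1) * b * normPow v := by positivity
    linarith
  have hr2n : (r ^ n) ^ 2 < r ^ (p + 2) := by
    rw [← pow_mul, ← Real.rpow_natCast]
    apply Real.rpow_lt_rpow_of_exponent_lt hr
    push_cast
    linarith [A.lt_p]
  have hrn : r ^ n ≤ (r ^ n) ^ 2 := by
    have := one_le_pow₀ hr.le (n := n)
    nlinarith
  have h3 : (r ^ n) ^ 2 * gssInt p q β v < r ^ (p + 2) * gssInt p q β v :=
    mul_lt_mul_of_pos_right hr2n hS
  have h4 : (n - q - 1) * b * (r ^ n * normPow v) ≤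
      (r ^ n) ^ 2 * ((n - q - 1) * b * normPow v) := by
    have := mul_le_mul_of_nonneg_right hrn (mul_pos hc2 hNv).le
    linarith
  have h5 : (r ^ n) ^ 2 * ((2 * n - q - 1) * a * normPow v ^ 2 + (n - q - 1) * b * normPow v) ≤
      (r ^ n) ^ 2 * gssInt p q β v :=
    mul_le_mul_of_nonneg_left (by linarith) (by positivity)
  nlinarith

end Energy

/-! ### The shape of the fibering maps -/

section Shape

open Filter Topology Set

/-- What is used of a fibering map `φ`: it vanishes at `0`, on `(0, ∞)` its derivative is a
positive multiple of a function `ψ`, and the derivative `δ` of `ψ` is negative after each of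
its nonpositive values, so that `ψ` increases and then decreases. -/
structure FiberProfile (φ ψ δ : ℝ → ℝ) : Prop where
  zero : φ 0 = 0
  cont : ContinuousOn φ (Ici 0)
  deriv : ∀ t, 0 < t → ∃ c, 0 < c ∧ HasDerivAt φ (c * ψ t) t
  deriv_ψ : ∀ t, 0 < t → HasDerivAt ψ (δ t) t
  neg : ∀ s t, 0 < s → s < t → δ s ≤ 0 → δ t < 0

namespace FiberProfile

variable {φ ψ δ : ℝ → ℝ}

lemma exists_slope (F : FiberProfile φ ψ δ) {s t : ℝ} (hs : 0 ≤ s) (hst : s < t) :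
    ∃ ξ ∈ Ioo s t, ∃ c, 0 < c ∧ φ t - φ s = c * ψ ξ := by
  have hpos : ∀ x ∈ Ioo s t, 0 < x := fun x hx => hs.trans_lt hx.1
  obtain ⟨ξ, hξ, h⟩ := exists_hasDerivAt_eq_slope φ (_root_.deriv φ) hst
    (F.cont.mono fun x hx => mem_Ici.2 (hs.trans hx.1))
    fun x hx => by
      obtain ⟨c, _, hc⟩ := F.deriv x (hpos x hx)
      exact hc.differentiableAt.hasDerivAt
  obtain ⟨c, hc0, hc⟩ := F.deriv ξ (hpos ξ hξ)
  rw [hc.deriv, eq_div_iff (sub_pos.2 hst).ne'] at h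
  exact ⟨ξ, hξ, c * (t - s), mul_pos hc0 (sub_pos.2 hst), by rw [← h]; ring⟩

lemma le_of_nonpos (F : FiberProfile φ ψ δ) {s t : ℝ} (hs : 0 ≤ s) (hst : s ≤ t)
    (h : ∀ x ∈ Ioo s t, ψ x ≤ 0) : φ t ≤ φ s := by
  rcases hst.eq_or_lt with rfl | hlt
  · exact le_rfl
  obtain ⟨ξ, hξ, c, hc, he⟩ := F.exists_slope hs hlt
  have := mul_nonpos_of_nonneg_of_nonpos hc.le (h ξ hξ)
  linarith

lemma le_of_nonneg (F : FiberProfile φ ψ δ) {s t : ℝ} (hs : 0 ≤ s) (hst : s ≤ t)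
    (h : ∀ x ∈ Ioo s t, 0 ≤ ψ x) : φ s ≤ φ t := by
  rcases hst.eq_or_lt with rfl | hlt
  · exact le_rfl
  obtain ⟨ξ, hξ, c, hc, he⟩ := F.exists_slope hs hlt
  have := mul_nonneg hc.le (h ξ hξ)
  linarith

lemma exists_slope_ψ (F : FiberProfile φ ψ δ) {s t : ℝ} (hs : 0 < s) (hst : s < t) :
    ∃ ξ ∈ Ioo s t, ψ t - ψ s = δ ξ * (t - s) := by
  obtain ⟨ξ, hξ, h⟩ := exists_hasDerivAt_eq_slope ψ δ hst
    (fun x hx => (F.deriv_ψ x (hs.trans_le hx.1)).continuousAt.continuousWithinAt)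
    fun x hx => F.deriv_ψ x (hs.trans hx.1)
  rw [eq_div_iff (sub_pos.2 hst).ne'] at h
  exact ⟨ξ, hξ, h.symm⟩

lemma ψ_neg_of_lt (F : FiberProfile φ ψ δ) (h0 : ψ 1 = 0) (h1 : δ 1 ≤ 0) {t : ℝ} (ht : 1 < t) :
    ψ t < 0 := by
  obtain ⟨ξ, hξ, h⟩ := F.exists_slope_ψ one_pos ht
  have := mul_neg_of_neg_of_pos (F.neg 1 ξ one_pos hξ.1 h1) (sub_pos.2 ht)
  linarith

lemma ψ_nonpos_of_le (F : FiberProfile φ ψ δ) (h0 : ψ 1 = 0) (h1 : 0 ≤ δ 1) {t : ℝ} (ht : 0 < t)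
    (ht1 : t ≤ 1) : ψ t ≤ 0 := by
  rcases ht1.eq_or_lt with rfl | hlt
  · exact h0.le
  obtain ⟨ξ, hξ, h⟩ := F.exists_slope_ψ ht hlt
  have hδ : 0 < δ ξ := by
    by_contra hc
    exact (F.neg ξ 1 (ht.trans hξ.1) hξ.2 (not_lt.1 hc)).not_ge h1
  have := mul_pos hδ (sub_pos.2 hlt)
  linarith

/-- If `ψ` crosses zero upwards at `1`, then `φ` decreases from `φ 0 = 0` up to `1`. -/
lemma nonpos_of_le_one (F : FiberProfile φ ψ δ) (h0 : ψ 1 = 0) (h1 : 0 ≤ δ 1) {t : ℝ}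
    (ht : 0 ≤ t) (ht1 : t ≤ 1) : φ t ≤ 0 := by
  rw [← F.zero]
  exact F.le_of_nonpos le_rfl ht fun x hx => F.ψ_nonpos_of_le h0 h1 hx.1 (hx.2.le.trans ht1)

/-- If `ψ` touches zero at `1`, this is its maximum and `φ` is decreasing. -/
lemma nonpos_of_eq_zero (F : FiberProfile φ ψ δ) (h0 : ψ 1 = 0) (h1 : δ 1 = 0) {t : ℝ}
    (ht : 0 ≤ t) : φ t ≤ 0 := by
  rw [← F.zero]
  refine F.le_of_nonpos le_rfl ht fun x hx => ?_
  rcases le_or_gt x 1 with h | h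
  · exact F.ψ_nonpos_of_le h0 h1.ge hx.1 h
  · exact (F.ψ_neg_of_lt h0 h1.le h).le

/-- If `ψ` crosses zero downwards at `1`, then no positive value of `φ` exceeds `φ 1`. -/
lemma le_max (F : FiberProfile φ ψ δ) (h0 : ψ 1 = 0) (h1 : δ 1 < 0) {t : ℝ} (ht : 0 ≤ t) :
    φ t ≤ max 0 (φ 1) := by
  rcases le_or_gt 1 t with h | h
  · exact (F.le_of_nonpos zero_le_one h fun x hx => (F.ψ_neg_of_lt h0 h1.le hx.1).le).trans
      (le_max_right _ _)
  by_cases hc : ∀ x ∈ Ioo t 1, 0 ≤ ψ x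
  · exact (F.le_of_nonneg ht h.le hc).trans (le_max_right _ _)
  push Not at hc
  -- A negative value `ψ x` before `1` forces `ψ` to increase on `(0, x]`, hence to be negative there.
  obtain ⟨x, hx, hxψ⟩ := hc
  have hx0 : 0 < x := ht.trans_lt hx.1
  refine le_trans ?_ (le_max_left _ _)
  rw [← F.zero]
  refine F.le_of_nonpos le_rfl ht fun y hy => ?_
  obtain ⟨ξ, hξ, he⟩ := F.exists_slope_ψ hx0 hx.2
  have hδξ : 0 < δ ξ := by
    by_contra hcon
    have := mul_nonpos_of_nonpos_of_nonneg (not_lt.1 hcon) (sub_pos.2 hx.2).le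
    linarith
  have hyx : y < x := hy.2.trans hx.1
  obtain ⟨η, hη, he'⟩ := F.exists_slope_ψ hy.1 hyx
  have hδη : 0 < δ η := by
    by_contra hcon
    exact (F.neg η ξ (hy.1.trans hη.1) (hη.2.trans hξ.1) (not_lt.1 hcon)).not_gt hδξ
  have := mul_pos hδη (sub_pos.2 hyx)
  linarith

lemma exists_ψ_pos (F : FiberProfile φ ψ δ) (h0 : ψ 1 = 0) (h1 : δ 1 < 0) :
    ∃ s, 0 < s ∧ s < 1 ∧ ∀ x ∈ Ioo s 1, 0 < ψ x := by
  have hs := (hasDerivAt_iff_tendsto_slope.1 (F.deriv_ψ 1 one_pos)).eventually_lt_const h1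
  have hs' : ∀ᶠ x in 𝓝[<] (1 : ℝ), slope ψ 1 x < 0 :=
    hs.filter_mono (nhdsWithin_mono _ fun x hx => ne_of_lt hx)
  obtain ⟨s, hs1, hsub⟩ := (mem_nhdsLT_iff_exists_Ioo_subset' (zero_lt_one' ℝ)).1 hs'
  refine ⟨max s (1 / 2), lt_max_of_lt_right (by norm_num), max_lt hs1 (by norm_num),
    fun x hx => ?_⟩
  have hx1 : slope ψ 1 x < 0 := hsub ⟨(le_max_left _ _).trans_lt hx.1, hx.2⟩
  rw [slope_def_field, h0, sub_zero] at hx1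
  by_contra hc
  exact (div_nonneg_of_nonpos (not_lt.1 hc) (sub_nonpos.2 hx.2.le)).not_gt hx1

/-- A sign change of `ψ` from plus to minus contains a transversal zero. -/
lemma exists_zero (F : FiberProfile φ ψ δ) {s r : ℝ} (hs : 0 < s) (hsr : s < r) (h1 : 0 < ψ s)
    (h2 : ψ r < 0) : ∃ t ∈ Ioo s r, ψ t = 0 ∧ δ t < 0 := by
  have hcont : ContinuousOn ψ (Icc s r) := fun x hx =>
    (F.deriv_ψ x (hs.trans_le hx.1)).continuousAt.continuousWithinAt
  obtain ⟨t, ht, h0⟩ := intermediate_value_Ioo' hsr.le hcont ⟨h2, h1⟩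
  refine ⟨t, ht, h0, ?_⟩
  obtain ⟨ξ, hξ, he⟩ := F.exists_slope_ψ hs ht.1
  refine F.neg ξ t (hs.trans hξ.1) hξ.2 ?_
  by_contra hcon
  have := mul_pos (not_le.1 hcon) (sub_pos.2 ht.1)
  linarith

end FiberProfile

variable {n : ℕ} [hn : Fact (2 ≤ n)] {Ω : Set (E n)} {a b p q β lam : ℝ} {h : E n → ℝ}

lemma primInt_smul_le (A : Admissible Ω a b p q β h) {t : ℝ} (ht : 0 ≤ t) (ht1 : t ≤ 1)
    (u : W0 Ω) : primInt p β (t • u) ≤ t ^ (p + 2) * gInt p β u := by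
  have h1 := mul_primInt_le A (t • u)
  have h2 := gInt_smul_le A ht ht1 u
  have h3 := primInt_nonneg (p := p) (β := β) (t • u)
  have := A.p_pos
  nlinarith

lemma continuousOn_fiber (A : Admissible Ω a b p q β h) (u : W0 Ω) :
    ContinuousOn (fiber a b p q β lam h u) (Ici 0) ∧ fiber a b p q β lam h u 0 = 0 := by
  have hp := A.p_pos
  have hq := A.q_pos
  have hn1 : n ≠ 0 := by have := hn.out; omega
  have hz : ∀ t : ℝ, 0 ≤ t → fiber a b p q β lam h u t =
      1 / (n : ℝ) * (a / 2 * (t ^ n * normPow u) ^ 2 + b * (t ^ n * normPow u)) -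
      lam / (q + 1) * (t ^ (q + 1) * hInt q h u) - primInt p β (t • u) := by
    intro t ht
    rw [fiber, J_eq, normPow_smul_of_nonneg ht, hInt_smul ht]
  have hprim0 : primInt p β ((0 : ℝ) • u) = 0 := by
    refine le_antisymm ?_ (primInt_nonneg _)
    have := primInt_smul_le A le_rfl zero_le_one u
    rwa [Real.zero_rpow (by linarith), zero_mul] at this
  have h0 : fiber a b p q β lam h u 0 = 0 := by
    rw [hz 0 le_rfl, hprim0, Real.zero_rpow (by linarith), zero_pow hn1]; ring
  refine ⟨fun t ht => ?_, h0⟩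
  rcases (mem_Ici.1 ht).eq_or_lt with rfl | ht0
  · have hprim : Tendsto (fun t : ℝ => primInt p β (t • u)) (𝓝[Ici 0] 0) (𝓝 0) := by
      have hr : Tendsto (fun t : ℝ => t ^ (p + 2) * gInt p β u) (𝓝[Ici 0] 0) (𝓝 0) := by
        have : Continuous fun t : ℝ => t ^ (p + 2) * gInt p β u :=
          (Real.continuous_rpow_const (by linarith)).mul continuous_const
        have := (this.tendsto 0).mono_left (nhdsWithin_le_nhds (s := Ici 0))
        rwa [Real.zero_rpow (by linarith), zero_mul] at this
      refine tendsto_of_tendsto_of_tendsto_of_le_of_le' tendsto_const_nhds hr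
        (Eventually.of_forall fun t => primInt_nonneg _) ?_
      filter_upwards [self_mem_nhdsWithin, nhdsWithin_le_nhds (eventually_le_nhds one_pos)]
        with t ht ht1 using primInt_smul_le A ht ht1 u
    have hrest : Continuous fun t : ℝ =>
        1 / (n : ℝ) * (a / 2 * (t ^ n * normPow u) ^ 2 + b * (t ^ n * normPow u)) -
        lam / (q + 1) * (t ^ (q + 1) * hInt q h u) := by
      have : Continuous fun t : ℝ => t ^ (q + 1) := Real.continuous_rpow_const (by linarith)
      fun_prop
    have := ((hrest.tendsto 0).mono_left (nhdsWithin_le_nhds (s := Ici 0))).sub hprim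
    have h2 := hz 0 le_rfl
    rw [hprim0] at h2
    rw [← h2] at this
    refine this.congr' ?_
    filter_upwards [self_mem_nhdsWithin] with s hs using (hz s hs).symm
  · exact (hasDerivAt_fiber A u ht0).continuousAt.continuousWithinAt

lemma fiberProfile (A : Admissible Ω a b p q β h) {u : W0 Ω} (hu : 0 < normPow u) :
    FiberProfile (fiber a b p q β lam h u)
      (fun t => t ^ (-(q + 1)) * nehariP a b p q β lam h (t • u))
      (fun t => t ^ (-(q + 2)) * nehariD a b p q β (t • u)) where
  zero := (continuousOn_fiber A u).2
  cont := (continuousOn_fiber A u).1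
  deriv t ht := by
    refine ⟨t ^ q, by positivity, ?_⟩
    refine (hasDerivAt_fiber A u ht).congr_deriv ?_
    rw [← mul_assoc, ← Real.rpow_add ht, show q + -(q + 1) = -1 by ring, Real.rpow_neg_one,
      div_eq_inv_mul]
  deriv_ψ t ht := hasDerivAt_rpow_mul_nehariP A u ht
  neg s t hs hst hD := by
    have ht : 0 < t := hs.trans hst
    have hD' : nehariD a b p q β (s • u) ≤ 0 := by
      by_contra hc
      exact (mul_pos (Real.rpow_pos_of_pos hs _) (not_le.1 hc)).not_ge hD
    exact mul_neg_of_pos_of_neg (Real.rpow_pos_of_pos ht _) (nehariD_smul_neg A hu hs hst hD')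

/-- On `N⁺ ∪ N⁰` the energy is nonpositive up to the Nehari point. -/
lemma J_smul_nonpos_of_le_one (A : Admissible Ω a b p q β h) {u : W0 Ω} (hu : 0 < normPow u)
    (hP : nehariP a b p q β lam h u = 0) (hD : 0 ≤ nehariD a b p q β u) {t : ℝ} (ht : 0 ≤ t)
    (ht1 : t ≤ 1) : J a b p q β lam h (t • u) ≤ 0 :=
  (fiberProfile A hu).nonpos_of_le_one (by simp [hP]) (by simpa using hD) ht ht1

/-- On `N⁰` the energy is nonpositive on the whole ray. -/
lemma J_smul_nonpos_of_eq_zero (A : Admissible Ω a b p q β h) {u : W0 Ω} (hu : 0 < normPow u)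
    (hP : nehariP a b p q β lam h u = 0) (hD : nehariD a b p q β u = 0) {t : ℝ} (ht : 0 ≤ t) :
    J a b p q β lam h (t • u) ≤ 0 :=
  (fiberProfile A hu).nonpos_of_eq_zero (by simp [hP]) (by simp [hD]) ht

/-- A point of `N⁻` with positive energy maximizes the energy on its ray. -/
lemma J_smul_le_max (A : Admissible Ω a b p q β h) {u : W0 Ω} (hu : 0 < normPow u)
    (hP : nehariP a b p q β lam h u = 0) (hD : nehariD a b p q β u < 0) {t : ℝ} (ht : 0 ≤ t) :
    J a b p q β lam h (t • u) ≤ max 0 (J a b p q β lam h u) := by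
  have := (fiberProfile (lam := lam) A hu).le_max (by simp [hP]) (by simpa using hD) ht
  simpa only [fiber, one_smul] using this

lemma exists_smul_mem_nehariMinus_of_sign (A : Admissible Ω a b p q β h) {u : W0 Ω}
    (hu : 0 < normPow u) {s r : ℝ} (hs : 0 < s) (hsr : s < r)
    (h1 : 0 < nehariP a b p q β lam h (s • u)) (h2 : nehariP a b p q β lam h (r • u) < 0) :
    ∃ t ∈ Ioo s r, t • u ∈ NehariMinus a b p q β lam h := by
  obtain ⟨t, ht, e1, e2⟩ := (fiberProfile (lam := lam) A hu).exists_zero hs hsr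
    (mul_pos (Real.rpow_pos_of_pos hs _) h1)
    (mul_neg_of_pos_of_neg (Real.rpow_pos_of_pos (hs.trans hsr) _) h2)
  have ht0 : 0 < t := hs.trans ht.1
  refine ⟨t, ht, (mem_nehariMinus_iff A _).2 ⟨?_, ?_⟩⟩
  · exact (mul_eq_zero.1 e1).resolve_left (Real.rpow_pos_of_pos ht0 _).ne'
  · exact neg_of_mul_neg_right e2 (Real.rpow_pos_of_pos ht0 _).le

end Shape

/-! ### Geometry of the energy -/

section Geometry

open Filter Topology Set

/-- A test function on which the weighted integral is positive: a bump function equal to `1` on a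
compact part of `{h > 0}` and supported close to it. -/
lemma exists_isTest_integral_pos {n : ℕ} {Ω : Set (E n)} {a b p q β : ℝ}
    {h : E n → ℝ} (hΩ : IsOpen Ω) (A : Admissible Ω a b p q β h)
    (hpos : ¬ ∀ᵐ x ∂(volume.restrict Ω), h x ≤ 0) :
    ∃ φ : E n → ℝ, IsTest Ω φ ∧ 0 < ∫ x in Ω, h x * |φ x| ^ (q + 1) := by
  have hq := A.q_pos
  have hfinΩ : IsFiniteMeasure (volume.restrict Ω) := ⟨by simpa using A.vol.lt_top⟩
  have hint : Integrable h (volume.restrict Ω) :=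
    A.memLp.integrable (by rw [← ENNReal.ofReal_one]; exact ENNReal.ofReal_le_ofReal A.one_lt_γ.le)
  set h' := hint.1.mk h with hh'
  have hae : h =ᵐ[volume.restrict Ω] h' := hint.1.ae_eq_mk
  have hm' : Measurable h' := hint.1.stronglyMeasurable_mk.measurable
  set S : Set (E n) := {x | 0 < h' x} ∩ Ω with hS
  have hSm : MeasurableSet S := (measurableSet_lt measurable_const hm').inter hΩ.measurableSet
  have hS0 : 0 < volume S := by
    refine pos_iff_ne_zero.2 fun h0 => hpos ?_
    have h1 : ∀ᵐ x ∂(volume.restrict Ω), ¬ 0 < h' x := by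
      rw [ae_iff]
      simp only [not_not]
      rwa [Measure.restrict_apply (measurableSet_lt measurable_const hm')]
    filter_upwards [hae, h1] with x hx hx1
    rw [hx]; exact not_lt.1 hx1
  obtain ⟨K, hKS, hK, hK0⟩ := hSm.exists_lt_isCompact hS0
  have hKΩ : K ⊆ Ω := fun x hx => (hKS hx).2
  -- the finite measure `|h| dx` on `Ω`
  set ν : Measure (E n) := (volume.restrict Ω).withDensity fun x => ENNReal.ofReal |h' x| with hν
  have hint' : Integrable h' (volume.restrict Ω) := hint.congr hae
  have hνfin : IsFiniteMeasure ν := by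
    refine isFiniteMeasure_withDensity_ofReal ?_
    exact hint'.norm.2
  have hνapp : ∀ s, MeasurableSet s → (ν s).toReal = ∫ x in Ω, s.indicator (fun x => |h' x|) x := by
    intro s hs
    rw [hν, withDensity_apply _ hs, integral_indicator hs,
      integral_eq_lintegral_of_nonneg_ae (Eventually.of_forall fun x => abs_nonneg _)
        hm'.abs.aestronglyMeasurable]
  have hKm := hK.measurableSet
  have hνK : 0 < ν K := by
    refine pos_iff_ne_zero.2 fun h0 => ?_
    rw [hν, withDensity_apply _ hKm, lintegral_eq_zero_iff (by fun_prop),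
      Measure.restrict_restrict hKm, inter_eq_left.2 hKΩ] at h0
    have h1 : ∀ᵐ x ∂(volume.restrict K), False := by
      filter_upwards [h0, ae_restrict_mem hKm] with x hx hxK
      have hx' : 0 < h' x := (hKS hxK).1
      have : (0 : ENNReal) < ENNReal.ofReal |h' x| := ENNReal.ofReal_pos.2 (abs_pos.2 hx'.ne')
      exact this.ne' hx
    have h2 : volume.restrict K = 0 := by simpa using h1
    rw [Measure.restrict_eq_zero] at h2
    exact hK0.ne' h2
  have hνK' : ν K < 2 * ν K := by
    rw [two_mul]
    exact ENNReal.lt_add_right (measure_ne_top ν K) hνK.ne'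
  obtain ⟨U, hKU, hU, hνU⟩ := K.exists_isOpen_lt_of_lt _ hνK'
  obtain ⟨L, hL, hKL, hLU⟩ := exists_compact_between hK (hU.inter hΩ) (subset_inter hKU hKΩ)
  obtain ⟨φ, hφ, hφ01, hφs, hφ1⟩ := exists_contMDiff_support_eq_eq_one_iff (n := ⊤)
    (modelWithCornersSelf ℝ (E n)) isOpen_interior hK.isClosed hKL
  have hsuppL : tsupport φ ⊆ L :=
    closure_minimal (hφs.le.trans interior_subset) hL.isClosed
  refine ⟨φ, ⟨hφ.contDiff, hL.of_isClosed_subset (isClosed_tsupport φ) hsuppL,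
    hsuppL.trans fun x hx => (hLU hx).2⟩, ?_⟩
  have hφ01' : ∀ x, φ x ∈ Icc (0 : ℝ) 1 := fun x => hφ01 (mem_range_self x)
  have hi1 : Integrable (K.indicator fun x => |h' x|) (volume.restrict Ω) :=
    hint'.abs.indicator hKm
  have hi2 : Integrable (U.indicator fun x => |h' x|) (volume.restrict Ω) :=
    hint'.abs.indicator hU.measurableSet
  have hi3 : Integrable (fun x => h x * |φ x| ^ (q + 1)) (volume.restrict Ω) := by
    refine hint.abs.mono' (hint.1.mul
      ((continuous_abs_rpow (by linarith)).comp hφ.continuous).aestronglyMeasurable)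
      (Eventually.of_forall fun x => ?_)
    rw [norm_mul, Real.norm_eq_abs, Real.norm_of_nonneg (by positivity)]
    refine mul_le_of_le_one_right (abs_nonneg _) (Real.rpow_le_one (abs_nonneg _) ?_ (by linarith))
    rw [abs_of_nonneg (hφ01' x).1]; exact (hφ01' x).2
  have hlow : 2 * (ν K).toReal - (ν U).toReal ≤ ∫ x in Ω, h x * |φ x| ^ (q + 1) := by
    rw [hνapp K hKm, hνapp U hU.measurableSet, ← integral_const_mul,
      ← integral_sub (hi1.const_mul 2) hi2]
    refine integral_mono_ae ((hi1.const_mul 2).sub hi2) hi3 ?_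
    filter_upwards [hae] with x hx
    simp only [hx]
    by_cases hxK : x ∈ K
    · have hp' : 0 < h' x := (hKS hxK).1
      rw [indicator_of_mem hxK, indicator_of_mem (hKU hxK), (hφ1 x).1 hxK, abs_one,
        Real.one_rpow, abs_of_pos hp']
      linarith
    · rw [indicator_of_notMem hxK]
      by_cases hxU : x ∈ U
      · rw [indicator_of_mem hxU]
        have e1 : |h' x * |φ x| ^ (q + 1)| ≤ |h' x| := by
          rw [abs_mul, abs_of_nonneg (by positivity : 0 ≤ |φ x| ^ (q + 1))]
          refine mul_le_of_le_one_right (abs_nonneg _)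
            (Real.rpow_le_one (abs_nonneg _) ?_ (by linarith))
          rw [abs_of_nonneg (hφ01' x).1]; exact (hφ01' x).2
        have := (abs_le.1 e1).1
        linarith
      · have : φ x = 0 := by
          by_contra hc
          have : x ∈ interior L := hφs ▸ hc
          exact hxU (hLU (interior_subset this)).1
        rw [indicator_of_notMem hxU, this, abs_zero, Real.zero_rpow (by linarith)]
        simp
  have hlt : (ν U).toReal < 2 * (ν K).toReal := by
    have := (ENNReal.toReal_lt_toReal (measure_ne_top ν U)
      (ENNReal.mul_ne_top (by simp) (measure_ne_top ν K))).2 hνU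
    simpa [ENNReal.toReal_mul] using this
  linarith

variable {n : ℕ} [hn : Fact (2 ≤ n)] {Ω : Set (E n)} {a b p q β lam : ℝ} {h : E n → ℝ}

lemma exists_bound_hInt (A : Admissible Ω a b p q β h) (K : ℝ) :
    ∃ B : ℝ, 0 ≤ B ∧ ∀ u : W0 Ω, normPow u ≤ K → |hInt q h u| ≤ B :=
  exists_bound_integral_mul_comp A.vol A.β_pos A.β_lt A.one_lt_γ A.memLp
    (continuous_abs_rpow (by linarith [A.q_pos]))
    (expGrowth_rpow A.β_pos (by linarith [A.q_pos])) K

lemma exists_bound_gInt (A : Admissible Ω a b p q β h) (K : ℝ) :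
    ∃ B : ℝ, 0 ≤ B ∧ ∀ u : W0 Ω, normPow u ≤ K → gInt p β u ≤ B := by
  obtain ⟨B, hB, hb⟩ := exists_bound_integral_mul_comp (Ω := Ω) A.vol A.β_pos A.β_lt one_lt_two
    (memLp_one A.vol) (continuous_gs A.p_pos A.β_pos) (expGrowth_gs A.p_pos A.β_pos) K
  refine ⟨B, hB, fun u hu => ?_⟩
  have := hb u hu
  simp only [one_mul] at this
  exact (le_abs_self _).trans this

lemma exists_normPow_eq_smul {u : W0 Ω} {t : ℝ} (ht : 0 < t) (hu : normPow u = t ^ n) :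
    ∃ w : W0 Ω, normPow w = 1 ∧ u = t • w := by
  refine ⟨t⁻¹ • u, ?_, by rw [smul_smul, mul_inv_cancel₀ ht.ne', one_smul]⟩
  rw [normPow_smul_of_nonneg (inv_pos.2 ht).le, hu, inv_pow, inv_mul_cancel₀ (pow_pos ht n).ne']

/-- For small `λ` the energy is bounded below by a positive constant on a small sphere: there the
term `b ‖u‖ⁿ / n` dominates `∫ G(u)`, which is of order `t₀^(p+2)`. -/
lemma exists_sphere (A : Admissible Ω a b p q β h) :
    ∃ t₀ c₀ lam₀ : ℝ, 0 < t₀ ∧ 0 < c₀ ∧ 0 < lam₀ ∧ ∀ lam, 0 < lam → lam < lam₀ →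
      ∀ u : W0 Ω, normPow u = t₀ ^ n → c₀ ≤ J a b p q β lam h u := by
  obtain ⟨B₁, hB₁, hb₁⟩ := exists_bound_hInt A 1
  obtain ⟨B₂, hB₂, hb₂⟩ := exists_bound_gInt A 1
  have hn0 := A.n_pos
  have hb := A.b_pos
  have hq := A.q_pos
  -- The radius leaves half of `b t₀ⁿ / n`, and the bound on `λ` half of the remainder `c`.
  set t₀ : ℝ := min 1 (b / (2 * n * (B₂ + 1))) with ht₀
  have ht0 : 0 < t₀ := lt_min one_pos (by positivity)
  have ht1 : t₀ ≤ 1 := min_le_left _ _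
  have htB : B₂ * t₀ ≤ b / (2 * n) := by
    have h1 : t₀ ≤ b / (2 * n * (B₂ + 1)) := min_le_right _ _
    calc B₂ * t₀ ≤ (B₂ + 1) * (b / (2 * n * (B₂ + 1))) := by gcongr; linarith
      _ = b / (2 * n) := by field_simp
  set c := t₀ ^ n * (b / (2 * n)) with hc
  have hc0 : 0 < c := by positivity
  refine ⟨t₀, c / 2, c / (2 * (B₁ + 1)), ht0, by positivity, by positivity, ?_⟩
  intro lam hl hl0 u hu
  obtain ⟨w, hw, rfl⟩ := exists_normPow_eq_smul ht0 hu
  have h1 := hb₁ w hw.le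
  have h2 := hb₂ w hw.le
  rw [J_eq, hu, hInt_smul ht0.le]
  have h3 := primInt_smul_le A ht0.le ht1 w
  have h4 : t₀ ^ (p + 2) ≤ t₀ ^ n * t₀ := by
    rw [← pow_succ, ← Real.rpow_natCast]
    apply Real.rpow_le_rpow_of_exponent_ge ht0 ht1
    push_cast
    linarith [A.lt_p, A.q_lt]
  have h5 : t₀ ^ (p + 2) * gInt p β w ≤ t₀ ^ n * (b / (2 * n)) :=
    calc t₀ ^ (p + 2) * gInt p β w ≤ (t₀ ^ n * t₀) * B₂ :=
          mul_le_mul h4 h2 (gInt_nonneg _) (by positivity)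
      _ = t₀ ^ n * (B₂ * t₀) := by ring
      _ ≤ _ := by gcongr
  have h6 : lam / (q + 1) * (t₀ ^ (q + 1) * hInt q h w) ≤ c / 2 := by
    have e1 : t₀ ^ (q + 1) * hInt q h w ≤ 1 * B₁ :=
      (mul_le_mul_of_nonneg_left ((le_abs_self _).trans h1) (by positivity)).trans
        (mul_le_mul_of_nonneg_right (Real.rpow_le_one ht0.le ht1 (by linarith)) hB₁)
    have e2 : lam / (q + 1) ≤ lam := div_le_self hl.le (by linarith)
    calc _ ≤ lam / (q + 1) * (1 * B₁) := by gcongr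
      _ ≤ lam * (B₁ + 1) := by
        rw [one_mul]
        exact mul_le_mul e2 (by linarith) hB₁ hl.le
      _ ≤ c / (2 * (B₁ + 1)) * (B₁ + 1) := by gcongr
      _ = c / 2 := by field_simp
  have h7 : t₀ ^ n * (b / n) ≤ 1 / (n : ℝ) * (a / 2 * (t₀ ^ n) ^ 2 + b * t₀ ^ n) := by
    have : 0 ≤ 1 / (n : ℝ) * (a / 2 * (t₀ ^ n) ^ 2) := by have := A.a_pos; positivity
    have e : 1 / (n : ℝ) * (a / 2 * (t₀ ^ n) ^ 2 + b * t₀ ^ n) =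
      1 / (n : ℝ) * (a / 2 * (t₀ ^ n) ^ 2) + t₀ ^ n * (b / n) := by ring
    linarith
  have h8 : t₀ ^ n * (b / n) = c + t₀ ^ n * (b / (2 * n)) := by rw [hc]; field_simp; ring
  linarith

/-- On the Nehari set the energy controls the norm: in `J(u) - P(u) / (p + 2)` the integral of the
nonlinearity drops out by the Ambrosetti–Rabinowitz condition. -/
lemma exists_bound_of_nehari (A : Admissible Ω a b p q β h) (hl : 0 < lam) (K : ℝ) :
    ∃ K' : ℝ, ∀ u : W0 Ω, nehariP a b p q β lam h u = 0 → J a b p q β lam h u ≤ K →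
      normPow u ≤ K' := by
  obtain ⟨B, hB, hb⟩ := exists_bound_hInt A 1
  have hn0 := A.n_pos
  have hq := A.q_pos
  have ha := A.a_pos
  have hb0 := A.b_pos
  have hp : 2 * (n : ℝ) < p + 2 := by linarith [A.lt_p]
  have hp2 : 0 < p + 2 := by linarith
  set c := a * (1 / (2 * n) - 1 / (p + 2)) with hc
  have hc0 : 0 < c :=
    mul_pos ha (sub_pos.2 (one_div_lt_one_div_of_lt (by positivity) hp))
  have hd0 : 0 ≤ 1 / (n : ℝ) - 1 / (p + 2) :=
    sub_nonneg.2 (one_div_le_one_div_of_le hn0 (by linarith))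
  refine ⟨max 1 ((|K| + lam * B) / c), fun u hP hJ => ?_⟩
  rcases le_or_gt (normPow u) 1 with h1 | h1
  · exact h1.trans (le_max_left _ _)
  refine le_trans ?_ (le_max_right _ _)
  have hN0 : 0 < normPow u := by linarith
  rw [le_div_iff₀ hc0]
  -- the bound on `∫ h |u|^(q+1)` by scaling, using `q + 1 < n`
  have hH : |hInt q h u| ≤ normPow u * B := by
    set t := normPow u ^ (1 / (n : ℝ)) with ht
    have ht0 : 0 < t := Real.rpow_pos_of_pos hN0 _
    have htn : normPow u = t ^ n := by
      rw [ht, ← Real.rpow_natCast, ← Real.rpow_mul hN0.le, one_div_mul_cancel hn0.ne',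
        Real.rpow_one]
    obtain ⟨w, hw, hu⟩ := exists_normPow_eq_smul ht0 htn
    have e1 : t ^ (q + 1) ≤ t ^ n := by
      rw [← Real.rpow_natCast t n]
      exact Real.rpow_le_rpow_of_exponent_le (Real.one_le_rpow h1.le (by positivity))
        (by linarith [A.q_lt])
    have e2 : hInt q h u = t ^ (q + 1) * hInt q h w := by rw [← hInt_smul ht0.le, ← hu]
    rw [e2, htn, abs_mul, abs_of_pos (Real.rpow_pos_of_pos ht0 _)]
    exact mul_le_mul e1 (hb w hw.le) (abs_nonneg _) (by positivity)
  have hprim : primInt p β u ≤ 1 / (p + 2) * gInt p β u := by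
    rw [one_div, ← div_eq_inv_mul, le_div_iff₀ hp2]
    linarith [mul_primInt_le A u]
  rw [J_eq] at hJ
  rw [nehariP] at hP
  have hQ : gInt p β u = a * normPow u ^ 2 + b * normPow u - lam * hInt q h u := by linarith
  rw [hQ] at hprim
  have hk0 : 0 ≤ 1 / (q + 1) - 1 / (p + 2) :=
    sub_nonneg.2 (one_div_le_one_div_of_le (by linarith) (by linarith [A.q_lt]))
  have hk1 : 1 / (q + 1) - 1 / (p + 2) ≤ 1 := by
    have e1 : 1 / (q + 1) ≤ 1 := by rw [div_le_one (by linarith)]; linarith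
    have e2 : 0 < 1 / (p + 2) := by positivity
    linarith
  have hlH : lam * (1 / (q + 1) - 1 / (p + 2)) * hInt q h u ≤ lam * B * normPow u := by
    have e1 : (1 / (q + 1) - 1 / (p + 2)) * hInt q h u ≤ 1 * (normPow u * B) :=
      (mul_le_mul_of_nonneg_left ((le_abs_self _).trans hH) hk0).trans
        (mul_le_mul_of_nonneg_right hk1 (by positivity))
    calc _ = lam * ((1 / (q + 1) - 1 / (p + 2)) * hInt q h u) := by ring
      _ ≤ lam * (1 * (normPow u * B)) := by gcongr
      _ = _ := by ring
  have hmain : c * normPow u ^ 2 + (1 / (n : ℝ) - 1 / (p + 2)) * (b * normPow u) -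
      lam * (1 / (q + 1) - 1 / (p + 2)) * hInt q h u ≤ K := by
    have e : c * normPow u ^ 2 + (1 / (n : ℝ) - 1 / (p + 2)) * (b * normPow u) -
      lam * (1 / (q + 1) - 1 / (p + 2)) * hInt q h u =
      1 / (n : ℝ) * (a / 2 * normPow u ^ 2 + b * normPow u) - lam / (q + 1) * hInt q h u -
      1 / (p + 2) * (a * normPow u ^ 2 + b * normPow u - lam * hInt q h u) := by
      rw [hc]
      have : (1 : ℝ) / (2 * n) = 1 / n / 2 := by field_simp
      rw [this]; ring
    linarith
  have hpos : 0 ≤ (1 / (n : ℝ) - 1 / (p + 2)) * (b * normPow u) := by positivity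
  have hK : K ≤ |K| * normPow u := by
    have := le_abs_self K
    have := abs_nonneg K
    nlinarith
  have : (normPow u * c) * normPow u ≤ (|K| + lam * B) * normPow u := by nlinarith
  exact le_of_mul_le_mul_right this hN0

lemma gInt_pos (A : Admissible Ω a b p q β h) {u : W0 Ω}
    (hu : ¬ fn u =ᵐ[volume.restrict Ω] 0) : 0 < gInt p β u := by
  refine lt_of_le_of_ne (gInt_nonneg u) fun h0 => hu ?_
  have h1 := (integral_eq_zero_iff_of_nonneg (fun x => gs_nonneg p β (fn u x))
    (integrable_gs A u)).1 h0.symm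
  filter_upwards [h1] with x hx
  by_contra hc
  have hc' : 0 < |fn u x| := abs_pos.2 hc
  have : 0 < gs p β (fn u x) := by unfold gs; positivity
  exact this.ne' hx

lemma normPow_pos_of_ne (A : Admissible Ω a b p q β h) {u : W0 Ω} (hu : u ≠ 0) :
    0 < normPow u :=
  lt_of_le_of_ne (normPow_nonneg u) fun h0 => hu (eq_zero_of_normPow_eq_zero A.vol h0.symm)

lemma ne_zero_of_fn {u : W0 Ω} (hu : ¬ fn u =ᵐ[volume.restrict Ω] 0) : u ≠ 0 := by
  rintro rfl
  exact hu (Lp.coeFn_zero _ _ _)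

/-- Far out on each ray the nonlinearity prevails, because `p + 2 > 2 n`. -/
lemma exists_nehariP_smul_neg (A : Admissible Ω a b p q β h) {u : W0 Ω}
    (hu : ¬ fn u =ᵐ[volume.restrict Ω] 0) (s : ℝ) :
    ∃ r, s < r ∧ nehariP a b p q β lam h (r • u) < 0 := by
  have hQ := gInt_pos A hu
  set C := a * normPow u ^ 2 + b * normPow u + |lam * hInt q h u| with hC
  have hexp : 0 < p + 2 - 2 * n := by linarith [A.lt_p]
  obtain ⟨r, hr1, hr2⟩ := (((tendsto_rpow_atTop hexp).eventually_gt_atTop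
    (C / gInt p β u)).and (eventually_gt_atTop (max s 1))).exists
  have hrs : s < r := (le_max_left _ _).trans_lt hr2
  have hr : 1 < r := (le_max_right _ _).trans_lt hr2
  have hr0 : 0 < r := by linarith
  refine ⟨r, hrs, ?_⟩
  rw [nehariP_smul hr0.le]
  have h1 := le_gInt_smul A hr.le u
  rw [div_lt_iff₀ hQ] at hr1
  have h2 : r ^ (p + 2) = (r ^ n) ^ 2 * r ^ (p + 2 - 2 * n) := by
    rw [← pow_mul, ← Real.rpow_natCast, ← Real.rpow_add hr0]; congr 1; push_cast; ring
  have h3 : (r ^ n) ^ 2 * C < r ^ (p + 2) * gInt p β u := by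
    rw [h2, mul_assoc]; exact mul_lt_mul_of_pos_left hr1 (by positivity)
  have hrn : r ^ n ≤ (r ^ n) ^ 2 := by
    have := one_le_pow₀ hr.le (n := n)
    nlinarith
  have hrq : r ^ (q + 1) ≤ (r ^ n) ^ 2 := by
    refine le_trans ?_ hrn
    rw [← Real.rpow_natCast]
    exact Real.rpow_le_rpow_of_exponent_le hr.le (by linarith [A.q_lt])
  have h4 : b * (r ^ n * normPow u) ≤ (r ^ n) ^ 2 * (b * normPow u) := by
    have := mul_le_mul_of_nonneg_right hrn (mul_nonneg A.b_pos.le (normPow_nonneg u))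
    linarith
  have h5 : -(lam * (r ^ (q + 1) * hInt q h u)) ≤ (r ^ n) ^ 2 * |lam * hInt q h u| :=
    calc -(lam * (r ^ (q + 1) * hInt q h u)) = r ^ (q + 1) * -(lam * hInt q h u) := by ring
      _ ≤ r ^ (q + 1) * |lam * hInt q h u| := by gcongr; exact neg_le_abs _
      _ ≤ _ := by gcongr
  have h6 : a * (r ^ n * normPow u) ^ 2 = (r ^ n) ^ 2 * (a * normPow u ^ 2) := by ring
  rw [hC] at h3
  nlinarith

/-- Every ray on which the energy is positive somewhere meets `N⁻`. -/
lemma exists_smul_mem_nehariMinus (A : Admissible Ω a b p q β h) {u : W0 Ω}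
    (hu : ¬ fn u =ᵐ[volume.restrict Ω] 0) {t₀ : ℝ} (ht₀ : 0 < t₀)
    (hJ : 0 < J a b p q β lam h (t₀ • u)) :
    ∃ t : ℝ, 0 < t ∧ t • u ∈ NehariMinus a b p q β lam h := by
  have hN := normPow_pos_of_ne A (ne_zero_of_fn hu)
  have F := fiberProfile (lam := lam) A hN
  have hs : ∃ s : ℝ, 0 < s ∧ 0 < nehariP a b p q β lam h (s • u) := by
    by_contra! hc
    have h1 := F.le_of_nonpos le_rfl ht₀.le fun x hx =>
      mul_nonpos_of_nonneg_of_nonpos (Real.rpow_nonneg hx.1.le _) (hc x hx.1)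
    rw [F.zero] at h1
    exact hJ.not_ge h1
  obtain ⟨s, hs0, hsP⟩ := hs
  obtain ⟨r, hsr, hr⟩ := exists_nehariP_smul_neg (lam := lam) A hu s
  obtain ⟨t, ht, hmem⟩ := exists_smul_mem_nehariMinus_of_sign A hN hs0 hsr hsP hr
  exact ⟨t, hs0.trans ht.1, hmem⟩

lemma exists_hInt_pos (hΩ : IsOpen Ω) (A : Admissible Ω a b p q β h)
    (hpos : ¬ ∀ᵐ x ∂(volume.restrict Ω), h x ≤ 0) : ∃ u : W0 Ω, 0 < hInt q h u := by
  obtain ⟨φ, hφ, h0⟩ := exists_isTest_integral_pos hΩ A hpos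
  obtain ⟨w, hw, _⟩ := exists_of_isTest hφ
  refine ⟨w, h0.trans_eq ?_⟩
  rw [hInt]
  refine integral_congr_ae ?_
  filter_upwards [hw] with x hx
  rw [hx]

/-- Where `∫ h |u|^(q+1) > 0` the energy is negative along the ray through `u` near `0`, because
`q + 1 < n`. -/
lemma eventually_J_smul_neg (A : Admissible Ω a b p q β h) (hl : 0 < lam) {u : W0 Ω}
    (hu : 0 < hInt q h u) : ∀ᶠ t in 𝓝[>] (0 : ℝ), J a b p q β lam h (t • u) < 0 := by
  have hq := A.q_pos
  have hn0 := A.n_pos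
  have hn1 : n ≠ 0 := by have := hn.out; omega
  have hr : 0 < (n : ℝ) - (q + 1) := by linarith [A.q_lt]
  have hc : Continuous fun t : ℝ => t ^ ((n : ℝ) - (q + 1)) *
      (1 / (n : ℝ) * (a / 2 * t ^ n * normPow u ^ 2 + b * normPow u)) := by
    have : Continuous fun t : ℝ => t ^ ((n : ℝ) - (q + 1)) := Real.continuous_rpow_const hr.le
    fun_prop
  have hlim := hc.tendsto 0
  simp only [Real.zero_rpow hr.ne', zero_mul] at hlim
  have hpos : 0 < lam / (q + 1) * hInt q h u := by positivity
  filter_upwards [nhdsWithin_le_nhds (hlim.eventually_lt_const hpos), self_mem_nhdsWithin]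
    with t ht ht0
  have ht0 : 0 < t := ht0
  rw [J_eq, normPow_smul_of_nonneg ht0.le, hInt_smul ht0.le]
  have e : t ^ n = t ^ (q + 1) * t ^ ((n : ℝ) - (q + 1)) := by
    rw [← Real.rpow_add ht0, add_sub_cancel, Real.rpow_natCast]
  have h1 := mul_lt_mul_of_pos_left ht (Real.rpow_pos_of_pos ht0 (q + 1))
  have h2 : 1 / (n : ℝ) * (a / 2 * (t ^ n * normPow u) ^ 2 + b * (t ^ n * normPow u)) =
      t ^ (q + 1) * (t ^ ((n : ℝ) - (q + 1)) *
      (1 / (n : ℝ) * (a / 2 * t ^ n * normPow u ^ 2 + b * normPow u))) := by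
    rw [← mul_assoc (t ^ (q + 1)), ← e]; ring
  have h3 := primInt_nonneg (p := p) (β := β) (t • u)
  linarith

end Geometry

/-! ### Minimization -/

section Minimization

open Filter Topology Set

variable {n : ℕ} [hn : Fact (2 ≤ n)] {Ω : Set (E n)} {a b p q β lam : ℝ} {h : E n → ℝ}

/-- The mode of convergence in which bounded sequences of `W₀^{1,n}(Ω)` are compact: the moduli
converge almost everywhere to a nonnegative `u`, and `‖w_k‖ⁿ → L ≥ ‖u‖ⁿ`. -/
structure AbsLimit (w : ℕ → W0 Ω) (u : W0 Ω) (L : ℝ) : Prop where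
  tendsto_normPow : Tendsto (fun k => normPow (w k)) atTop (𝓝 L)
  normPow_le : normPow u ≤ L
  nonneg : ∀ᵐ x ∂(volume.restrict Ω), 0 ≤ fn u x
  tendsto_ae : ∀ᵐ x ∂(volume.restrict Ω), Tendsto (fun k => |fn (w k) x|) atTop (𝓝 (fn u x))

namespace AbsLimit

variable {w : ℕ → W0 Ω} {u : W0 Ω} {L : ℝ}

lemma smul (H : AbsLimit w u L) {t : ℝ} (ht : 0 ≤ t) :
    AbsLimit (fun k => t • w k) (t • u) (t ^ n * L) where
  tendsto_normPow := by
    simp only [normPow_smul_of_nonneg ht]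
    exact H.tendsto_normPow.const_mul _
  normPow_le := by
    rw [normPow_smul_of_nonneg ht]
    exact mul_le_mul_of_nonneg_left H.normPow_le (by positivity)
  nonneg := by
    filter_upwards [fn_smul t u, H.nonneg] with x h1 h2
    rw [h1]; positivity
  tendsto_ae := by
    filter_upwards [fn_smul t u, ae_all_iff.2 fun k => fn_smul t (w k), H.tendsto_ae]
      with x h1 h2 h3
    simp only [h1, h2, abs_mul, abs_of_nonneg ht]
    exact h3.const_mul t

lemma tendsto_integral_mul_comp (H : AbsLimit w u L) (hΩ : volume Ω ≠ ⊤) (hβ : 0 < β)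
    (hβn : β < (n : ℝ) / ((n : ℝ) - 1)) {f : E n → ℝ} {γ : ℝ} (hγ : 1 < γ)
    (hf : MemLp f (ENNReal.ofReal γ) (volume.restrict Ω)) {F : ℝ → ℝ} (hF : Continuous F)
    (hFg : ExpGrowth β F) (hFe : ∀ s, F |s| = F s) :
    Tendsto (fun k => ∫ x in Ω, f x * F (fn (w k) x)) atTop
      (𝓝 (∫ x in Ω, f x * F (fn u x))) := by
  obtain ⟨K, hK⟩ := H.tendsto_normPow.bddAbove_range
  have hw : ∀ k, normPow (w k) ≤ K := fun k => hK (mem_range_self k)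
  refine Kirchhoff.tendsto_integral_mul_comp hΩ hβ hβn hγ hf hF hFg hFe hw
    (H.normPow_le.trans (le_of_tendsto' H.tendsto_normPow hw)) ?_
  filter_upwards [H.nonneg, H.tendsto_ae] with x h1 h2
  rwa [abs_of_nonneg h1]

lemma tendsto_hInt (H : AbsLimit w u L) (A : Admissible Ω a b p q β h) :
    Tendsto (fun k => hInt q h (w k)) atTop (𝓝 (hInt q h u)) :=
  H.tendsto_integral_mul_comp A.vol A.β_pos A.β_lt A.one_lt_γ A.memLp
    (continuous_abs_rpow (by linarith [A.q_pos]))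
    (expGrowth_rpow A.β_pos (by linarith [A.q_pos])) fun s => by rw [abs_abs]

lemma tendsto_gssInt (H : AbsLimit w u L) (A : Admissible Ω a b p q β h) :
    Tendsto (fun k => gssInt p q β (w k)) atTop (𝓝 (gssInt p q β u)) := by
  have := H.tendsto_integral_mul_comp A.vol A.β_pos A.β_lt one_lt_two (memLp_one A.vol)
    (continuous_gss A.p_pos A.β_pos) (expGrowth_gss (q := q) A.p_pos A.β_pos) gss_abs
  simp only [one_mul] at this
  exact this

lemma tendsto_primInt (H : AbsLimit w u L) (A : Admissible Ω a b p q β h) :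
    Tendsto (fun k => primInt p β (w k)) atTop (𝓝 (primInt p β u)) := by
  have := H.tendsto_integral_mul_comp A.vol A.β_pos A.β_lt one_lt_two (memLp_one A.vol)
    (continuous_G A.p_pos A.β_pos) (expGrowth_G A.p_pos A.one_lt_β) G_abs
  simp only [one_mul] at this
  exact this

lemma tendsto_J (H : AbsLimit w u L) (A : Admissible Ω a b p q β h) :
    Tendsto (fun k => J a b p q β lam h (w k)) atTop
      (𝓝 (1 / (n : ℝ) * (a / 2 * L ^ 2 + b * L) - lam / (q + 1) * hInt q h u - primInt p β u)) := by
  simp only [J_eq]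
  exact (((((H.tendsto_normPow.pow 2).const_mul _).add (H.tendsto_normPow.const_mul _)).const_mul
    _).sub ((H.tendsto_hInt A).const_mul _)).sub (H.tendsto_primInt A)

/-- The energy is lower semicontinuous. -/
lemma J_le (H : AbsLimit w u L) (A : Admissible Ω a b p q β h) {I : ℝ}
    (hI : Tendsto (fun k => J a b p q β lam h (w k)) atTop (𝓝 I)) : J a b p q β lam h u ≤ I := by
  rw [tendsto_nhds_unique hI (H.tendsto_J A), J_eq]
  have h1 := normPow_nonneg u
  have h2 := H.normPow_le
  have := A.a_pos
  have := A.b_pos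
  gcongr

end AbsLimit

lemma exists_absLimit (hΩ : volume Ω ≠ ⊤) (w : ℕ → W0 Ω) (K : ℝ) (hw : ∀ k, normPow (w k) ≤ K) :
    ∃ (σ : ℕ → ℕ) (u : W0 Ω) (L : ℝ), StrictMono σ ∧ AbsLimit (fun k => w (σ k)) u L := by
  obtain ⟨σ, u, L, h1, h2, h3, h4, h5⟩ := exists_subseq_tendsto_abs hΩ w K hw
  exact ⟨σ, u, L, h1, h2, h3, h4, h5⟩

lemma integral_comp_fn_eq_zero {u : W0 Ω} (hu : fn u =ᵐ[volume.restrict Ω] 0) (f : E n → ℝ)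
    {F : ℝ → ℝ} (hF : F 0 = 0) : ∫ x in Ω, f x * F (fn u x) = 0 := by
  refine integral_eq_zero_of_ae ?_
  filter_upwards [hu] with x hx
  simp [hx, hF]

lemma functionals_eq_zero (A : Admissible Ω a b p q β h) {u : W0 Ω}
    (hu : fn u =ᵐ[volume.restrict Ω] 0) :
    hInt q h u = 0 ∧ gssInt p q β u = 0 ∧ primInt p β u = 0 := by
  have hp := A.p_pos
  have hq := A.q_pos
  refine ⟨integral_comp_fn_eq_zero hu h (F := fun s => |s| ^ (q + 1)) ?_, ?_, ?_⟩
  · simp [Real.zero_rpow (by linarith : q + 1 ≠ 0)]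
  · have := integral_comp_fn_eq_zero hu (fun _ => 1) (F := gss p q β)
      (by simp [gss, gs, Real.zero_rpow (by linarith : p + 2 ≠ 0)])
    simp only [one_mul] at this
    exact this
  · have := integral_comp_fn_eq_zero hu (fun _ => 1) (F := G p β) (by simp [G])
    simp only [one_mul] at this
    exact this

/-- On the Nehari set the function `u` alone determines the energy: `P(u) = 0` recovers `‖u‖ⁿ`, so no
uniqueness of weak gradients is needed to tell two points apart. -/
lemma J_eq_of_fn_eq (A : Admissible Ω a b p q β h) {u v : W0 Ω}
    (huv : fn u =ᵐ[volume.restrict Ω] fn v) (hu : nehariP a b p q β lam h u = 0)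
    (hv : nehariP a b p q β lam h v = 0) : J a b p q β lam h u = J a b p q β lam h v := by
  have e1 : hInt q h u = hInt q h v :=
    integral_congr_ae (by filter_upwards [huv] with x hx; rw [hx])
  have e2 : gInt p β u = gInt p β v :=
    integral_congr_ae (by filter_upwards [huv] with x hx; rw [hx])
  have e3 : primInt p β u = primInt p β v :=
    integral_congr_ae (by filter_upwards [huv] with x hx; rw [hx])
  rw [nehariP, e1, e2] at hu
  rw [nehariP] at hv
  have hN : normPow u = normPow v := by
    have h1 : (normPow u - normPow v) * (a * (normPow u + normPow v) + b) = 0 := by linarith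
    have h2 : 0 < a * (normPow u + normPow v) + b := by
      have := A.a_pos
      have := A.b_pos
      have := normPow_nonneg u
      have := normPow_nonneg v
      positivity
    linarith [(mul_eq_zero.1 h1).resolve_right h2.ne']
  rw [J_eq, J_eq, hN, e1, e3]

lemma exists_isMinOn_ball (A : Admissible Ω a b p q β h) (hl : 0 < lam) {ρ : ℝ} (hρ : 0 < ρ) :
    ∃ u : W0 Ω, normPow u ≤ ρ ∧ (∀ᵐ x ∂(volume.restrict Ω), 0 ≤ fn u x) ∧
      ∀ w : W0 Ω, normPow w ≤ ρ → J a b p q β lam h u ≤ J a b p q β lam h w := by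
  set S := J a b p q β lam h '' {w : W0 Ω | normPow w ≤ ρ} with hS
  have hne : S.Nonempty := ⟨_, 0, by
    change normPow (0 : W0 Ω) ≤ ρ
    rw [normPow_zero]; exact hρ.le, rfl⟩
  obtain ⟨B₁, hB₁, hb₁⟩ := exists_bound_hInt A ρ
  obtain ⟨B₂, hB₂, hb₂⟩ := exists_bound_gInt A ρ
  have hbdd : BddBelow S := by
    refine ⟨-(lam / (q + 1) * B₁ + B₂), ?_⟩
    rintro _ ⟨w, hw, rfl⟩
    have hw : normPow w ≤ ρ := hw
    rw [J_eq]
    have h1 : lam / (q + 1) * hInt q h w ≤ lam / (q + 1) * B₁ := by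
      have := A.q_pos
      exact mul_le_mul_of_nonneg_left ((le_abs_self _).trans (hb₁ w hw)) (by positivity)
    have h2 : primInt p β w ≤ B₂ := by
      have h3 := primInt_smul_le A zero_le_one le_rfl w
      rw [one_smul, Real.one_rpow, one_mul] at h3
      exact h3.trans (hb₂ w hw)
    have h4 : 0 ≤ 1 / (n : ℝ) * (a / 2 * normPow w ^ 2 + b * normPow w) := by
      have := A.a_pos
      have := A.b_pos
      have := normPow_nonneg w
      positivity
    linarith
  obtain ⟨s, -, hs, hmem⟩ := exists_seq_tendsto_sInf hne hbdd
  choose w hw hws using hmem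
  obtain ⟨σ, u, L, hσ, H⟩ := exists_absLimit A.vol w ρ hw
  refine ⟨u, H.normPow_le.trans (le_of_tendsto' H.tendsto_normPow fun k => hw _), H.nonneg,
    fun v hv => ?_⟩
  have hJ : Tendsto (fun k => J a b p q β lam h (w (σ k))) atTop (𝓝 (sInf S)) := by
    simp only [hws]
    exact hs.comp hσ.tendsto_atTop
  exact (H.J_le A hJ).trans (csInf_le hbdd ⟨v, hv, rfl⟩)

lemma dJ_nonneg_of_isMinOn_ball (A : Admissible Ω a b p q β h) {ρ : ℝ} {u : W0 Ω}
    (hu : normPow u < ρ)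
    (hmin : ∀ w : W0 Ω, normPow w ≤ ρ → J a b p q β lam h u ≤ J a b p q β lam h w) (φ : W0 Ω) :
    0 ≤ dJ a b p q β lam h u φ := by
  have hε : Tendsto (fun ε : ℝ => ε) (𝓝[>] 0) (𝓝 0) := nhdsWithin_le_nhds
  have hε0 : ∀ᶠ ε : ℝ in 𝓝[>] 0, 0 < ε := self_mem_nhdsWithin
  have h1 := tendsto_diffQuot_J (lam := lam) A u φ (t := fun _ => 1) tendsto_const_nhds hε
    (hε0.mono fun ε h => h.ne')
  have h2 := tendsto_normPow_ray u φ (t := fun _ => 1) tendsto_const_nhds hε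
  refine ge_of_tendsto h1 ?_
  filter_upwards [h2.eventually_le_const hu, hε0] with ε h3 h4
  rw [one_smul] at h3 ⊢
  rw [one_smul]
  exact div_nonneg (sub_nonneg.2 (hmin _ h3)) h4.le

lemma nehariP_eq_zero_of_dJ (A : Admissible Ω a b p q β h) {u : W0 Ω}
    (hu : ∀ φ, 0 ≤ dJ a b p q β lam h u φ) : nehariP a b p q β lam h u = 0 := by
  have h1 := hu u
  have h2 := hu ((-1 : ℝ) • u)
  rw [dJ_smul] at h2
  rw [← dJ_self A]
  linarith

lemma nehariD_zero : nehariD a b p q β (0 : W0 Ω) = -gssInt p q β (0 : W0 Ω) := by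
  rw [nehariD, normPow_zero]; ring

lemma normPow_pos_of_nehariD (A : Admissible Ω a b p q β h) {u : W0 Ω}
    (hu : nehariD a b p q β u ≠ 0) : 0 < normPow u := by
  refine normPow_pos_of_ne A ?_
  rintro rfl
  rw [nehariD_zero, (functionals_eq_zero A (Lp.coeFn_zero _ _ _)).2.1, neg_zero] at hu
  exact hu rfl

/-- Every nonzero ray meets the sphere of radius `t₀`. -/
lemma exists_smul_normPow_eq {u : W0 Ω} (hu : 0 < normPow u) {t₀ : ℝ} (ht₀ : 0 < t₀) :
    ∃ t : ℝ, 0 < t ∧ normPow (t • u) = t₀ ^ n ∧ (t₀ ^ n < normPow u → t < 1) := by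
  have hn0 : (n : ℝ) ≠ 0 := by have := hn.out; exact_mod_cast (by omega : n ≠ 0)
  have hn1 : n ≠ 0 := by exact_mod_cast hn0
  set s := normPow u ^ (1 / (n : ℝ)) with hs
  have hs0 : 0 < s := Real.rpow_pos_of_pos hu _
  have hsn : s ^ n = normPow u := by
    rw [hs, ← Real.rpow_natCast, ← Real.rpow_mul hu.le, one_div_mul_cancel hn0, Real.rpow_one]
  refine ⟨t₀ / s, by positivity, ?_, fun hlt => ?_⟩
  · rw [normPow_smul_of_nonneg (by positivity), div_pow, hsn, div_mul_cancel₀ _ hu.ne']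
  · rw [div_lt_one hs0]
    rw [← hsn] at hlt
    exact lt_of_pow_lt_pow_left₀ n hs0.le hlt

/-- The minimizer of the energy on the ball is a solution, lies in `N⁺` and, as `N⁺` is contained in
the ball, minimizes the energy there. -/
lemma exists_solution_nehariPlus (hΩ : IsOpen Ω) (A : Admissible Ω a b p q β h)
    (hpos : ¬ ∀ᵐ x ∂(volume.restrict Ω), h x ≤ 0) (hl : 0 < lam) {t₀ c₀ : ℝ} (ht₀ : 0 < t₀)
    (hc₀ : 0 < c₀)
    (hsphere : ∀ u : W0 Ω, normPow u = t₀ ^ n → c₀ ≤ J a b p q β lam h u) :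
    ∃ u : W0 Ω, J a b p q β lam h u < 0 ∧ ¬ (fn u =ᵐ[volume.restrict Ω] 0) ∧
      IsSolution a b p q β lam h u ∧
      u ∈ NehariPlus a b p q β lam h ∧
      IsMinOn (J a b p q β lam h) (NehariPlus a b p q β lam h) u := by
  have hn1 : n ≠ 0 := by have := hn.out; omega
  obtain ⟨u, huρ, hu0, hmin⟩ := exists_isMinOn_ball A hl (pow_pos ht₀ n)
  obtain ⟨u₀, hu₀⟩ := exists_hInt_pos hΩ A hpos
  have hJ : J a b p q β lam h u < 0 := by
    have h1 : ∀ᶠ t in 𝓝[>] (0 : ℝ), normPow (t • u₀) ≤ t₀ ^ n := by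
      have : Continuous fun t : ℝ => normPow (t • u₀) :=
        continuous_normPow.comp (continuous_id.smul continuous_const)
      have h0 := this.tendsto 0
      rw [normPow_smul, abs_zero, zero_pow hn1, zero_mul] at h0
      exact nhdsWithin_le_nhds (h0.eventually_le_const (pow_pos ht₀ n))
    obtain ⟨t, h2, h3⟩ := ((eventually_J_smul_neg A hl hu₀).and h1).exists
    exact (hmin _ h3).trans_lt h2
  have huρ' : normPow u < t₀ ^ n := lt_of_le_of_ne huρ fun he =>
    (hsphere u he).not_gt (hJ.trans hc₀)
  have hdJ := dJ_nonneg_of_isMinOn_ball A huρ' hmin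
  have hP := nehariP_eq_zero_of_dJ A hdJ
  have hfn : ¬ (fn u =ᵐ[volume.restrict Ω] 0) := by
    intro hfn
    obtain ⟨e1, -, e3⟩ := functionals_eq_zero A hfn
    rw [J_eq, e1, e3, mul_zero, sub_zero, sub_zero] at hJ
    have : 0 ≤ 1 / (n : ℝ) * (a / 2 * normPow u ^ 2 + b * normPow u) := by
      have := A.a_pos
      have := A.b_pos
      have := normPow_nonneg u
      positivity
    linarith
  have hN := normPow_pos_of_ne A (ne_zero_of_fn hfn)
  have F := fiberProfile (lam := lam) A hN
  -- For `D(u) < 0` the energy would be smaller at `s u` with `s` slightly less than `1`.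
  have hD0 : 0 ≤ nehariD a b p q β u := by
    by_contra! hD
    obtain ⟨s, hs0, hs1, hs⟩ := F.exists_ψ_pos (by simp [hP]) (by simpa using hD)
    obtain ⟨ξ, hξ, c, hc, he⟩ := F.exists_slope hs0.le hs1
    have h1 := mul_pos hc (hs ξ hξ)
    have h2 : J a b p q β lam h u ≤ fiber a b p q β lam h u s := by
      refine hmin _ (le_trans ?_ huρ)
      rw [normPow_smul_of_nonneg hs0.le]
      exact mul_le_of_le_one_left hN.le (pow_le_one₀ hs0.le hs1.le)
    have h3 : fiber a b p q β lam h u 1 = J a b p q β lam h u := by rw [fiber, one_smul]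
    linarith
  have hD : 0 < nehariD a b p q β u := by
    refine lt_of_le_of_ne hD0 fun hD => ?_
    obtain ⟨t, ht, htN, -⟩ := exists_smul_normPow_eq hN ht₀
    exact (hsphere _ htN).not_gt
      ((J_smul_nonpos_of_eq_zero A hN hP hD.symm ht.le).trans_lt hc₀)
  refine ⟨u, hJ, hfn, ⟨isWeakSolution_of_dJ A hdJ, hu0⟩, (mem_nehariPlus_iff A u).2 ⟨hP, hD⟩, ?_⟩
  intro w hw
  obtain ⟨hwP, hwD⟩ := (mem_nehariPlus_iff A w).1 hw
  have hwN := normPow_pos_of_nehariD A hwD.ne'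
  refine hmin w ?_
  by_contra! hc
  obtain ⟨t, ht, htN, ht1⟩ := exists_smul_normPow_eq hwN ht₀
  exact (hsphere _ htN).not_gt
    ((J_smul_nonpos_of_le_one A hwN hwP hwD.le ht.le (ht1 hc).le).trans_lt hc₀)

lemma tendsto_nehariP_line (A : Admissible Ω a b p q β h) (u w : W0 Ω) :
    Tendsto (fun ε : ℝ => nehariP a b p q β lam h (u + ε • w)) (𝓝[>] 0)
      (𝓝 (nehariP a b p q β lam h u)) := by
  have hε : Tendsto (fun ε : ℝ => ε) (𝓝[>] 0) (𝓝 0) := nhdsWithin_le_nhds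
  have hε0 : ∀ᶠ ε : ℝ in 𝓝[>] 0, ε ≠ 0 := by
    filter_upwards [self_mem_nhdsWithin] with ε h using (ne_of_gt h)
  have key : ∀ {Φ : W0 Ω → ℝ} {d : ℝ}, Tendsto (fun ε : ℝ => (Φ ((1 : ℝ) • (u + ε • w)) -
      Φ ((1 : ℝ) • u)) / ε) (𝓝[>] 0) (𝓝 d) →
      Tendsto (fun ε : ℝ => Φ (u + ε • w)) (𝓝[>] 0) (𝓝 (Φ u)) := by
    intro Φ d hΦ
    have h1 := (hε.mul hΦ).const_add (Φ u)
    rw [zero_mul, add_zero] at h1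
    refine h1.congr' ?_
    filter_upwards [hε0] with ε h0
    rw [mul_div_cancel₀ _ h0, one_smul, one_smul]; ring
  have h1 := key (tendsto_diffQuot_normPow u w (t := fun _ => 1) tendsto_const_nhds hε hε0)
  have h2 := key (tendsto_diffQuot_hInt A u w (t := fun _ => 1) tendsto_const_nhds hε hε0)
  have h3 := key (tendsto_diffQuot_gInt A u w (t := fun _ => 1) tendsto_const_nhds hε hε0)
  exact ((((h1.pow 2).const_mul a).add (h1.const_mul b)).sub (h2.const_mul lam)).sub h3

/-- Near a point of `N⁻`, rays still meet `N⁻` near their point of parameter `1`. -/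
lemma eventually_exists_smul_mem_nehariMinus (A : Admissible Ω a b p q β h) {v : W0 Ω}
    (hv : v ∈ NehariMinus a b p q β lam h) (φ : W0 Ω) {s r : ℝ} (hs : s < 1) (hr : 1 < r) :
    ∀ᶠ ε in 𝓝[>] (0 : ℝ), ∃ t ∈ Ioo s r, 0 < t ∧ t • (v + ε • φ) ∈ NehariMinus a b p q β lam h := by
  obtain ⟨hP, hD⟩ := (mem_nehariMinus_iff A v).1 hv
  have hN := normPow_pos_of_nehariD A hD.ne
  have F := fiberProfile (lam := lam) A hN
  obtain ⟨s₀, hs₀, hs₁, hpos⟩ := F.exists_ψ_pos (by simp [hP]) (by simpa using hD)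
  obtain ⟨s', hs', hs'1⟩ := exists_between (max_lt hs hs₁)
  have hs'0 : 0 < s' := hs₀.trans ((le_max_right _ _).trans_lt hs')
  have hPs : 0 < nehariP a b p q β lam h (s' • v) :=
    pos_of_mul_pos_right (hpos s' ⟨(le_max_right _ _).trans_lt hs', hs'1⟩)
      (Real.rpow_nonneg hs'0.le _)
  have hPr : nehariP a b p q β lam h (r • v) < 0 :=
    neg_of_mul_neg_right (F.ψ_neg_of_lt (by simp [hP]) (by simpa using hD.le) hr)
      (Real.rpow_nonneg (by linarith) _)
  have hε : Tendsto (fun ε : ℝ => ε) (𝓝[>] 0) (𝓝 0) := nhdsWithin_le_nhds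
  have e0 := (tendsto_normPow_ray v φ (t := fun _ => 1) tendsto_const_nhds hε).eventually_const_lt hN
  have e1 := (tendsto_nehariP_line (lam := lam) A (s' • v) (s' • φ)).eventually_const_lt hPs
  have e2 := (tendsto_nehariP_line (lam := lam) A (r • v) (r • φ)).eventually_lt_const hPr
  filter_upwards [e0, e1, e2] with ε h0 h1 h2
  rw [one_smul] at h0
  rw [smul_comm ε, ← smul_add] at h1 h2
  obtain ⟨t, ht, hmem⟩ := exists_smul_mem_nehariMinus_of_sign A h0 hs'0 (hs'1.trans hr) h1 h2
  exact ⟨t, ⟨((le_max_left _ _).trans_lt hs').trans ht.1, ht.2⟩, hs'0.trans ht.1, hmem⟩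

/-- A minimizer on `N⁻` which maximizes the energy on its ray is a critical point: to first order
the energy of `v + ε φ` exceeds that of `v` by `(J(t (v + ε φ)) - J(t v)) / ε`, which is
nonnegative when `t (v + ε φ) ∈ N⁻`. -/
lemma dJ_nonneg_of_isMinOn_nehariMinus (A : Admissible Ω a b p q β h) {v : W0 Ω}
    (hv : v ∈ NehariMinus a b p q β lam h)
    (hmin : ∀ w ∈ NehariMinus (Ω := Ω) a b p q β lam h, J a b p q β lam h v ≤ J a b p q β lam h w)
    (hray : ∀ t : ℝ, 0 ≤ t → J a b p q β lam h (t • v) ≤ J a b p q β lam h v) (φ : W0 Ω) :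
    0 ≤ dJ a b p q β lam h v φ := by
  by_contra! hneg
  -- The limit is taken jointly in `ε` and `t`, so that `t` may be chosen in dependence on `ε`.
  have h3 : ∀ᶠ ε : ℝ in 𝓝[>] 0, 0 < ε := self_mem_nhdsWithin
  have h1 := tendsto_diffQuot_J (lam := lam) A v φ (l := 𝓝[>] (0 : ℝ) ×ˢ 𝓝 (1 : ℝ))
    (t := fun z : ℝ × ℝ => z.2) (ε := fun z : ℝ × ℝ => z.1) tendsto_snd
    (tendsto_fst.mono_right nhdsWithin_le_nhds)
    (tendsto_fst.eventually (h3.mono fun ε hε => hε.ne'))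
  obtain ⟨pa, hpa, pb, hpb, hab⟩ := eventually_prod_iff.1 (h1.eventually_lt_const hneg)
  obtain ⟨s, r, hsr, hsub⟩ := mem_nhds_iff_exists_Ioo_subset.1 hpb
  have h2 := eventually_exists_smul_mem_nehariMinus A hv φ hsr.1 hsr.2
  obtain ⟨ε, hεa, ⟨t, ht, ht0, hmem⟩, hε0⟩ := (hpa.and (h2.and h3)).exists
  refine (hab hεa (hsub ht)).not_ge (div_nonneg (sub_nonneg.2 ?_) hε0.le)
  exact (hray t ht0.le).trans (hmin _ hmem)

/-- The limit of a minimizing sequence in `N⁻`, projected back onto `N⁻` along its ray, is a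
minimizer: the projection does not raise the energy above the infimum, because each member of the
sequence maximizes the energy on its own ray. -/
lemma exists_solution_nehariMinus (hΩ : IsOpen Ω) (A : Admissible Ω a b p q β h)
    (hpos : ¬ ∀ᵐ x ∂(volume.restrict Ω), h x ≤ 0) (hl : 0 < lam) {t₀ c₀ : ℝ} (ht₀ : 0 < t₀)
    (hc₀ : 0 < c₀)
    (hsphere : ∀ u : W0 Ω, normPow u = t₀ ^ n → c₀ ≤ J a b p q β lam h u) :
    ∃ v : W0 Ω, 0 < J a b p q β lam h v ∧ ¬ (fn v =ᵐ[volume.restrict Ω] 0) ∧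
      IsSolution a b p q β lam h v ∧ v ∈ NehariMinus a b p q β lam h ∧
      IsMinOn (J a b p q β lam h) (NehariMinus a b p q β lam h) v := by
  have hproj : ∀ u : W0 Ω, ¬ (fn u =ᵐ[volume.restrict Ω] 0) →
      ∃ t : ℝ, 0 < t ∧ t • u ∈ NehariMinus a b p q β lam h := by
    intro u hu
    obtain ⟨t, ht, htN, -⟩ := exists_smul_normPow_eq (normPow_pos_of_ne A (ne_zero_of_fn hu)) ht₀
    exact exists_smul_mem_nehariMinus A hu ht (hc₀.trans_le (hsphere _ htN))
  have hlow : ∀ w ∈ NehariMinus (Ω := Ω) a b p q β lam h, c₀ ≤ J a b p q β lam h w ∧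
      ∀ t : ℝ, 0 ≤ t → J a b p q β lam h (t • w) ≤ J a b p q β lam h w := by
    intro w hw
    obtain ⟨hP, hD⟩ := (mem_nehariMinus_iff A w).1 hw
    have hN := normPow_pos_of_nehariD A hD.ne
    obtain ⟨t, ht, htN, -⟩ := exists_smul_normPow_eq hN ht₀
    have h1 : c₀ ≤ J a b p q β lam h w :=
      (le_max_iff.1 ((hsphere _ htN).trans (J_smul_le_max A hN hP hD ht.le))).resolve_left hc₀.not_ge
    refine ⟨h1, fun s hs => ?_⟩
    have h2 := J_smul_le_max (lam := lam) A hN hP hD hs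
    rwa [max_eq_right (hc₀.le.trans h1)] at h2
  set S := J a b p q β lam h '' NehariMinus (Ω := Ω) a b p q β lam h with hS
  have hne : S.Nonempty := by
    obtain ⟨u₀, hu₀⟩ := exists_hInt_pos hΩ A hpos
    obtain ⟨t, -, ht⟩ := hproj u₀ fun hfn => hu₀.ne' (functionals_eq_zero A hfn).1
    exact ⟨_, _, ht, rfl⟩
  have hbdd : BddBelow S := ⟨c₀, by rintro _ ⟨w, hw, rfl⟩; exact (hlow w hw).1⟩
  obtain ⟨s, hanti, hs, hmem⟩ := exists_seq_tendsto_sInf hne hbdd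
  choose w hw hws using hmem
  obtain ⟨K, hK⟩ := exists_bound_of_nehari A hl (s 0)
  obtain ⟨σ, u, L, hσ, H⟩ := exists_absLimit A.vol w K fun k =>
    hK _ ((mem_nehariMinus_iff A _).1 (hw k)).1 ((hws k).trans_le (hanti (Nat.zero_le k)))
  have hJ : Tendsto (fun k => J a b p q β lam h (w (σ k))) atTop (𝓝 (sInf S)) := by
    simp only [hws]
    exact hs.comp hσ.tendsto_atTop
  -- If `u = 0`, then `D(w k) < 0` forces `‖w k‖ → 0`, so `J(w k) → 0`, contradicting the lower bound.
  have hfn : ¬ (fn u =ᵐ[volume.restrict Ω] 0) := by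
    intro hfn
    obtain ⟨e1, e2, e3⟩ := functionals_eq_zero A hfn
    have hS0 := H.tendsto_gssInt A
    rw [e2] at hS0
    have hb : 0 < ((n : ℝ) - q - 1) * b := mul_pos (by linarith [A.q_lt]) A.b_pos
    have hL : L ≤ 0 := by
      have h1 : ((n : ℝ) - q - 1) * b * L ≤ 0 := by
        refine le_of_tendsto_of_tendsto' (H.tendsto_normPow.const_mul _) hS0 fun k => ?_
        have hD := ((mem_nehariMinus_iff A _).1 (hw (σ k))).2
        rw [nehariD] at hD
        have : 0 ≤ (2 * (n : ℝ) - q - 1) * a * normPow (w (σ k)) ^ 2 :=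
          mul_nonneg (mul_nonneg (by linarith [A.q_lt, A.n_pos]) A.a_pos.le) (sq_nonneg _)
        linarith
      by_contra! hc
      exact (mul_pos hb hc).not_ge h1
    have hL0 : L = 0 := le_antisymm hL ((normPow_nonneg u).trans H.normPow_le)
    have hJ0 := H.tendsto_J (lam := lam) A
    rw [hL0, e1, e3] at hJ0
    have := ge_of_tendsto' hJ0 fun k => (hlow _ (hw (σ k))).1
    norm_num at this
    linarith
  obtain ⟨t, ht, htmem⟩ := hproj u hfn
  have Ht := H.smul ht.le
  have hle : J a b p q β lam h (t • u) ≤ sInf S := by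
    refine le_trans ?_ (le_of_tendsto_of_tendsto' (Ht.tendsto_J (lam := lam) A) hJ
      fun k => (hlow _ (hw (σ k))).2 t ht.le)
    exact Ht.J_le A (Ht.tendsto_J A)
  have hmin : ∀ z ∈ NehariMinus (Ω := Ω) a b p q β lam h,
      J a b p q β lam h (t • u) ≤ J a b p q β lam h z :=
    fun z hz => hle.trans (csInf_le hbdd ⟨z, hz, rfl⟩)
  refine ⟨t • u, hc₀.trans_le (hlow _ htmem).1, fun h0 => hfn ?_, ⟨isWeakSolution_of_dJ A
    (dJ_nonneg_of_isMinOn_nehariMinus A htmem hmin (hlow _ htmem).2), Ht.nonneg⟩, htmem,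
    fun z hz => hmin z hz⟩
  filter_upwards [h0, fn_smul t u] with x h1 h2
  rw [h2] at h1
  exact (mul_eq_zero.1 h1).resolve_left ht.ne'

end Minimization

end Kirchhoff

end

theorem theorem3p1 (n : ℕ) [Fact (2 ≤ n)] (Ω : Set (Kirchhoff.E n))
    (hΩ_open : IsOpen Ω) (hΩ_conn : IsConnected Ω) (hΩ_bdd : Bornology.IsBounded Ω)
    (a b p q β : ℝ) (ha : 0 < a) (hb : 0 < b)
    (hq : 0 < q) (hqn : q < (n : ℝ) - 1) (hp : 2 * (n : ℝ) - 1 < p + 1)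
    (hβ : 1 < β) (hβn : β < (n : ℝ) / ((n : ℝ) - 1))
    (h : Kirchhoff.E n → ℝ)
    (hh : MemLp h (ENNReal.ofReal ((n : ℝ) / ((n : ℝ) - q - 1))) (volume.restrict Ω))
    (hh_pos : ¬ ∀ᵐ x ∂(volume.restrict Ω), h x ≤ 0) :
    ∃ lam₀ : ℝ, 0 < lam₀ ∧ ∀ lam : ℝ, 0 < lam → lam < lam₀ →
      ∃ u v : Kirchhoff.W0 Ω,
        ¬ (Kirchhoff.fn u =ᵐ[volume.restrict Ω] Kirchhoff.fn v) ∧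
        ¬ (Kirchhoff.fn u =ᵐ[volume.restrict Ω] 0) ∧
        ¬ (Kirchhoff.fn v =ᵐ[volume.restrict Ω] 0) ∧
        Kirchhoff.IsSolution a b p q β lam h u ∧
        Kirchhoff.IsSolution a b p q β lam h v ∧
        u ∈ Kirchhoff.NehariPlus a b p q β lam h ∧
        IsMinOn (Kirchhoff.J a b p q β lam h)
          (Kirchhoff.NehariPlus (Ω := Ω) a b p q β lam h) u ∧
        v ∈ Kirchhoff.NehariMinus a b p q β lam h ∧
        IsMinOn (Kirchhoff.J a b p q β lam h)
          (Kirchhoff.NehariMinus (Ω := Ω) a b p q β lam h) v := by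
  have A : Kirchhoff.Admissible Ω a b p q β h :=
    ⟨hΩ_bdd.measure_lt_top.ne, ha, hb, hq, hqn, hp, hβ, hβn, hh⟩
  obtain ⟨t₀, c₀, lam₀, ht₀, hc₀, hlam₀, hsphere⟩ := Kirchhoff.exists_sphere A
  refine ⟨lam₀, hlam₀, fun lam hl hl₀ => ?_⟩
  obtain ⟨u, huJ, hu0, husol, hu, humin⟩ :=
    Kirchhoff.exists_solution_nehariPlus hΩ_open A hh_pos hl ht₀ hc₀ (hsphere lam hl hl₀)
  obtain ⟨v, hvJ, hv0, hvsol, hv, hvmin⟩ :=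
    Kirchhoff.exists_solution_nehariMinus hΩ_open A hh_pos hl ht₀ hc₀ (hsphere lam hl hl₀)
  refine ⟨u, v, fun huv => ?_, hu0, hv0, husol, hvsol, hu, humin, hv, hvmin⟩
  have := Kirchhoff.J_eq_of_fn_eq A huv ((Kirchhoff.mem_nehariPlus_iff A u).1 hu).1
    ((Kirchhoff.mem_nehariMinus_iff A v).1 hv).1
  linarith
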